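/- **Setting.** Let $n\ge 2$, $t_0\in\mathbb R$, $a_0,\dots,a_{n-1}\in\mathbb C$, and let $r_0,\dots,r_{n-1}:[t_0,\infty)\to\mathbb C$ be locally integrable; put $a_n=1$, $r_n=0$. Consider $$y^{(n)}+\sum_{i=0}^{n-1}(a_i+r_i(t))\,y^{(i)}=0\quad\text{on }[t_0,\infty),\tag{1}$$ whose solutions are functions $y\in C^{n-1}$ with $y^{(n-1)}$ locally absolutely continuous that satisfy the equation almost everywhere. Let $P(a;x)=\sum_{i=0}^n a_ix^i$ and $P(r(t);x)=\sum_{i=0}^{n-1}r_i(t)x^i$. Assume that $P(a;x)$ has $n$ roots $\lambda,\lambda_1,\dots,\lambda_{n-1}$ with pairwise distinct real parts, and put $\gamma_j=\lambda_j-\lambda$, $\alpha_j=\Re\gamma_j$, $\Gamma_j=\prod_{k\ne j}(\gamma_j-\gamma_k)$, $\tilde\alpha_j=\sum_{i=0}^{n-2}|\alpha_j|^i$. For $\Re\omega\neq0$ let $g_\omega(t,s)=-\operatorname{sgn}(\Re\omega)e^{\omega(t-s)}$ if $\operatorname{sgn}(\Re\omega)(t-s)<0$ and $g_\omega(t,s)=0$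 otherwise. For $T\ge t_0$ let $$G^T_\omega[f](t)=\int_T^\infty g_\omega(t,s)f(s)\,ds,\qquad I^T_\omega[f](t)=\int_T^\infty|g_\omega(t,s)f(s)|\,ds\in[0,\infty],\qquad G^T[f]=\sum_{j=1}^{n-1}\Gamma_j^{-1}G^T_{\gamma_j}[f]$$ (the first integral is an improper one), and omit the superscript when $T=t_0$. With the complete Bell polynomials $B_0=1$, $B_{i+1}(x_1,\dots,x_{i+1})=\sum_{j=0}^i\binom ij B_{i-j}(x_1,\dots,x_{i-j})x_{j+1}$, put, for $Z=(z,z',\dots,z^{(n-2)})$, $$\mathcal L(t,z)=\sum_{k=1}^{n-1}\frac1{k!}\frac{\partial^kP(r(t);\lambda)}{\partial x^k}z^{(k-1)},\qquad \mathcal F(t,Z)=\sum_{i=2}^n\sum_{j=0}^{n-i}\binom{i+j}{j}(a_{i+j}+r_{i+j}(t))\lambda^j\bigl(B_i(z,z',\dots,z^{(i-1)})-z^{(i-1)}\bigr),$$ and let $R(\cdot,z)=\mathcal L(\cdot,z)+\mathcal F(\cdot,Z)$, $\theta=-G[P(r;\lambda)]$, $\Theta=(\theta,\dots,\theta^{(n-2)})$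 and $\tilde{\mathcal F}(\cdot,U)=\mathcal F(\cdot,U+\Theta)-\mathcal F(\cdot,\Theta)$. **Theorem.** Assume that * the improper integrals defining $G_{\gamma_j}[P(r;\lambda)]$ converge for all $j$, and $\sum_{i=0}^{n-2}|G[P(r;\lambda)]^{(i)}(t)|\to0$ as $t\to\infty$; * $R(\cdot,\theta)\in L^p[t_0,\infty)$ and $\frac{\partial^k}{\partial x^k}P(r;\lambda)\in L^{p_k}[t_0,\infty)$ for $k=1,\dots,n$, with $p,p_k\in(1,2]$; * for some $0<\beta<\min_j|\alpha_j|$, $$\sum_{j=1}^{n-1}\sum_{k=1}^{n-1}\frac{\tilde\alpha_j}{|\Gamma_j|\,k!}\Bigl\|I_{\alpha_j-\operatorname{sgn}(\alpha_j)\beta}\Bigl[\frac{\partial^k}{\partial x^k}P(r;\lambda)\Bigr]\Bigr\|_\infty<\frac12 .$$ Then there is a solution $y$ of (1) on $[t_0,\infty)$ such that $y^{(i)}(t)/y(t)\to\lambda^i$ as $t\to\infty$ for $i=1,\dots,n-1$, and a $T\ge t_0$ such that $y$ has no zero on $[T,\infty)$ and the following holds. The function $u=y'/y-\lambda-\theta$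 on $[T,\infty)$, with $U=(u,\dots,u^{(n-2)})$, satisfies $$u=-G[R(\cdot,\theta)]-G^T[\mathcal L(\cdot,u)+\tilde{\mathcal F}(\cdot,U)]\quad\text{on }[T,\infty),$$ $\mathcal L(\cdot,u)\in L^1[T,\infty)$, and for $t\ge t_0$ $$y(t)=(1+\varepsilon(t))\,e^{\lambda(t-t_0)}\exp\Bigl(-\sum_{j=1}^{n-1}\frac1{\Gamma_j\gamma_j}G_{\gamma_j}[P(r;\lambda)+R(\cdot,\theta)](t)\Bigr)\exp\Bigl((-1)^n\prod_{k=1}^{n-1}(\lambda_k-\lambda)^{-1}\int_{t_0}^t[P(r(s);\lambda)+R(s,\theta(s))]\,ds\Bigr),$$ where, as $t\to\infty$, $$\varepsilon(t)=O\Bigl(\sum_{j=1}^{n-1}I^T_{\alpha_j}[\mathcal L(\cdot,u)+\tilde{\mathcal F}(\cdot,U)](t)+\int_t^\infty\bigl[|\mathcal L(s,u(s))|+|\tilde{\mathcal F}(s,U(s))|\bigr]ds\Bigr).$$ Here the bound is an element of $[0,\infty]$ and says nothing if it is infinite. If moreover $\theta^{(i)}\in L^{p/(p-1)}[t_0,\infty)$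 for $i=0,\dots,n-2$, then $\tilde{\mathcal F}(\cdot,U)\in L^1[T,\infty)$, so that the bound is finite and tends to $0$. -/

import Mathlib

open Filter Topology MeasureTheory Set
open scoped ENNReal NNReal

namespace PoincarePerron

noncomputable section

/-! Coefficients, polynomials and jets -/

/-- `P(a;x) = x^n + ∑_{i<n} a_i x^i`. -/
def charPoly {n : ℕ} (a : Fin n → ℂ) : Polynomial ℂ :=
  Polynomial.X ^ n + ∑ i : Fin n, Polynomial.C (a i) * Polynomial.X ^ (i : ℕ)

/-- `P(r(t);x) = ∑_{i<n} r_i(t) x^i`. -/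
def pertPoly {n : ℕ} (r : Fin n → ℝ → ℂ) (t : ℝ) : Polynomial ℂ :=
  ∑ i : Fin n, Polynomial.C (r i t) * Polynomial.X ^ (i : ℕ)

/-- `∂^k/∂x^k P(r(t);x)` at `x = lam`; the case `k = 0` is `P(r(t);lam)`. -/
def pertDeriv {n : ℕ} (r : Fin n → ℝ → ℂ) (lam : ℂ) (k : ℕ) (t : ℝ) : ℂ :=
  (Polynomial.derivative^[k] (pertPoly r t)).eval lam

/-- The sequence `u(t), u'(t), u''(t), …` of derivatives of `u` on `[t₀, ∞)`
(one-sided at `t₀`). -/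
def jet (t₀ : ℝ) (u : ℝ → ℂ) (t : ℝ) : ℕ → ℂ :=
  fun j => iteratedDerivWithin j u (Ici t₀) t

/-- `y` solves `y^(n) + ∑_{i<n} (a_i + r_i) y^(i) = 0` on `[t₀, ∞)` in the sense of Carathéodory
(the `r_i` are only locally integrable): `y` is of class `C^{n-1}` and `y^(n-1)` is an indefinite
integral of `-∑_{i<n} (a_i + r_i) y^(i)`, that is, it is locally absolutely continuous and the
equation holds almost everywhere. -/
def IsSolution {n : ℕ} (a : Fin n → ℂ) (r : Fin n → ℝ → ℂ) (t₀ : ℝ) (y : ℝ → ℂ) : Prop :=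
  ContDiffOn ℝ ((n - 1 : ℕ) : WithTop ℕ∞) y (Ici t₀) ∧
  ∀ t ∈ Ici t₀, jet t₀ y t (n - 1) =
    jet t₀ y t₀ (n - 1) - ∫ s in t₀..t, ∑ i : Fin n, (a i + r i s) * jet t₀ y s i

/-! The Riccati type equation -/

/-- Complete Bell polynomials: `bell x i = B_i(x 0, …, x (i-1))`. -/
def bell (x : ℕ → ℂ) : ℕ → ℂ
  | 0 => 1
  | i + 1 => ∑ j : Fin (i + 1), (i.choose j : ℂ) * bell x (i - j) * x j
termination_by i => i
decreasing_by omega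

/-- The linear part `𝓛(t, z) = ∑_{k=1}^{n-1} (1/k!) ∂^k P(r(t);lam) z^(k-1)`, as a function of
`Z = (z, z', …)`. -/
def linPart {n : ℕ} (r : Fin n → ℝ → ℂ) (lam : ℂ) (t : ℝ) (Z : ℕ → ℂ) : ℂ :=
  ∑ k ∈ Finset.Icc 1 (n - 1), ((k.factorial : ℂ))⁻¹ * pertDeriv r lam k t * Z (k - 1)

/-- The nonlinear part `𝓕(t, z, …, z^(n-2))`, with `a_n = 1` and `r_n = 0`. The difference
`B_i(z, …, z^(i-1)) - z^(i-1)` does not depend on `z^(i-1)`. -/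
def nonlinPart {n : ℕ} (a : Fin n → ℂ) (r : Fin n → ℝ → ℂ) (lam : ℂ) (t : ℝ) (Z : ℕ → ℂ) : ℂ :=
  ∑ i ∈ Finset.Icc 2 n, ∑ j ∈ Finset.range (n - i + 1),
    ((i + j).choose j : ℂ) * ((charPoly a).coeff (i + j) + (pertPoly r t).coeff (i + j))
      * lam ^ j * (bell Z i - Z (i - 1))

/-- `R(t, Z) = 𝓛(t, z) + 𝓕(t, Z)`. -/
def remPart {n : ℕ} (a : Fin n → ℂ) (r : Fin n → ℝ → ℂ) (lam : ℂ) (t : ℝ) (Z : ℕ → ℂ) : ℂ :=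
  linPart r lam t Z + nonlinPart a r lam t Z

/-- The shifted nonlinearity `𝓕(t, U + Θ) - 𝓕(t, Θ)`. -/
def shiftedNonlin {n : ℕ} (a : Fin n → ℂ) (r : Fin n → ℝ → ℂ) (lam : ℂ) (t : ℝ)
    (Θ U : ℕ → ℂ) : ℂ :=
  nonlinPart a r lam t (U + Θ) - nonlinPart a r lam t Θ

/-! Green's operators -/

/-- `g_ω(t,s) = -sgn(Re ω) e^{ω(t-s)}` if `sgn(Re ω) (t-s) < 0`, and `0` otherwise. -/
def greenKernel (ω : ℂ) (t s : ℝ) : ℂ :=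
  if Real.sign ω.re * (t - s) < 0 then
    -((Real.sign ω.re : ℝ) : ℂ) * Complex.exp (ω * ((t : ℂ) - (s : ℂ))) else 0

/-- The improper integral `∫_{t₀}^∞ g_ω(t,s) f(s) ds` converges for every `t ≥ t₀`. -/
def GreenConverges (t₀ : ℝ) (ω : ℂ) (f : ℝ → ℂ) : Prop :=
  ∀ t ∈ Ici t₀, ∃ l : ℂ,
    Tendsto (fun S : ℝ => ∫ s in t₀..S, greenKernel ω t s * f s) atTop (𝓝 l)

/-- `G_ω[f](t) = ∫_{t₀}^∞ g_ω(t,s) f(s) ds`, as an improper integral, which may converge only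
conditionally. -/
def greenOp (t₀ : ℝ) (ω : ℂ) (f : ℝ → ℂ) (t : ℝ) : ℂ :=
  limUnder atTop (fun S : ℝ => ∫ s in t₀..S, greenKernel ω t s * f s)

/-- `I_ω[f](t) = ∫_{t₀}^∞ |g_ω(t,s) f(s)| ds`, with values in `[0, ∞]`. -/
def absGreenOp (t₀ : ℝ) (ω : ℂ) (f : ℝ → ℂ) (t : ℝ) : ℝ≥0∞ :=
  ∫⁻ s in Ici t₀, ‖greenKernel ω t s * f s‖ₑ

/-- `Γ_j = ∏_{k ≠ j} (γ_j - γ_k)`. -/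
def Gam {m : ℕ} (γ : Fin m → ℂ) (j : Fin m) : ℂ :=
  ∏ k ∈ Finset.univ.erase j, (γ j - γ k)

/-- `G[f] = ∑_j Γ_j⁻¹ G_{γ_j}[f]`. -/
def greenSum {m : ℕ} (t₀ : ℝ) (γ : Fin m → ℂ) (f : ℝ → ℂ) (t : ℝ) : ℂ :=
  ∑ j : Fin m, (Gam γ j)⁻¹ * greenOp t₀ (γ j) f t

/-- `α̃_j = ∑_{i=0}^{n-2} |Re γ_j|^i`, where `m = n - 1` is the number of the `γ_j`. -/
def alphaTilde {m : ℕ} (γ : Fin m → ℂ) (j : Fin m) : ℝ :=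
  ∑ i ∈ Finset.range m, |(γ j).re| ^ i

/-- The smallness condition on the derivatives of `P(r;x)` at `lam`:
`∑_j ∑_{k=1}^{n-1} α̃_j / (|Γ_j| k!) ‖I_{α_j - sgn(α_j) β}[∂^k P(r;lam)]‖_∞ < 1/2`,
where `α_j = Re γ_j` and the supremum norm is taken over `[t₀, ∞)`. -/
def SmallnessCondition {n : ℕ} (r : Fin n → ℝ → ℂ) (lam : ℂ) (γ : Fin (n - 1) → ℂ)
    (t₀ β : ℝ) : Prop :=
  ∑ j : Fin (n - 1), ∑ k ∈ Finset.Icc 1 (n - 1),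
    ENNReal.ofReal (alphaTilde γ j / (‖Gam γ j‖ * (k.factorial : ℝ))) *
      (⨆ t ∈ Ici t₀,
        absGreenOp t₀ (((γ j).re - Real.sign (γ j).re * β : ℝ) : ℂ) (pertDeriv r lam k) t) < 1 / 2

/-- `θ = -G[P(r;lam)]`. -/
def theta {n m : ℕ} (r : Fin n → ℝ → ℂ) (lam : ℂ) (γ : Fin m → ℂ) (t₀ : ℝ) (t : ℝ) : ℂ :=
  -greenSum t₀ γ (pertDeriv r lam 0) t

/-- The function `t ↦ R(t, θ(t), θ'(t), …, θ^(n-2)(t))`. -/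
def remTheta {n m : ℕ} (a : Fin n → ℂ) (r : Fin n → ℝ → ℂ) (lam : ℂ) (γ : Fin m → ℂ)
    (t₀ : ℝ) (t : ℝ) : ℂ :=
  remPart a r lam t (jet t₀ (theta r lam γ t₀) t)

/-- For a function `u` on `[T, ∞)`, the function `t ↦ 𝓛(t, u(t))` on `[T, ∞)`. -/
def linU {n : ℕ} (r : Fin n → ℝ → ℂ) (lam : ℂ) (T : ℝ) (u : ℝ → ℂ) (t : ℝ) : ℂ :=
  linPart r lam t (jet T u t)

/-- For a function `u` on `[T, ∞)`, the function `t ↦ 𝓕(t, U(t) + Θ(t)) - 𝓕(t, Θ(t))` on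
`[T, ∞)`, where `U = (u, u', …)` and `Θ = (θ, θ', …)`. -/
def shiftU {n m : ℕ} (a : Fin n → ℂ) (r : Fin n → ℝ → ℂ) (lam : ℂ) (γ : Fin m → ℂ)
    (t₀ T : ℝ) (u : ℝ → ℂ) (t : ℝ) : ℂ :=
  shiftedNonlin a r lam t (jet t₀ (theta r lam γ t₀) t) (jet T u t)

end

end PoincarePerron

/-! Write y' = (lam + z) y. Then y^(i)/y is a Bell type polynomial in z, z', … (`expBell`), and
expanding P(a;x) + P(r;x) about lam turns the linear equation into Q(D)z = -(P(r;lam) + 𝓛 + 𝓕),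
where P(a;lam+x) = x Q(x) and Q has the roots γ_j (`sum_mul_expBell`). Since the γ_j are distinct
and off the imaginary axis, G = ∑ Γ_j⁻¹ G_{γ_j} is a right inverse of Q(D): the Lagrange identities
`sum_pow_div_Gam` keep the forcing out of the derivatives of G[f] below order n-1. With z = θ + u it
remains to solve the integral equation of u on some [T,∞).

This is a contraction (`exists_riccati_solution`) in the norm sup ‖U(t)‖/w(t). The weight w
(`exists_majorant`) is positive, lies in L^p, tends to zero, dominates the exponential averages of
R(·,θ), and varies at most at a fixed exponential rate, so that it can be pulled out of Green's
kernels at the cost of part of their decay. The Lipschitz constant is small for two reasons: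
functions in L^{p_k} have exponential averages over [T,∞) that become uniformly small as T grows,
and 𝓕 has no linear terms in Z while Θ and w are small near infinity. The resulting bound U = O(w),
with p and p_k at most 2, makes 𝓛(·,u) integrable by Young's inequality; for the shifted
nonlinearity the products Θ w have to be integrable as well.

Finally y = c exp ∫(lam + z) on [T,∞), continued back to t₀ by solving the linear system
(`exists_extension`). Because G_γ[f]' = γ G_γ[f] + f, the integral of z is explicit
(`integral_greenSum`). A suitable c leaves in the exponent of 1 + ε only Green terms at t and a
multiple of the tail ∫_t^∞ f, where f = 𝓛 + 𝓕̃ is the forcing, and |e^x - 1| ≤ 2|x| gives the bound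
(`exists_error_term`). -/

namespace PoincarePerron

/-! ### Calculus of indefinite integrals on a half-line -/

/-- `f` is, on `[T, ∞)`, an indefinite integral of the locally integrable function `f'`. -/
structure IsPrimitiveOn (T : ℝ) (f f' : ℝ → ℂ) : Prop where
  locInt : LocallyIntegrableOn f' (Ici T)
  eq : ∀ t ∈ Ici T, f t = f T + ∫ s in T..t, f' s

theorem intervalIntegrable_of_locallyIntegrableOn {E : Type*} [NormedAddCommGroup E]
    {f : ℝ → E} {T a b : ℝ}
    (h : LocallyIntegrableOn f (Ici T)) (ha : T ≤ a) (hb : T ≤ b) :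
    IntervalIntegrable f volume a b := by
  rw [intervalIntegrable_iff]
  refine (h.integrableOn_compact_subset (t := uIcc a b) ?_ isCompact_uIcc).mono_set uIoc_subset_uIcc
  intro x hx
  exact (le_min ha hb).trans hx.1

theorem isLocallyClosed_Ici {T : ℝ} : IsLocallyClosed (Ici T) := isClosed_Ici.isLocallyClosed

/-- An indefinite integral of an interval integrable function is absolutely continuous. -/
theorem absolutelyContinuousOnInterval_integral {E : Type*} [NormedAddCommGroup E]
    [NormedSpace ℝ E] {f : ℝ → E} {a b : ℝ}
    (h : IntervalIntegrable f volume a b) :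
    AbsolutelyContinuousOnInterval (fun x => ∫ s in a..x, f s) a b := by
  -- Increments of the integral of `f` are dominated by those of the integral of `‖f‖`, so the `δ`
  -- of the latter serves.
  have h1 := h.norm.absolutelyContinuousOnInterval_intervalIntegral (c := a) (by simp)
  rw [absolutelyContinuousOnInterval_iff] at h1 ⊢
  intro ε hε
  obtain ⟨δ, hδ, H⟩ := h1 ε hε
  refine ⟨δ, hδ, fun E hE hs => lt_of_le_of_lt (Finset.sum_le_sum fun i hi => ?_) (H E hE hs)⟩
  have hi' := (hE.1 i hi)
  have I1 : IntervalIntegrable f volume a (E.2 i).1 :=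
    h.mono_set (uIcc_subset_uIcc (by simp) hi'.1)
  have I2 : IntervalIntegrable f volume a (E.2 i).2 :=
    h.mono_set (uIcc_subset_uIcc (by simp) hi'.2)
  rw [dist_eq_norm, dist_eq_norm, intervalIntegral.integral_interval_sub_left I1 I2,
    intervalIntegral.integral_interval_sub_left I1.norm I2.norm, Real.norm_eq_abs]
  exact intervalIntegral.norm_integral_le_abs_integral_norm

namespace IsPrimitiveOn

variable {T : ℝ} {f g f' g' : ℝ → ℂ}

theorem intervalIntegrable (h : IsPrimitiveOn T f f') {a b : ℝ} (ha : T ≤ a) (hb : T ≤ b) :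
    IntervalIntegrable f' volume a b :=
  intervalIntegrable_of_locallyIntegrableOn h.locInt ha hb

theorem sub_eq (h : IsPrimitiveOn T f f') {a b : ℝ} (ha : T ≤ a) (hb : T ≤ b) :
    f b - f a = ∫ s in a..b, f' s := by
  rw [h.eq a ha, h.eq b hb, add_sub_add_left_eq_sub,
    intervalIntegral.integral_interval_sub_left (h.intervalIntegrable le_rfl hb)
      (h.intervalIntegrable le_rfl ha)]

theorem mono (h : IsPrimitiveOn T f f') {T' : ℝ} (hT : T ≤ T') : IsPrimitiveOn T' f f' :=
  ⟨h.locInt.mono_set (Ici_subset_Ici.2 hT), fun t ht => by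
    rw [← h.sub_eq hT (hT.trans ht)]; ring⟩

theorem congr (h : IsPrimitiveOn T f f') (hf : EqOn g f (Ici T)) (hf' : EqOn g' f' (Ici T)) :
    IsPrimitiveOn T g g' := by
  refine ⟨h.locInt.congr ?_, fun t ht => ?_⟩
  · exact (ae_restrict_iff' measurableSet_Ici).2 (Eventually.of_forall fun x hx => (hf' hx).symm)
  · rw [hf ht, hf self_mem_Ici, h.eq t ht]
    congr 1
    refine intervalIntegral.integral_congr fun s hs => (hf' ?_).symm
    rw [uIcc_of_le ht] at hs
    exact hs.1

theorem absolutelyContinuousOnInterval (h : IsPrimitiveOn T f f') {b : ℝ} (hb : T ≤ b) :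
    AbsolutelyContinuousOnInterval f T b := by
  have h1 := absolutelyContinuousOnInterval_integral (h.intervalIntegrable le_rfl hb)
  rw [absolutelyContinuousOnInterval_iff] at h1 ⊢
  intro ε hε
  obtain ⟨δ, hδ, H⟩ := h1 ε hε
  refine ⟨δ, hδ, fun E hE hs => lt_of_le_of_lt (Finset.sum_le_sum fun i hi => ?_) (H E hE hs)⟩
  have hi' := (hE.1 i hi)
  rw [uIcc_of_le hb] at hi'
  rw [h.eq _ hi'.1.1, h.eq _ hi'.2.1, dist_add_left]

theorem continuousOn (h : IsPrimitiveOn T f f') : ContinuousOn f (Ici T) := by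
  intro t ht
  have h1 := (h.absolutelyContinuousOnInterval (b := t + 1)
    (le_trans ht (by linarith))).continuousOn
  rw [uIcc_of_le (le_trans ht (by linarith))] at h1
  refine (h1 t ⟨ht, by linarith⟩).mono_of_mem_nhdsWithin ?_
  rw [← Ici_inter_Iic]
  exact inter_mem_nhdsWithin _ (Iic_mem_nhds (by linarith))

theorem ae_hasDerivAt (h : IsPrimitiveOn T f f') {b : ℝ} (hb : T ≤ b) :
    ∀ᵐ x, x ∈ uIcc T b → HasDerivAt f (f' x) x := by
  -- The endpoint is discarded because nothing is known of `f` to the left of `T`.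
  have hT : ∀ᵐ x : ℝ, x ≠ T := by simp [ae_iff, measure_singleton]
  filter_upwards [(h.intervalIntegrable le_rfl hb).ae_hasDerivAt_integral, hT] with x hx hxT hxm
  have h1 := (hx hxm T (by simp)).const_add (f T)
  rw [uIcc_of_le hb] at hxm
  refine h1.congr_of_eventuallyEq ?_
  filter_upwards [Ioi_mem_nhds (lt_of_le_of_ne hxm.1 hxT.symm)] with y hy
  exact h.eq y (mem_Ici.2 (le_of_lt hy))

theorem const (c : ℂ) : IsPrimitiveOn T (fun _ => c) (fun _ => 0) :=
  ⟨locallyIntegrableOn_zero, fun t _ => by simp⟩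

theorem add (hf : IsPrimitiveOn T f f') (hg : IsPrimitiveOn T g g') :
    IsPrimitiveOn T (fun t => f t + g t) (fun t => f' t + g' t) := by
  refine ⟨hf.locInt.add hg.locInt, fun t ht => ?_⟩
  rw [intervalIntegral.integral_add (hf.intervalIntegrable le_rfl ht)
    (hg.intervalIntegrable le_rfl ht), hf.eq t ht, hg.eq t ht]
  ring

/-- The product rule. -/
theorem mul (hf : IsPrimitiveOn T f f') (hg : IsPrimitiveOn T g g') :
    IsPrimitiveOn T (fun t => f t * g t) (fun t => f' t * g t + f t * g' t) := by
  have hl : LocallyIntegrableOn (fun t => f' t * g t + f t * g' t) (Ici T) :=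
    (hf.locInt.mul_continuousOn hg.continuousOn isLocallyClosed_Ici).add
      (hg.locInt.continuousOn_mul hf.continuousOn isLocallyClosed_Ici)
  refine ⟨hl, fun t ht => ?_⟩
  have hI : IntervalIntegrable (fun t => f' t * g t + f t * g' t) volume T t :=
    intervalIntegrable_of_locallyIntegrableOn hl le_rfl ht
  -- The product minus its candidate integral is absolutely continuous with derivative zero almost
  -- everywhere, hence constant.
  have hac : AbsolutelyContinuousOnInterval
      (fun t => f t * g t - ∫ s in T..t, (f' s * g s + f s * g' s)) T t :=
    ((hf.absolutelyContinuousOnInterval ht).fun_smul (hg.absolutelyContinuousOnInterval ht)).fun_sub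
      (absolutelyContinuousOnInterval_integral hI)
  obtain ⟨C, hC⟩ := hac.const_of_ae_hasDerivAt_zero (by
    filter_upwards [hf.ae_hasDerivAt ht, hg.ae_hasDerivAt ht, hI.ae_hasDerivAt_integral]
      with x h1 h2 h3 hx
    have := ((h1 hx).mul (h2 hx)).sub (h3 hx T (by simp))
    rwa [sub_self] at this)
  have e1 := hC T (by simp)
  have e2 := hC t (by simp)
  simp only [intervalIntegral.integral_same, sub_zero] at e1
  rw [← e1] at e2
  linear_combination e2

theorem const_mul (hf : IsPrimitiveOn T f f') (c : ℂ) :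
    IsPrimitiveOn T (fun t => c * f t) (fun t => c * f' t) :=
  ((const c).mul hf).congr (fun _ _ => rfl) (fun _ _ => by ring)

theorem sum {ι : Type*} {s : Finset ι} {F F' : ι → ℝ → ℂ}
    (h : ∀ i ∈ s, IsPrimitiveOn T (F i) (F' i)) :
    IsPrimitiveOn T (fun t => ∑ i ∈ s, F i t) (fun t => ∑ i ∈ s, F' i t) := by
  classical
  induction s using Finset.induction_on with
  | empty => simpa using const 0
  | insert i s hi ih =>
    simp only [Finset.sum_insert hi]
    exact (h i (Finset.mem_insert_self i s)).add
      (ih fun j hj => h j (Finset.mem_insert_of_mem hj))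

theorem hasDerivWithinAt (h : IsPrimitiveOn T f f') (hc : ContinuousOn f' (Ici T)) {t : ℝ}
    (ht : T ≤ t) : HasDerivWithinAt f (f' t) (Ici T) t := by
  -- Freezing `f'` to the left of `T` gives a function continuous on the whole line, so the
  -- two-sided fundamental theorem also covers the endpoint.
  have hc' : Continuous (fun s => f' (max s T)) :=
    hc.comp_continuous (by fun_prop) (fun s => le_max_right s T)
  have h1 := ((hc'.integral_hasStrictDerivAt T t).hasDerivAt.const_add (f T)).hasDerivWithinAt
    (s := Ici T)
  rw [max_eq_left ht] at h1
  refine h1.congr (fun x hx => ?_) ?_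
  all_goals
    rw [h.eq _ (by assumption)]
    congr 1
    refine intervalIntegral.integral_congr fun s hs => ?_
    rw [uIcc_of_le (by assumption)] at hs
    simp [max_eq_left hs.1]

theorem of_hasDerivWithinAt (hc : ContinuousOn f' (Ici T))
    (h : ∀ t ∈ Ici T, HasDerivWithinAt f (f' t) (Ici T) t) : IsPrimitiveOn T f f' := by
  refine ⟨hc.locallyIntegrableOn measurableSet_Ici, fun t ht => ?_⟩
  rw [intervalIntegral.integral_eq_sub_of_hasDerivAt_of_le ht]
  · ring
  · exact fun x hx => ((h x hx.1).continuousWithinAt).mono Icc_subset_Ici_self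
  · exact fun x hx => (h x hx.1.le).hasDerivAt (Ici_mem_nhds hx.1)
  · exact intervalIntegrable_of_locallyIntegrableOn (hc.locallyIntegrableOn measurableSet_Ici)
      le_rfl ht

theorem integral {φ : ℝ → ℂ} (h : LocallyIntegrableOn φ (Ici T)) (c : ℂ) :
    IsPrimitiveOn T (fun t => c + ∫ s in T..t, φ s) φ :=
  ⟨h, fun t _ => by simp⟩

theorem exp (hf : IsPrimitiveOn T f f') (hc : ContinuousOn f' (Ici T)) :
    IsPrimitiveOn T (fun t => Complex.exp (f t)) (fun t => f' t * Complex.exp (f t)) := by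
  refine of_hasDerivWithinAt (hc.mul (Complex.continuous_exp.comp_continuousOn hf.continuousOn))
    fun t ht => ?_
  simpa [mul_comm] using (hf.hasDerivWithinAt hc ht).cexp

end IsPrimitiveOn

/-- A chain of successive indefinite integrals gives the derivatives. -/
theorem jet_eq_of_chain {T : ℝ} {Y : ℕ → ℝ → ℂ} {k : ℕ}
    (h : ∀ i < k, IsPrimitiveOn T (Y i) (Y (i + 1))) (hk : ContinuousOn (Y k) (Ici T)) :
    (∀ i ≤ k, ∀ t ∈ Ici T, jet T (Y 0) t i = Y i t) ∧
      ContDiffOn ℝ (k : WithTop ℕ∞) (Y 0) (Ici T) := by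
  have hc : ∀ i ≤ k, ContinuousOn (Y i) (Ici T) := fun i hi => by
    rcases hi.eq_or_lt with rfl | hi
    · exact hk
    · exact (h i hi).continuousOn
  have hj : ∀ i ≤ k, ∀ t ∈ Ici T, jet T (Y 0) t i = Y i t := by
    intro i
    induction i with
    | zero => intro _ t _; simp [jet]
    | succ i ih =>
      intro hi t ht
      have ih' := ih (by omega)
      simp only [jet] at ih' ⊢
      rw [iteratedDerivWithin_succ, derivWithin_congr ih' (ih' t ht)]
      exact ((h i (by omega)).hasDerivWithinAt (hc _ hi) ht).derivWithin
        (uniqueDiffOn_Ici T t ht)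
  refine ⟨hj, ?_⟩
  have := contDiffOn_of_continuousOn_differentiableOn_deriv (𝕜 := ℝ) (n := (k : ℕ∞)) (f := Y 0)
    (s := Ici T) (fun i hi => (hc i (by exact_mod_cast hi)).congr (hj i (by exact_mod_cast hi)))
    (fun i hi t ht => ?_)
  · exact_mod_cast this
  · have hi' : i < k := by exact_mod_cast hi
    exact ((h i hi').hasDerivWithinAt (hc _ hi') ht).differentiableWithinAt.congr
      (hj i hi'.le) (hj i hi'.le t ht)

/-! ### Green's kernels and operators -/

theorem greenKernel_of_pos {ω : ℂ} (h : 0 < ω.re) (t s : ℝ) :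
    greenKernel ω t s = if t < s then -Complex.exp (ω * ((t : ℂ) - s)) else 0 := by
  simp [greenKernel, Real.sign_of_pos h]

theorem greenKernel_of_neg {ω : ℂ} (h : ω.re < 0) (t s : ℝ) :
    greenKernel ω t s = if s < t then Complex.exp (ω * ((t : ℂ) - s)) else 0 := by
  simp [greenKernel, Real.sign_of_neg h]

theorem norm_greenKernel_le (ω : ℂ) (t s : ℝ) :
    ‖greenKernel ω t s‖ ≤ Real.exp (-|ω.re| * |t - s|) := by
  rcases lt_trichotomy ω.re 0 with h | h | h
  · rw [greenKernel_of_neg h]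
    split_ifs with hs
    · rw [Complex.norm_exp, ← Complex.ofReal_sub, Complex.re_mul_ofReal, abs_of_neg h,
        abs_of_pos (sub_pos.2 hs), neg_neg]
    · simpa using (Real.exp_pos _).le
  · simp [greenKernel, h]
  · rw [greenKernel_of_pos h]
    split_ifs with hs
    · rw [norm_neg, Complex.norm_exp, ← Complex.ofReal_sub, Complex.re_mul_ofReal, abs_of_pos h,
        abs_of_neg (sub_neg.2 hs), neg_mul_neg]
    · simpa using (Real.exp_pos _).le

theorem norm_greenKernel_le_one (ω : ℂ) (t s : ℝ) : ‖greenKernel ω t s‖ ≤ 1 := by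
  refine (norm_greenKernel_le ω t s).trans (Real.exp_le_one_iff.2 ?_)
  rw [neg_mul, neg_nonpos]; positivity

theorem norm_greenKernel_re (ω : ℂ) (t s : ℝ) :
    ‖greenKernel (ω.re : ℂ) t s‖ = ‖greenKernel ω t s‖ := by
  simp only [greenKernel, Complex.ofReal_re]
  split_ifs
  · rw [norm_mul, norm_mul, Complex.norm_exp, Complex.norm_exp, ← Complex.ofReal_sub,
      Complex.re_mul_ofReal, Complex.re_mul_ofReal, Complex.ofReal_re]
  · rfl

theorem measurable_greenKernel (ω : ℂ) (t : ℝ) : Measurable (greenKernel ω t) := by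
  unfold greenKernel
  refine Measurable.ite ?_ (by fun_prop) measurable_const
  exact measurableSet_lt (by fun_prop) measurable_const

theorem locallyIntegrableOn_greenKernel_mul {T : ℝ} {f : ℝ → ℂ}
    (hf : LocallyIntegrableOn f (Ici T)) (ω : ℂ) (t : ℝ) :
    LocallyIntegrableOn (fun s => greenKernel ω t s * f s) (Ici T) := by
  intro x hx
  obtain ⟨u, hu, h⟩ := hf x hx
  refine ⟨u, hu, Integrable.mono h ?_ (Eventually.of_forall fun s => ?_)⟩
  · exact (measurable_greenKernel ω t).aestronglyMeasurable.mul h.aestronglyMeasurable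
  · rw [norm_mul]
    exact mul_le_of_le_one_left (norm_nonneg _) (norm_greenKernel_le_one ω t s)

theorem GreenConverges.tendsto {T : ℝ} {ω : ℂ} {f : ℝ → ℂ} (h : GreenConverges T ω f) {t : ℝ}
    (ht : T ≤ t) :
    Tendsto (fun S : ℝ => ∫ s in T..S, greenKernel ω t s * f s) atTop (𝓝 (greenOp T ω f t)) :=
  tendsto_nhds_limUnder (h t ht)

/-- The kernel lives on s < t only, so beyond `t` the truncated integral no longer depends on `S`
and the improper integral is a Volterra integral. -/
theorem integral_greenKernel_of_neg {ω : ℂ} (h : ω.re < 0) {T t S : ℝ} {f : ℝ → ℂ}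
    (hf : LocallyIntegrableOn f (Ici T)) (ht : T ≤ t) (hS : t ≤ S) :
    ∫ s in T..S, greenKernel ω t s * f s =
      Complex.exp (ω * t) * ∫ s in T..t, Complex.exp (-ω * s) * f s := by
  have hk := locallyIntegrableOn_greenKernel_mul hf ω t
  rw [← intervalIntegral.integral_add_adjacent_intervals
    (intervalIntegrable_of_locallyIntegrableOn hk le_rfl ht)
    (intervalIntegrable_of_locallyIntegrableOn hk ht (ht.trans hS)),
    intervalIntegral.integral_zero_ae (a := t), add_zero, ← intervalIntegral.integral_const_mul]
  · refine intervalIntegral.integral_congr_ae ?_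
    have : ∀ᵐ x : ℝ, x ≠ t := by simp [ae_iff, measure_singleton]
    filter_upwards [this] with s hs hsm
    rw [uIoc_of_le ht] at hsm
    rw [greenKernel_of_neg h, if_pos (lt_of_le_of_ne hsm.2 hs), ← mul_assoc, ← Complex.exp_add]
    ring_nf
  · refine Eventually.of_forall fun s hs => ?_
    rw [uIoc_of_le hS] at hs
    rw [greenKernel_of_neg h, if_neg (not_lt.2 hs.1.le), zero_mul]

theorem integral_greenKernel_of_pos {ω : ℂ} (h : 0 < ω.re) {T t S : ℝ} {f : ℝ → ℂ}
    (hf : LocallyIntegrableOn f (Ici T)) (ht : T ≤ t) (hS : t ≤ S) :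
    ∫ s in T..S, greenKernel ω t s * f s =
      -Complex.exp (ω * t) * ∫ s in t..S, Complex.exp (-ω * s) * f s := by
  have hk := locallyIntegrableOn_greenKernel_mul hf ω t
  rw [← intervalIntegral.integral_add_adjacent_intervals
    (intervalIntegrable_of_locallyIntegrableOn hk le_rfl ht)
    (intervalIntegrable_of_locallyIntegrableOn hk ht (ht.trans hS)),
    intervalIntegral.integral_zero_ae (a := T), zero_add, ← intervalIntegral.integral_const_mul]
  · refine intervalIntegral.integral_congr_ae (Eventually.of_forall fun s hsm => ?_)
    rw [uIoc_of_le hS] at hsm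
    rw [greenKernel_of_pos h, if_pos hsm.1, ← mul_assoc, neg_mul (Complex.exp (ω * t)), ← Complex.exp_add]
    ring_nf
  · refine Eventually.of_forall fun s hs => ?_
    rw [uIoc_of_le ht] at hs
    rw [greenKernel_of_pos h, if_neg (not_lt.2 hs.2), zero_mul]

/-- Both signs of Re ω give the variation of constants formula. For Re ω < 0 the constant is 0; for
Re ω > 0 the tail from `t` is the tail from `T` minus a finite piece, so the constant is read off at
`T`. Conditional convergence is enough. -/
theorem exists_greenOp_eq {T : ℝ} {ω : ℂ} {f : ℝ → ℂ} (hω : ω.re ≠ 0)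
    (hf : LocallyIntegrableOn f (Ici T)) (h : GreenConverges T ω f) :
    ∃ c : ℂ, ∀ t ∈ Ici T, greenOp T ω f t =
      Complex.exp (ω * t) * (c + ∫ s in T..t, Complex.exp (-ω * s) * f s) := by
  have he : LocallyIntegrableOn (fun s : ℝ => Complex.exp (-ω * s) * f s) (Ici T) :=
    hf.continuousOn_mul (by fun_prop) isLocallyClosed_Ici
  rcases lt_or_gt_of_ne hω with hω | hω
  · refine ⟨0, fun t ht => ?_⟩
    refine tendsto_nhds_unique (h.tendsto ht) (tendsto_const_nhds.congr' ?_)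
    filter_upwards [eventually_ge_atTop t] with S hS
    rw [integral_greenKernel_of_neg hω hf ht hS, zero_add]
  · refine ⟨Complex.exp (-ω * T) * greenOp T ω f T, fun t ht => ?_⟩
    have h1 : Tendsto (fun S : ℝ => Complex.exp (ω * t) *
        (Complex.exp (-ω * T) * (∫ s in T..S, greenKernel ω T s * f s) +
          ∫ s in T..t, Complex.exp (-ω * s) * f s)) atTop (𝓝 (Complex.exp (ω * t) *
        (Complex.exp (-ω * T) * greenOp T ω f T +
          ∫ s in T..t, Complex.exp (-ω * s) * f s))) :=
      (((h.tendsto le_rfl).const_mul _).add_const _).const_mul _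
    refine tendsto_nhds_unique (h.tendsto ht) (h1.congr' ?_)
    filter_upwards [eventually_ge_atTop t] with S hS
    rw [integral_greenKernel_of_pos hω hf ht hS,
      integral_greenKernel_of_pos hω hf le_rfl (le_trans ht hS),
      ← intervalIntegral.integral_add_adjacent_intervals
        (intervalIntegrable_of_locallyIntegrableOn he le_rfl ht)
        (intervalIntegrable_of_locallyIntegrableOn he ht (le_trans ht hS)), ← mul_assoc, mul_neg,
      ← Complex.exp_add]
    ring_nf
    simp
    ring

/-- `G_ω[f]` solves `g' = ω g + f`. -/
theorem isPrimitiveOn_greenOp {T : ℝ} {ω : ℂ} {f : ℝ → ℂ} (hω : ω.re ≠ 0)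
    (hf : LocallyIntegrableOn f (Ici T)) (h : GreenConverges T ω f) :
    IsPrimitiveOn T (greenOp T ω f) (fun t => ω * greenOp T ω f t + f t) := by
  obtain ⟨c, hc⟩ := exists_greenOp_eq hω hf h
  have he : LocallyIntegrableOn (fun s : ℝ => Complex.exp (-ω * s) * f s) (Ici T) :=
    hf.continuousOn_mul (by fun_prop) isLocallyClosed_Ici
  have h1 : IsPrimitiveOn T (fun t : ℝ => Complex.exp (ω * t))
      (fun t : ℝ => Complex.exp (ω * t) * ω) := by
    refine IsPrimitiveOn.of_hasDerivWithinAt (by fun_prop) fun t _ => ?_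
    have := ((hasDerivAt_id (t : ℂ)).const_mul ω).cexp.comp_ofReal
    simpa using this.hasDerivWithinAt
  refine (h1.mul (IsPrimitiveOn.integral he c)).congr hc fun t ht => ?_
  dsimp only
  rw [hc t ht, ← mul_assoc (Complex.exp (ω * t)) _ (f t), ← Complex.exp_add]
  simp
  ring

theorem GreenConverges.add {T : ℝ} {ω : ℂ} {f g : ℝ → ℂ}
    (hf : LocallyIntegrableOn f (Ici T)) (hg : LocallyIntegrableOn g (Ici T))
    (h : GreenConverges T ω f) (h' : GreenConverges T ω g) :
    GreenConverges T ω (fun s => f s + g s) ∧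
      ∀ t ∈ Ici T, greenOp T ω (fun s => f s + g s) t = greenOp T ω f t + greenOp T ω g t := by
  have key : ∀ t ∈ Ici T, Tendsto (fun S : ℝ => ∫ s in T..S, greenKernel ω t s * (f s + g s))
      atTop (𝓝 (greenOp T ω f t + greenOp T ω g t)) := by
    intro t ht
    refine ((h.tendsto ht).add (h'.tendsto ht)).congr' ?_
    filter_upwards [eventually_ge_atTop T] with S hS
    rw [← intervalIntegral.integral_add
      (intervalIntegrable_of_locallyIntegrableOn
        (locallyIntegrableOn_greenKernel_mul hf ω t) le_rfl hS)
      (intervalIntegrable_of_locallyIntegrableOn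
        (locallyIntegrableOn_greenKernel_mul hg ω t) le_rfl hS)]
    simp only [mul_add]
  exact ⟨fun t ht => ⟨_, key t ht⟩, fun t ht => (key t ht).limUnder_eq⟩

theorem tendsto_integral_greenKernel {T : ℝ} {ω : ℂ} {f : ℝ → ℂ} {t : ℝ}
    (hf : LocallyIntegrableOn f (Ici T)) (h : absGreenOp T ω f t ≠ ∞) :
    Tendsto (fun S : ℝ => ∫ s in T..S, greenKernel ω t s * f s) atTop
      (𝓝 (∫ s in Ici T, greenKernel ω t s * f s)) := by
  have hi : IntegrableOn (fun s => greenKernel ω t s * f s) (Ici T) :=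
    ⟨(locallyIntegrableOn_greenKernel_mul hf ω t).aestronglyMeasurable, lt_top_iff_ne_top.2 h⟩
  rw [integral_Ici_eq_integral_Ioi]
  exact intervalIntegral_tendsto_integral_Ioi _ (hi.mono_set Ioi_subset_Ici_self) tendsto_id

theorem greenConverges_of_absGreenOp_ne_top {T : ℝ} {ω : ℂ} {f : ℝ → ℂ}
    (hf : LocallyIntegrableOn f (Ici T)) (h : ∀ t ∈ Ici T, absGreenOp T ω f t ≠ ∞) :
    GreenConverges T ω f :=
  fun t ht => ⟨_, tendsto_integral_greenKernel hf (h t ht)⟩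

theorem greenOp_eq_integral {T : ℝ} {ω : ℂ} {f : ℝ → ℂ} {t : ℝ}
    (hf : LocallyIntegrableOn f (Ici T)) (h : absGreenOp T ω f t ≠ ∞) :
    greenOp T ω f t = ∫ s in Ici T, greenKernel ω t s * f s :=
  (tendsto_integral_greenKernel hf h).limUnder_eq

/-- The modulus of the kernel sees only Re ω; this converts bounds for γ_j into the I_{α_j} of the
error estimate. -/
theorem absGreenOp_re (T : ℝ) (ω : ℂ) (f : ℝ → ℂ) (t : ℝ) :
    absGreenOp T (ω.re : ℂ) f t = absGreenOp T ω f t := by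
  refine lintegral_congr fun s => ?_
  rw [enorm_mul, enorm_mul, ← ofReal_norm, norm_greenKernel_re, ofReal_norm]

theorem enorm_greenOp_le {T : ℝ} {ω : ℂ} {f : ℝ → ℂ} {t : ℝ}
    (hf : LocallyIntegrableOn f (Ici T)) :
    ‖greenOp T ω f t‖ₑ ≤ absGreenOp T ω f t := by
  by_cases h : absGreenOp T ω f t = ∞
  · simp [h]
  · rw [greenOp_eq_integral hf h]
    exact enorm_integral_le_lintegral_enorm _

/-- `∫_T^∞ e^{-δ|t-s|} h(s) ds`. -/
noncomputable def expInt (δ T : ℝ) (h : ℝ → ℝ) (t : ℝ) : ℝ≥0∞ :=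
  ∫⁻ s in Ici T, ENNReal.ofReal (Real.exp (-δ * |t - s|) * h s)

theorem absGreenOp_le_expInt (T : ℝ) (ω : ℂ) (f : ℝ → ℂ) (t : ℝ) :
    absGreenOp T ω f t ≤ expInt |ω.re| T (fun s => ‖f s‖) t := by
  refine lintegral_mono fun s => ?_
  rw [← ofReal_norm, norm_mul]
  gcongr
  exact norm_greenKernel_le ω t s

/-! ### Lagrange identities for the Γ_j -/

/-- Interpolation at the nodes γ_j reproduces x^i, and the sum is the coefficient of x^(m-1) of the
interpolant. -/
theorem sum_pow_div_Gam {m : ℕ} {γ : Fin m → ℂ} (hγ : Function.Injective γ) {i : ℕ} (hi : i < m) :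
    ∑ j, (Gam γ j)⁻¹ * γ j ^ i = if i + 1 = m then 1 else 0 := by
  have h := Lagrange.coeff_eq_sum (s := Finset.univ) (v := γ) hγ.injOn
    (P := (Polynomial.X : Polynomial ℂ) ^ i) (by simpa using hi)
  simp only [Finset.card_univ, Fintype.card_fin, Polynomial.coeff_X_pow, Polynomial.eval_pow,
    Polynomial.eval_X] at h
  simp only [Gam, inv_mul_eq_div]
  rw [← h]
  congr 1
  apply propext
  omega

/-- Interpolate the constant 1 at the nodes γ_j and evaluate at 0, which is not a node. The sum
becomes the coefficient of ∫(P(r;lam) + R) in the asymptotic formula. -/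
theorem sum_inv_Gam_mul {m : ℕ} (hm : 0 < m) {γ : Fin m → ℂ} (hγ : Function.Injective γ)
    (h0 : ∀ j, γ j ≠ 0) :
    ∑ j, (Gam γ j * γ j)⁻¹ = (-1) ^ (m + 1) * ∏ j, (γ j)⁻¹ := by
  have : Nonempty (Fin m) := ⟨⟨0, hm⟩⟩
  have h := Lagrange.eval_interpolate_not_at_node (s := Finset.univ) (v := γ) (x := 0) 1
    (fun j _ => (h0 j).symm)
  rw [Lagrange.interpolate_one hγ.injOn Finset.univ_nonempty, Polynomial.eval_one,
    Lagrange.eval_nodal] at h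
  simp only [zero_sub, Finset.prod_neg, Finset.card_univ, Fintype.card_fin, Pi.one_apply, mul_one,
    Lagrange.nodalWeight, Finset.prod_inv_distrib, inv_neg, mul_neg, Finset.sum_neg_distrib] at h
  rw [Finset.prod_inv_distrib]
  have hp : ∏ j, γ j ≠ 0 := Finset.prod_ne_zero_iff.2 fun j _ => h0 j
  have h2 : ((-1 : ℂ)) ^ m * (-1) ^ m = 1 := by rw [← mul_pow]; simp
  simp only [Gam, mul_inv]
  generalize ∑ j, (∏ k ∈ Finset.univ.erase j, (γ j - γ k))⁻¹ * (γ j)⁻¹ = S at h ⊢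
  field_simp
  rw [pow_succ]
  linear_combination (-1 : ℂ) ^ m * h - (∏ j, γ j) * S * h2

/-! Bell polynomials -/

theorem bell_zero (x : ℕ → ℂ) : bell x 0 = 1 := by simp [bell]

theorem bell_succ (x : ℕ → ℂ) (i : ℕ) :
    bell x (i + 1) = ∑ j ∈ Finset.range (i + 1), (i.choose j : ℂ) * (bell x (i - j) * x j) := by
  rw [bell, Finset.sum_range]
  simp only [mul_assoc]

theorem bell_succ_sub (x : ℕ → ℂ) (i : ℕ) :
    bell x (i + 1) - x i = ∑ j ∈ Finset.range i, (i.choose j : ℂ) * (bell x (i - j) * x j) := by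
  rw [bell_succ, Finset.sum_range_succ]
  simp [bell_zero]

/-- Pascal's rule, in the shape in which Leibniz's rule meets the recursion of the Bell polynomials.
-/
theorem sum_range_choose_succ_mul (i : ℕ) (F : ℕ → ℕ → ℂ) :
    ∑ j ∈ Finset.range (i + 2), ((i + 1).choose j : ℂ) * F j (i + 1 - j) =
      ∑ j ∈ Finset.range (i + 1), (i.choose j : ℂ) * F j (i - j + 1) +
        ∑ j ∈ Finset.range (i + 1), (i.choose j : ℂ) * F (j + 1) (i - j) := by
  have h := Finset.sum_antidiagonal_choose_succ_mul F i
  rw [Finset.Nat.sum_antidiagonal_eq_sum_range_succ_mk,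
    Finset.Nat.sum_antidiagonal_eq_sum_range_succ_mk,
    Finset.Nat.sum_antidiagonal_eq_sum_range_succ_mk] at h
  rw [h]
  congr 1
  refine Finset.sum_congr rfl fun j hj => ?_
  rw [Nat.choose_symm (Nat.lt_succ_iff.1 (Finset.mem_range.1 hj))]

theorem bell_congr {x y : ℕ → ℂ} (i : ℕ) (h : ∀ k < i, x k = y k) : bell x i = bell y i := by
  induction i using Nat.strong_induction_on with
  | _ i ih =>
    cases i with
    | zero => simp [bell_zero]
    | succ i =>
      rw [bell_succ, bell_succ]
      refine Finset.sum_congr rfl fun j hj => ?_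
      have hj' := Finset.mem_range.1 hj
      rw [h j hj', ih (i - j) (by omega) fun k hk => h k (by omega)]

/-- If v' = z v, then B_i = v^(i)/v, and the formula is the quotient rule. The proof avoids v: the
recursion is differentiated term by term and reassembled by Pascal's rule. -/
theorem isPrimitiveOn_bell {T : ℝ} {Z : ℝ → ℕ → ℂ} (i : ℕ)
    (h : ∀ k < i, IsPrimitiveOn T (fun t => Z t k) (fun t => Z t (k + 1))) :
    IsPrimitiveOn T (fun t => bell (Z t) i)
      (fun t => bell (Z t) (i + 1) - Z t 0 * bell (Z t) i) := by
  induction i using Nat.strong_induction_on with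
  | _ i ih =>
    cases i with
    | zero => simpa [bell_zero, bell_succ] using IsPrimitiveOn.const (T := T) 1
    | succ i =>
      have h1 : IsPrimitiveOn T
          (fun t => ∑ j ∈ Finset.range (i + 1),
            (i.choose j : ℂ) * (bell (Z t) (i - j) * Z t j)) _ :=
        IsPrimitiveOn.sum fun j hj => by
          have hj' := Finset.mem_range.1 hj
          exact ((ih (i - j) (by omega) fun k hk => h k (by omega)).mul
            (h j (by omega))).const_mul _
      refine h1.congr (fun t _ => bell_succ _ _) fun t _ => ?_
      dsimp only
      rw [bell_succ, sum_range_choose_succ_mul i fun j l => bell (Z t) l * Z t j, bell_succ,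
        Finset.mul_sum, ← Finset.sum_add_distrib, ← Finset.sum_sub_distrib]
      refine Finset.sum_congr rfl fun j _ => ?_
      ring

/-- `∑_j C(i,j) lam^(i-j) B_j(Z)`, which is `y^(i)/y` if `y' = (lam + z) y`. -/
noncomputable def expBell (lam : ℂ) (Z : ℕ → ℂ) (i : ℕ) : ℂ :=
  ∑ j ∈ Finset.range (i + 1), (i.choose j : ℂ) * (lam ^ (i - j) * bell Z j)

theorem expBell_zero (lam : ℂ) (Z : ℕ → ℂ) : expBell lam Z 0 = 1 := by
  simp [expBell, bell_zero]

theorem expBell_one (lam : ℂ) (Z : ℕ → ℂ) : expBell lam Z 1 = lam + Z 0 := by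
  simp [expBell, bell_zero, bell_succ, Finset.sum_range_succ]

/-- The term -Z₀ B_j in the derivative of B_j cancels the Z₀ contributed by y', which leaves lam B_j
+ B_{j+1}. Only the entries below `i` need primitives, so the last derivative of z may be merely
locally integrable. -/
theorem isPrimitiveOn_expBell {T : ℝ} {Z : ℝ → ℕ → ℂ} {y : ℝ → ℂ} {lam : ℂ}
    (hy : IsPrimitiveOn T y (fun t => (lam + Z t 0) * y t)) (i : ℕ)
    (h : ∀ k < i, IsPrimitiveOn T (fun t => Z t k) (fun t => Z t (k + 1))) :
    IsPrimitiveOn T (fun t => y t * expBell lam (Z t) i)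
      (fun t => y t * expBell lam (Z t) (i + 1)) := by
  have h1 : IsPrimitiveOn T (fun t => expBell lam (Z t) i) _ :=
    IsPrimitiveOn.sum fun j hj =>
      ((isPrimitiveOn_bell j fun k hk => h k
        (hk.trans_le (Nat.lt_succ_iff.1 (Finset.mem_range.1 hj)))).const_mul
          (lam ^ (i - j))).const_mul (i.choose j : ℂ)
  refine (hy.mul h1).congr (fun _ _ => rfl) fun t _ => ?_
  dsimp only
  rw [show expBell lam (Z t) (i + 1) = ∑ j ∈ Finset.range (i + 1),
      (i.choose j : ℂ) * (lam ^ (i - j + 1) * bell (Z t) j) +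
        ∑ j ∈ Finset.range (i + 1), (i.choose j : ℂ) * (lam ^ (i - j) * bell (Z t) (j + 1)) from
    sum_range_choose_succ_mul i fun j l => lam ^ l * bell (Z t) j, expBell, Finset.mul_sum,
    Finset.mul_sum, ← Finset.sum_add_distrib, Finset.mul_sum,
    ← Finset.sum_add_distrib]
  refine Finset.sum_congr rfl fun j _ => ?_
  ring

theorem continuousOn_bell {S : Set ℝ} {Z : ℝ → ℕ → ℂ} (i : ℕ)
    (h : ∀ k < i, ContinuousOn (fun t => Z t k) S) : ContinuousOn (fun t => bell (Z t) i) S := by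
  induction i using Nat.strong_induction_on with
  | _ i ih =>
    cases i with
    | zero => simpa [bell_zero] using continuousOn_const
    | succ i =>
      simp only [bell_succ]
      refine continuousOn_finsetSum _ fun j hj => ?_
      have hj' := Finset.mem_range.1 hj
      exact continuousOn_const.mul ((ih (i - j) (by omega) fun k hk => h k (by omega)).mul
        (h j hj'))

/-- The three bounds go through one induction, since the difference of two products needs a
Lipschitz bound for one factor and a size bound for the other. Smallness with ρ fails for B_0 = 1,
hence the restriction to positive index. -/
theorem exists_bell_lipschitz (i : ℕ) : ∃ C : ℝ, 0 ≤ C ∧ ∀ (Z Z' : ℕ → ℂ) (ρ d : ℝ), 0 ≤ ρ →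
    ρ ≤ 1 → 0 ≤ d → (∀ k < i, ‖Z k‖ ≤ ρ) → (∀ k < i, ‖Z' k‖ ≤ ρ) →
    (∀ k < i, ‖Z k - Z' k‖ ≤ d) →
    ‖bell Z i - bell Z' i‖ ≤ C * d ∧ (0 < i → ‖bell Z' i‖ ≤ C * ρ) ∧ ‖bell Z' i‖ ≤ 1 + C := by
  induction i using Nat.strong_induction_on with
  | _ i ih =>
    cases i with
    | zero => exact ⟨0, le_rfl, fun Z Z' ρ d _ _ _ _ _ _ => by simp [bell_zero]⟩
    | succ i =>
      choose! C hC0 hC using ih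
      refine ⟨∑ j ∈ Finset.range (i + 1), (i.choose j : ℝ) * (1 + 2 * C (i - j)),
        Finset.sum_nonneg fun j hj => ?_, fun Z Z' ρ d hρ hρ1 hd hZ hZ' hZZ => ?_⟩
      · have := hC0 (i - j) (by have := Finset.mem_range.1 hj; omega)
        positivity
      have key : ∀ j ∈ Finset.range (i + 1), 0 ≤ C (i - j) ∧
          ‖bell Z (i - j) - bell Z' (i - j)‖ ≤ C (i - j) * d ∧
          ‖bell Z' (i - j)‖ ≤ 1 + C (i - j) ∧ ‖Z j‖ ≤ ρ ∧ ‖Z' j‖ ≤ ρ ∧ ‖Z j - Z' j‖ ≤ d := by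
        intro j hj
        have hj' := Finset.mem_range.1 hj
        obtain ⟨h1, -, h3⟩ := hC (i - j) (by omega) Z Z' ρ d hρ hρ1 hd
          (fun k hk => hZ k (by omega)) (fun k hk => hZ' k (by omega))
          (fun k hk => hZZ k (by omega))
        exact ⟨hC0 _ (by omega), h1, h3, hZ j hj', hZ' j hj', hZZ j hj'⟩
      have hb : ‖bell Z' (i + 1)‖ ≤
          (∑ j ∈ Finset.range (i + 1), (i.choose j : ℝ) * (1 + 2 * C (i - j))) * ρ := by
        rw [bell_succ, Finset.sum_mul]
        refine (norm_sum_le _ _).trans (Finset.sum_le_sum fun j hj => ?_)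
        obtain ⟨h0, h1, h2, h3, h4, h5⟩ := key j hj
        rw [norm_mul, norm_mul, Complex.norm_natCast, mul_assoc]
        gcongr
        linarith
      refine ⟨?_, fun _ => hb, ?_⟩
      · rw [bell_succ, bell_succ, ← Finset.sum_sub_distrib, Finset.sum_mul]
        refine (norm_sum_le _ _).trans (Finset.sum_le_sum fun j hj => ?_)
        obtain ⟨h0, h1, h2, h3, h4, h5⟩ := key j hj
        rw [← mul_sub, norm_mul, Complex.norm_natCast, mul_assoc]
        gcongr
        calc ‖bell Z (i - j) * Z j - bell Z' (i - j) * Z' j‖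
            = ‖(bell Z (i - j) - bell Z' (i - j)) * Z j + bell Z' (i - j) * (Z j - Z' j)‖ := by
              ring_nf
          _ ≤ C (i - j) * d * 1 + (1 + C (i - j)) * d := by
              refine (norm_add_le _ _).trans ?_
              rw [norm_mul, norm_mul]
              have h3' := h3.trans hρ1
              gcongr
          _ = (1 + 2 * C (i - j)) * d := by ring
      · refine hb.trans ?_
        have : 0 ≤ ∑ j ∈ Finset.range (i + 1), (i.choose j : ℝ) * (1 + 2 * C (i - j)) :=
          Finset.sum_nonneg fun j hj => by
            have := (key j hj).1
            positivity
        nlinarith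

/-- The nonlinear part `B_{i+1}(Z) - Z_i` of a Bell polynomial has a small Lipschitz constant
near `0`. -/
theorem exists_bell_sub_lipschitz (i : ℕ) : ∃ C : ℝ, 0 ≤ C ∧ ∀ (Z Z' : ℕ → ℂ) (ρ d : ℝ), 0 ≤ ρ →
    ρ ≤ 1 → 0 ≤ d → (∀ k < i, ‖Z k‖ ≤ ρ) → (∀ k < i, ‖Z' k‖ ≤ ρ) →
    (∀ k < i, ‖Z k - Z' k‖ ≤ d) →
    ‖(bell Z (i + 1) - Z i) - (bell Z' (i + 1) - Z' i)‖ ≤ C * (ρ * d) := by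
  choose C hC0 hC using exists_bell_lipschitz
  refine ⟨∑ j ∈ Finset.range i, (i.choose j : ℝ) * (2 * C (i - j)),
    Finset.sum_nonneg fun j hj => ?_, fun Z Z' ρ d hρ hρ1 hd hZ hZ' hZZ => ?_⟩
  · have := hC0 (i - j)
    positivity
  rw [bell_succ_sub, bell_succ_sub, ← Finset.sum_sub_distrib, Finset.sum_mul]
  refine (norm_sum_le _ _).trans (Finset.sum_le_sum fun j hj => ?_)
  have hj' := Finset.mem_range.1 hj
  obtain ⟨h1, h2, -⟩ := hC (i - j) Z Z' ρ d hρ hρ1 hd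
    (fun k hk => hZ k (by omega)) (fun k hk => hZ' k (by omega)) (fun k hk => hZZ k (by omega))
  -- Here j < i, so each product in B_{i+1} - Z_i has two small factors; this is where the extra ρ
  -- comes from.
  have h2 := h2 (by omega)
  have h3 := hZ j hj'
  have h5 := hZZ j hj'
  have h0 := hC0 (i - j)
  rw [← mul_sub, norm_mul, Complex.norm_natCast, mul_assoc]
  gcongr
  calc ‖bell Z (i - j) * Z j - bell Z' (i - j) * Z' j‖
      = ‖(bell Z (i - j) - bell Z' (i - j)) * Z j + bell Z' (i - j) * (Z j - Z' j)‖ := by ring_nf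
    _ ≤ C (i - j) * d * ρ + C (i - j) * ρ * d := by
        refine (norm_add_le _ _).trans ?_
        rw [norm_mul, norm_mul]
        gcongr
    _ = 2 * C (i - j) * (ρ * d) := by ring

theorem tendsto_bell {Z : ℝ → ℕ → ℂ} (i : ℕ) (hi : 0 < i)
    (h : ∀ k < i, Tendsto (fun t => Z t k) atTop (𝓝 0)) :
    Tendsto (fun t => bell (Z t) i) atTop (𝓝 0) := by
  induction i using Nat.strong_induction_on with
  | _ i ih =>
    obtain ⟨i, rfl⟩ : ∃ i', i = i' + 1 := ⟨i - 1, by omega⟩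
    simp only [bell_succ]
    rw [← Finset.sum_const_zero (s := Finset.range (i + 1))]
    refine tendsto_finsetSum _ fun j hj => ?_
    have hj' := Finset.mem_range.1 hj
    rcases Nat.eq_zero_or_pos (i - j) with h0 | h0
    · simpa [h0, bell_zero] using (h j hj').const_mul (i.choose j : ℂ)
    · simpa using ((ih (i - j) (by omega) h0 fun k hk => h k (by omega)).mul
        (h j hj')).const_mul (i.choose j : ℂ)

theorem tendsto_expBell {Z : ℝ → ℕ → ℂ} {lam : ℂ} (i : ℕ)
    (h : ∀ k < i, Tendsto (fun t => Z t k) atTop (𝓝 0)) :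
    Tendsto (fun t => expBell lam (Z t) i) atTop (𝓝 (lam ^ i)) := by
  simp only [expBell, Finset.sum_range_succ', bell_zero]
  have h1 : Tendsto (fun t => ∑ j ∈ Finset.range i,
      (i.choose (j + 1) : ℂ) * (lam ^ (i - (j + 1)) * bell (Z t) (j + 1))) atTop
      (𝓝 (∑ j ∈ Finset.range i, 0)) := by
    refine tendsto_finsetSum _ fun j hj => ?_
    have := (tendsto_bell (j + 1) (by omega) fun k hk => h k
      (by have := Finset.mem_range.1 hj; omega)).const_mul
        ((i.choose (j + 1) : ℂ) * lam ^ (i - (j + 1)))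
    simpa [mul_assoc] using this
  simpa using h1.add_const (lam ^ i)

/-! ### Taylor expansion at lam and the Riccati substitution -/

open Polynomial in
theorem natDegree_charPoly_le {n : ℕ} (a : Fin n → ℂ) : (charPoly a).natDegree ≤ n := by
  unfold charPoly
  refine natDegree_add_le_of_degree_le (natDegree_X_pow_le n)
    (natDegree_sum_le_of_forall_le _ _ fun i _ => ?_)
  exact (natDegree_C_mul_X_pow_le _ _).trans i.2.le

open Polynomial in
theorem coeff_charPoly {n : ℕ} (a : Fin n → ℂ) : (charPoly a).coeff n = 1 := by
  have (i : Fin n) : n ≠ i := i.2.ne'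
  simp [charPoly, finsetSum_coeff, coeff_X_pow, this]

open Polynomial in
theorem coeff_charPoly_fin {n : ℕ} (a : Fin n → ℂ) (i : Fin n) : (charPoly a).coeff i = a i := by
  simp [charPoly, finsetSum_coeff, coeff_X_pow, i.2.ne, Fin.val_inj]

open Polynomial in
theorem natDegree_pertPoly_lt {n : ℕ} (hn : 0 < n) (r : Fin n → ℝ → ℂ) (t : ℝ) :
    (pertPoly r t).natDegree < n := by
  refine lt_of_le_of_lt (natDegree_sum_le_of_forall_le (n := n - 1) _ _ fun i _ => ?_)
    (Nat.sub_lt hn one_pos)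
  exact (natDegree_C_mul_X_pow_le _ _).trans (by omega)

open Polynomial in
theorem coeff_pertPoly_fin {n : ℕ} (r : Fin n → ℝ → ℂ) (t : ℝ) (i : Fin n) :
    (pertPoly r t).coeff i = r i t := by
  simp [pertPoly, finsetSum_coeff, coeff_X_pow, Fin.val_inj]

open Polynomial in
theorem taylor_coeff_eq_sum {Q : ℂ[X]} {n : ℕ} (hQ : Q.natDegree ≤ n) (lam : ℂ) (k : ℕ) :
    (taylor lam Q).coeff k =
      ∑ i ∈ Finset.range (n + 1), Q.coeff i * ((i.choose k : ℂ) * lam ^ (i - k)) := by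
  rw [taylor_coeff, hasseDeriv_apply, sum_over_range' _ (by simp) (n + 1) (by omega),
    eval_finsetSum]
  refine Finset.sum_congr rfl fun i _ => ?_
  rw [eval_monomial]
  ring

open Polynomial in
theorem pertDeriv_eq {n : ℕ} (r : Fin n → ℝ → ℂ) (lam : ℂ) (k : ℕ) (t : ℝ) :
    pertDeriv r lam k t = (k.factorial : ℂ) * (taylor lam (pertPoly r t)).coeff k := by
  rw [pertDeriv, ← factorial_smul_hasseDeriv, taylor_coeff]
  simp

theorem locallyIntegrableOn_pertDeriv {n : ℕ} {r : Fin n → ℝ → ℂ} {t₀ : ℝ}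
    (hr : ∀ i, LocallyIntegrableOn (r i) (Ici t₀)) (lam : ℂ) (k : ℕ) :
    LocallyIntegrableOn (pertDeriv r lam k) (Ici t₀) := by
  have h : pertDeriv r lam k = fun t => ∑ i : Fin n, r i t *
      (Polynomial.derivative^[k] ((Polynomial.X : Polynomial ℂ) ^ (i : ℕ))).eval lam := by
    funext t
    simp [pertDeriv, pertPoly, Polynomial.iterate_derivative_sum,
      Polynomial.iterate_derivative_C_mul, Polynomial.eval_finsetSum]
  rw [h]
  have : ∀ s : Finset (Fin n), LocallyIntegrableOn (fun t => ∑ i ∈ s, r i t *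
      (Polynomial.derivative^[k] ((Polynomial.X : Polynomial ℂ) ^ (i : ℕ))).eval lam)
      (Ici t₀) := by
    intro s
    induction s using Finset.cons_induction with
    | empty => simpa using locallyIntegrableOn_zero
    | cons i s hi ih =>
      simp only [Finset.sum_cons]
      exact ((hr i).mul_continuousOn continuousOn_const isLocallyClosed_Ici).add ih
  exact this _

theorem linPart_eq {n : ℕ} (r : Fin n → ℝ → ℂ) (lam : ℂ) (t : ℝ) (Z : ℕ → ℂ) :
    linPart r lam t Z = ∑ k ∈ Finset.Icc 1 (n - 1),
      (Polynomial.taylor lam (pertPoly r t)).coeff k * Z (k - 1) := by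
  refine Finset.sum_congr rfl fun k _ => ?_
  rw [pertDeriv_eq, inv_mul_cancel_left₀ (by exact_mod_cast k.factorial_ne_zero)]

/-- For fixed i the sum over j in the definition is the i-th Taylor coefficient of P(a;·) + P(r;·)
at lam, because j binomially weighted powers of lam are exactly a Taylor shift. -/
theorem nonlinPart_eq {n : ℕ} (hn : 0 < n) (a : Fin n → ℂ) (r : Fin n → ℝ → ℂ) (lam : ℂ) (t : ℝ)
    (Z : ℕ → ℂ) :
    nonlinPart a r lam t Z = ∑ k ∈ Finset.Icc 2 n,
      (Polynomial.taylor lam (charPoly a) + Polynomial.taylor lam (pertPoly r t)).coeff k *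
        (bell Z k - Z (k - 1)) := by
  refine Finset.sum_congr rfl fun k hk => ?_
  have hk := Finset.mem_Icc.1 hk
  rw [← map_add, taylor_coeff_eq_sum (n := n), ← Finset.sum_mul]
  · congr 1
    rw [← Finset.sum_range_add_sum_Ico _ (show k ≤ n + 1 by omega),
      Finset.sum_eq_zero (s := Finset.range k), zero_add,
      Finset.sum_Ico_eq_sum_range, show n + 1 - k = n - k + 1 by omega]
    · refine Finset.sum_congr rfl fun j _ => ?_
      rw [Nat.choose_symm_add, Polynomial.coeff_add, Nat.add_sub_cancel_left]
      ring
    · intro i hi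
      rw [Nat.choose_eq_zero_of_lt (Finset.mem_range.1 hi)]
      simp
  · refine (Polynomial.natDegree_add_le _ _).trans (max_le (natDegree_charPoly_le a) ?_)
    exact (natDegree_pertPoly_lt hn r t).le

/-- The substitution `y' = (lam + z) y` turns the linear equation into the Riccati type one. -/
theorem sum_mul_expBell {n : ℕ} (hn : 2 ≤ n) {a : Fin n → ℂ} {r : Fin n → ℝ → ℂ} {lam : ℂ}
    (hlam : (charPoly a).IsRoot lam) (t : ℝ) (Z : ℕ → ℂ) :
    expBell lam Z n + ∑ i : Fin n, (a i + r i t) * expBell lam Z i =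
      pertDeriv r lam 0 t +
        ∑ k ∈ Finset.Icc 1 n, (Polynomial.taylor lam (charPoly a)).coeff k * Z (k - 1) +
        linPart r lam t Z + nonlinPart a r lam t Z := by
  have hdeg : (charPoly a + pertPoly r t).natDegree ≤ n :=
    (Polynomial.natDegree_add_le _ _).trans (max_le (natDegree_charPoly_le a)
      (natDegree_pertPoly_lt (by omega) r t).le)
  have hpn : (pertPoly r t).coeff n = 0 :=
    Polynomial.coeff_eq_zero_of_natDegree_lt (natDegree_pertPoly_lt (by omega) r t)
  have h1 : expBell lam Z n + ∑ i : Fin n, (a i + r i t) * expBell lam Z i =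
      ∑ i ∈ Finset.range (n + 1), (charPoly a + pertPoly r t).coeff i * expBell lam Z i := by
    rw [Finset.sum_range_succ, Polynomial.coeff_add, coeff_charPoly, hpn, Finset.sum_range]
    simp only [Polynomial.coeff_add, coeff_charPoly_fin, coeff_pertPoly_fin]
    ring
  -- Exchanging the sums collects, in front of each B_k, the k-th Taylor coefficient at lam.
  have h2 : ∑ i ∈ Finset.range (n + 1), (charPoly a + pertPoly r t).coeff i * expBell lam Z i =
      ∑ k ∈ Finset.range (n + 1), (Polynomial.taylor lam (charPoly a) +
        Polynomial.taylor lam (pertPoly r t)).coeff k * bell Z k := by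
    rw [← map_add]
    simp only [taylor_coeff_eq_sum hdeg, Finset.sum_mul]
    rw [Finset.sum_comm]
    refine Finset.sum_congr rfl fun i hi => ?_
    have hi' : i + 1 ≤ n + 1 := by have := Finset.mem_range.1 hi; omega
    rw [← Finset.sum_range_add_sum_Ico _ hi', expBell, Finset.mul_sum, Finset.sum_eq_zero (s := Finset.Ico (i+1) (n+1)),
      add_zero]
    · refine Finset.sum_congr rfl fun j _ => ?_
      ring
    · intro j hj
      rw [Nat.choose_eq_zero_of_lt (Finset.mem_Ico.1 hj).1]
      simp
  -- Two coefficients drop out: P(r;·) has degree below n, so 𝓛 stops at k = n-1, and P(a;·)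
  -- vanishes at lam, so its constant term is absent.
  have hR : (Polynomial.taylor lam (pertPoly r t)).coeff n = 0 := by
    refine Polynomial.coeff_eq_zero_of_natDegree_lt ?_
    rw [Polynomial.natDegree_taylor]
    exact natDegree_pertPoly_lt (by omega) r t
  have hA : (Polynomial.taylor lam (charPoly a)).coeff 0 = 0 := by
    rw [Polynomial.taylor_coeff_zero]; exact hlam
  have hp : pertDeriv r lam 0 t = (Polynomial.taylor lam (pertPoly r t)).coeff 0 := by
    simp [pertDeriv_eq]
  rw [h1, h2, linPart_eq, nonlinPart_eq (by omega), hp]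
  generalize Polynomial.taylor lam (pertPoly r t) = R at hR ⊢
  generalize Polynomial.taylor lam (charPoly a) = A at hA ⊢
  obtain ⟨m, rfl⟩ : ∃ m, n = m + 1 := ⟨n - 1, by omega⟩
  rw [Finset.sum_range_succ', bell_zero, Polynomial.coeff_add, hA]
  have e1 : ∀ f : ℕ → ℂ, ∀ l, ∑ k ∈ Finset.Icc 1 l, f k = ∑ k ∈ Finset.range l, f (k + 1) := by
    intro f l
    rw [← Finset.Ico_succ_right_eq_Icc, Finset.sum_Ico_eq_sum_range]
    simp [add_comm]
  -- As B_1 = Z_0, the term k = 1 is zero and all sums can be taken over the same range.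
  have e2 : ∑ k ∈ Finset.Icc 2 (m + 1), (A + R).coeff k * (bell Z k - Z (k - 1)) =
      ∑ k ∈ Finset.range (m + 1), (A + R).coeff (k + 1) * (bell Z (k + 1) - Z k) := by
    rw [Finset.sum_range_succ', bell_succ_sub Z 0, ← Finset.Ico_succ_right_eq_Icc,
      Finset.sum_Ico_eq_sum_range, Finset.range_zero, Finset.sum_empty, mul_zero, add_zero]
    refine Finset.sum_congr (by simp) fun k _ => ?_
    rw [show 2 + k = k + 1 + 1 by omega, Nat.add_sub_cancel]
  have e3 : ∑ k ∈ Finset.range m, R.coeff (k + 1) * Z k =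
      ∑ k ∈ Finset.range (m + 1), R.coeff (k + 1) * Z k := by
    rw [Finset.sum_range_succ, hR]; simp
  rw [e1, e1, e2]
  simp only [Nat.add_sub_cancel]
  rw [e3, add_comm _ ((0 + R.coeff 0) * 1), zero_add, mul_one, add_assoc, add_assoc,
    ← Finset.sum_add_distrib, ← Finset.sum_add_distrib]
  congr 1
  refine Finset.sum_congr rfl fun k _ => ?_
  rw [Polynomial.coeff_add]
  ring

/-- The sum is Q(γ), where P(a;lam+x) = x Q(x): the product γ Q(γ) vanishes and γ ≠ 0. -/
theorem sum_taylor_mul_pow {n : ℕ} {a : Fin n → ℂ} {lam γ : ℂ}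
    (hlam : (charPoly a).IsRoot lam) (hmu : (charPoly a).IsRoot (lam + γ)) (hγ : γ ≠ 0) :
    ∑ k ∈ Finset.Icc 1 n, (Polynomial.taylor lam (charPoly a)).coeff k * γ ^ (k - 1) = 0 := by
  have h1 : (Polynomial.taylor lam (charPoly a)).eval γ = 0 := by
    rw [Polynomial.taylor_eval, add_comm]; exact hmu
  rw [Polynomial.eval_eq_sum_range' (n := n + 1), Finset.sum_range_succ',
    Polynomial.taylor_coeff_zero, hlam.eq_zero] at h1
  · rw [← Finset.Ico_succ_right_eq_Icc, Finset.sum_Ico_eq_sum_range]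
    refine (mul_eq_zero.1 (?_ : γ * _ = 0)).resolve_left hγ
    rw [zero_mul, add_zero] at h1
    rw [← h1, Finset.mul_sum]
    refine Finset.sum_congr (by simp) fun k _ => ?_
    rw [Nat.add_sub_cancel_left, add_comm 1 k, pow_succ]
    ring
  · rw [Polynomial.natDegree_taylor]
    exact Nat.lt_succ_of_le (natDegree_charPoly_le a)

theorem coeff_taylor_charPoly {n : ℕ} (a : Fin n → ℂ) (lam : ℂ) :
    (Polynomial.taylor lam (charPoly a)).coeff n = 1 := by
  have h : (charPoly a).natDegree = n :=
    le_antisymm (natDegree_charPoly_le a)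
      (Polynomial.le_natDegree_of_ne_zero (by rw [coeff_charPoly]; exact one_ne_zero))
  have h2 := Polynomial.coeff_taylor_natDegree (f := charPoly a) lam
  rwa [Polynomial.leadingCoeff, h, coeff_charPoly] at h2

/-! Lipschitz bounds -/

/-- The sum of the absolute values of the derivatives of `P(r;x)` at `lam`. -/
noncomputable def pertNorm {n : ℕ} (r : Fin n → ℝ → ℂ) (lam : ℂ) (t : ℝ) : ℝ :=
  ∑ k ∈ Finset.Icc 1 n, ‖pertDeriv r lam k t‖

theorem pertNorm_nonneg {n : ℕ} (r : Fin n → ℝ → ℂ) (lam : ℂ) (t : ℝ) : 0 ≤ pertNorm r lam t :=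
  Finset.sum_nonneg fun _ _ => norm_nonneg _

theorem norm_linPart_sub_le {n : ℕ} (r : Fin n → ℝ → ℂ) (lam : ℂ) (t : ℝ) {Z Z' : ℕ → ℂ} {d : ℝ}
    (hd : 0 ≤ d) (h : ∀ k < n - 1, ‖Z k - Z' k‖ ≤ d) :
    ‖linPart r lam t Z - linPart r lam t Z'‖ ≤ pertNorm r lam t * d := by
  rw [linPart, linPart, ← Finset.sum_sub_distrib, pertNorm, Finset.sum_mul]
  refine (norm_sum_le _ _).trans ((Finset.sum_le_sum fun k hk => ?_).trans
    (Finset.sum_le_sum_of_subset_of_nonneg (Finset.Icc_subset_Icc_right (Nat.sub_le n 1))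
      fun k hk _ => ?_))
  · have hk := Finset.mem_Icc.1 hk
    rw [← mul_sub, norm_mul, norm_mul, norm_inv, Complex.norm_natCast]
    refine mul_le_mul ?_ (h (k - 1) (by omega)) (norm_nonneg _) (norm_nonneg _)
    exact mul_le_of_le_one_left (norm_nonneg _)
      (inv_le_one_of_one_le₀ (by exact_mod_cast k.factorial_pos))
  · positivity

/-- The constant depends on `a` and `lam` alone; `r` and `t` enter only through the factor 1 +
`pertNorm`. The factor ρ makes the nonlinearity contractive near zero. -/
theorem exists_nonlinPart_lipschitz {n : ℕ} (hn : 0 < n) (a : Fin n → ℂ) (lam : ℂ) :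
    ∃ C : ℝ, 0 ≤ C ∧ ∀ (r : Fin n → ℝ → ℂ) (t : ℝ) (Z Z' : ℕ → ℂ) (ρ d : ℝ), 0 ≤ ρ → ρ ≤ 1 →
      0 ≤ d → (∀ k < n - 1, ‖Z k‖ ≤ ρ) → (∀ k < n - 1, ‖Z' k‖ ≤ ρ) →
      (∀ k < n - 1, ‖Z k - Z' k‖ ≤ d) →
      ‖nonlinPart a r lam t Z - nonlinPart a r lam t Z'‖ ≤
        C * (1 + pertNorm r lam t) * (ρ * d) := by
  choose C hC0 hC using exists_bell_sub_lipschitz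
  refine ⟨∑ k ∈ Finset.Icc 2 n, (‖(Polynomial.taylor lam (charPoly a)).coeff k‖ + 1) * C (k - 1),
    Finset.sum_nonneg fun k _ => mul_nonneg (by positivity) (hC0 _), ?_⟩
  intro r t Z Z' ρ d hρ hρ1 hd hZ hZ' hZZ
  rw [nonlinPart_eq hn, nonlinPart_eq hn, ← Finset.sum_sub_distrib, Finset.sum_mul, Finset.sum_mul]
  refine (norm_sum_le _ _).trans (Finset.sum_le_sum fun k hk => ?_)
  have hk := Finset.mem_Icc.1 hk
  obtain ⟨i, rfl⟩ : ∃ i, k = i + 1 := ⟨k - 1, by omega⟩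
  rw [← mul_sub, norm_mul, Nat.add_sub_cancel]
  have h1 := hC i Z Z' ρ d hρ hρ1 hd (fun k hk => hZ k (by omega)) (fun k hk => hZ' k (by omega))
    (fun k hk => hZZ k (by omega))
  have h2 : ‖(Polynomial.taylor lam (pertPoly r t)).coeff (i + 1)‖ ≤ pertNorm r lam t := by
    have h3 : ‖(Polynomial.taylor lam (pertPoly r t)).coeff (i + 1)‖ ≤
        ‖pertDeriv r lam (i + 1) t‖ := by
      rw [pertDeriv_eq, norm_mul, Complex.norm_natCast]
      exact le_mul_of_one_le_left (norm_nonneg _) (by exact_mod_cast Nat.factorial_pos _)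
    exact h3.trans (Finset.single_le_sum (f := fun k => ‖pertDeriv r lam k t‖)
      (fun _ _ => norm_nonneg _) (Finset.mem_Icc.2 (by omega)))
  have h4 := pertNorm_nonneg r lam t
  calc _ ≤ ((‖(Polynomial.taylor lam (charPoly a)).coeff (i + 1)‖ + 1) *
        (1 + pertNorm r lam t)) * (C i * (ρ * d)) := by
        refine mul_le_mul ?_ h1 (norm_nonneg _) (by positivity)
        rw [Polynomial.coeff_add]
        refine (norm_add_le _ _).trans ?_
        nlinarith [norm_nonneg ((Polynomial.taylor lam (charPoly a)).coeff (i + 1))]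
    _ = _ := by ring

theorem linPart_congr {n : ℕ} (r : Fin n → ℝ → ℂ) (lam : ℂ) (t : ℝ) {Z Z' : ℕ → ℂ}
    (h : ∀ k < n - 1, Z k = Z' k) : linPart r lam t Z = linPart r lam t Z' := by
  refine Finset.sum_congr rfl fun k hk => ?_
  have hk := Finset.mem_Icc.1 hk
  rw [h (k - 1) (by omega)]

/-- The top entry Z_{n-1} cancels in B_n - Z_{n-1}, so the highest derivative of z does not matter.
-/
theorem nonlinPart_congr {n : ℕ} (hn : 0 < n) (a : Fin n → ℂ) (r : Fin n → ℝ → ℂ) (lam : ℂ)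
    (t : ℝ) {Z Z' : ℕ → ℂ} (h : ∀ k < n - 1, Z k = Z' k) :
    nonlinPart a r lam t Z = nonlinPart a r lam t Z' := by
  rw [nonlinPart_eq hn, nonlinPart_eq hn]
  refine Finset.sum_congr rfl fun k hk => ?_
  have hk := Finset.mem_Icc.1 hk
  obtain ⟨i, rfl⟩ : ∃ i, k = i + 1 := ⟨k - 1, by omega⟩
  rw [Nat.add_sub_cancel, bell_succ_sub, bell_succ_sub]
  congr 1
  refine Finset.sum_congr rfl fun j hj => ?_
  have hj := Finset.mem_range.1 hj
  rw [h j (by omega), bell_congr (i - j) fun l hl => h l (by omega)]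

theorem LocallyIntegrableOn.finsetSum {ι : Type*} {T : ℝ} (s : Finset ι) {f : ι → ℝ → ℂ}
    (h : ∀ i ∈ s, LocallyIntegrableOn (f i) (Ici T)) :
    LocallyIntegrableOn (fun t => ∑ i ∈ s, f i t) (Ici T) := by
  induction s using Finset.cons_induction with
  | empty => simpa using locallyIntegrableOn_zero
  | cons i s hi ih =>
    simp only [Finset.sum_cons]
    exact (h i (Finset.mem_cons_self i s)).add
      (ih fun j hj => h j (Finset.mem_cons_of_mem hj))

theorem locallyIntegrableOn_linPart {n : ℕ} {r : Fin n → ℝ → ℂ} {T : ℝ}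
    (hr : ∀ i, LocallyIntegrableOn (r i) (Ici T)) (lam : ℂ) {Z : ℝ → ℕ → ℂ}
    (hZ : ∀ k < n - 1, ContinuousOn (fun t => Z t k) (Ici T)) :
    LocallyIntegrableOn (fun t => linPart r lam t (Z t)) (Ici T) := by
  refine LocallyIntegrableOn.finsetSum _ fun k hk => ?_
  have hk := Finset.mem_Icc.1 hk
  exact ((locallyIntegrableOn_pertDeriv hr lam k).continuousOn_mul continuousOn_const
    isLocallyClosed_Ici).mul_continuousOn (hZ _ (by omega)) isLocallyClosed_Ici

theorem locallyIntegrableOn_nonlinPart {n : ℕ} (hn : 0 < n) (a : Fin n → ℂ) {r : Fin n → ℝ → ℂ}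
    {T : ℝ} (hr : ∀ i, LocallyIntegrableOn (r i) (Ici T)) (lam : ℂ) {Z : ℝ → ℕ → ℂ}
    (hZ : ∀ k < n - 1, ContinuousOn (fun t => Z t k) (Ici T)) :
    LocallyIntegrableOn (fun t => nonlinPart a r lam t (Z t)) (Ici T) := by
  simp only [nonlinPart_eq hn]
  refine LocallyIntegrableOn.finsetSum _ fun k hk => ?_
  have hk := Finset.mem_Icc.1 hk
  obtain ⟨i, rfl⟩ : ∃ i, k = i + 1 := ⟨k - 1, by omega⟩
  refine LocallyIntegrableOn.mul_continuousOn ?_ ?_ isLocallyClosed_Ici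
  · simp only [Polynomial.coeff_add]
    refine LocallyIntegrableOn.add (continuousOn_const.locallyIntegrableOn measurableSet_Ici) ?_
    have h1 : ∀ t, (Polynomial.taylor lam (pertPoly r t)).coeff (i + 1) =
        ((i + 1).factorial : ℂ)⁻¹ * pertDeriv r lam (i + 1) t := fun t => by
      rw [pertDeriv_eq, inv_mul_cancel_left₀ (by exact_mod_cast (i + 1).factorial_ne_zero)]
    simp only [h1]
    exact (locallyIntegrableOn_pertDeriv hr lam _).continuousOn_mul continuousOn_const
      isLocallyClosed_Ici
  · simp only [Nat.add_sub_cancel, bell_succ_sub]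
    refine continuousOn_finsetSum _ fun j hj => ?_
    have hj := Finset.mem_range.1 hj
    exact continuousOn_const.mul ((continuousOn_bell (i - j) fun l hl => hZ l (by omega)).mul
      (hZ j (by omega)))

/-! ### Exponential averages -/

theorem integrable_exp_neg_mul_abs {δ : ℝ} (hδ : 0 < δ) :
    Integrable (fun x : ℝ => Real.exp (-δ * |x|)) := by
  rw [← integrableOn_univ, ← Iic_union_Ioi (a := (0 : ℝ))]
  refine IntegrableOn.union ?_ ?_
  · refine (integrableOn_exp_mul_Iic hδ 0).congr_fun (fun x hx => ?_) measurableSet_Iic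
    simp only [abs_of_nonpos (mem_Iic.1 hx)]
    ring_nf
  · refine (exp_neg_integrableOn_Ioi 0 hδ).congr_fun (fun x hx => ?_) measurableSet_Ioi
    simp only [abs_of_pos (mem_Ioi.1 hx)]

/-- `∫ e^{-δ|s|} ds`. -/
noncomputable def expMass (δ : ℝ) : ℝ := ∫ s : ℝ, Real.exp (-δ * |s|)

theorem expMass_nonneg (δ : ℝ) : 0 ≤ expMass δ := integral_nonneg fun _ => (Real.exp_pos _).le

theorem lintegral_exp_neg_mul_abs_sub {δ : ℝ} (hδ : 0 < δ) (t : ℝ) :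
    ∫⁻ s : ℝ, ENNReal.ofReal (Real.exp (-δ * |t - s|)) = ENNReal.ofReal (expMass δ) := by
  rw [lintegral_sub_left_eq_self (fun x : ℝ => ENNReal.ofReal (Real.exp (-δ * |x|))) t, expMass,
    ofReal_integral_eq_lintegral_ofReal (integrable_exp_neg_mul_abs hδ)
      (Eventually.of_forall fun _ => (Real.exp_pos _).le)]

/-- Continuity from above of the measure with density φ along the shrinking rays. -/
theorem tendsto_setLIntegral_Ici {t₀ : ℝ} {φ : ℝ → ℝ≥0∞} (h : ∫⁻ s in Ici t₀, φ s ≠ ∞) :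
    Tendsto (fun T => ∫⁻ s in Ici T, φ s) atTop (𝓝 0) := by
  let μ := (volume.restrict (Ici t₀)).withDensity φ
  have h1 : Tendsto (fun T : ℝ => μ (Ici T)) atTop (𝓝 (μ (⋂ T : ℝ, Ici T))) :=
    tendsto_measure_iInter_atTop (fun _ => measurableSet_Ici.nullMeasurableSet)
      (fun a b hab => Ici_subset_Ici.2 hab) ⟨t₀, by
        simp only [μ]
        rwa [withDensity_apply _ measurableSet_Ici, Measure.restrict_restrict measurableSet_Ici,
          inter_self]⟩
  have h2 : (⋂ T : ℝ, Ici T) = ∅ := by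
    ext x
    simp only [mem_iInter, mem_Ici, mem_empty_iff_false, iff_false, not_forall, not_le]
    exact ⟨x + 1, by linarith⟩
  rw [h2, measure_empty] at h1
  refine h1.congr' ?_
  filter_upwards [eventually_ge_atTop t₀] with T hT
  simp only [μ]
  rw [withDensity_apply _ measurableSet_Ici, Measure.restrict_restrict measurableSet_Ici,
    inter_eq_left.2 (Ici_subset_Ici.2 hT)]

theorem expInt_mono {α δ T : ℝ} {h k : ℝ → ℝ} {t : ℝ} (hδ : δ ≤ α) (hh : ∀ s ∈ Ici T, 0 ≤ h s)
    (hk : ∀ s ∈ Ici T, h s ≤ k s) : expInt α T h t ≤ expInt δ T k t := by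
  refine setLIntegral_mono' measurableSet_Ici fun s hs => ENNReal.ofReal_le_ofReal ?_
  refine mul_le_mul (Real.exp_le_exp.2 ?_) (hk s hs) (hh s hs) (Real.exp_pos _).le
  have := abs_nonneg (t - s)
  nlinarith

/-- A function which is, up to arbitrarily small constants, dominated by an integrable one. -/
def IsSmallAtTop (t₀ : ℝ) (h : ℝ → ℝ) : Prop :=
  ∀ η > 0, ∃ g : ℝ → ℝ, IntegrableOn g (Ici t₀) ∧ (∀ s, 0 ≤ g s) ∧ ∀ s, h s ≤ η + g s

/-- Beyond η the power x^(1-q) is at most η^(1-q). Hence an L^q function with q > 1 is, up to any η,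
dominated by an integrable one. -/
theorem le_add_rpow {x η q : ℝ} (hx : 0 ≤ x) (hη : 0 < η) (hq : 1 < q) :
    x ≤ η + η ^ (1 - q) * x ^ q := by
  rcases le_or_gt x η with h | h
  · have : 0 ≤ η ^ (1 - q) * x ^ q := by positivity
    linarith
  · have hx' := hη.trans h
    have : x = x ^ (1 - q) * x ^ q := by rw [← Real.rpow_add hx']; simp
    have h2 : x ^ (1 - q) ≤ η ^ (1 - q) :=
      Real.rpow_le_rpow_of_nonpos hη h.le (by linarith)
    have h3 : 0 ≤ x ^ q := by positivity
    nlinarith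

theorem integrableOn_rpow_of_memLp {t₀ q : ℝ} {f : ℝ → ℂ} (hq : 1 < q)
    (h : MemLp f (ENNReal.ofReal q) (volume.restrict (Ici t₀))) :
    IntegrableOn (fun s => ‖f s‖ ^ q) (Ici t₀) := by
  have := h.integrable_norm_rpow (by simp; linarith) (by simp)
  rwa [ENNReal.toReal_ofReal (by linarith)] at this

theorem isSmallAtTop_pertNorm {n : ℕ} {r : Fin n → ℝ → ℂ} {lam : ℂ} {t₀ : ℝ} {q : ℕ → ℝ}
    (hq : ∀ k ∈ Finset.Icc 1 n, 1 < q k ∧ q k ≤ 2 ∧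
      MemLp (pertDeriv r lam k) (ENNReal.ofReal (q k)) (volume.restrict (Ici t₀))) :
    IsSmallAtTop t₀ (pertNorm r lam) := by
  intro η hη
  have hη' : 0 < η / (n + 1) := by positivity
  refine ⟨fun s => ∑ k ∈ Finset.Icc 1 n, (η / (n + 1)) ^ (1 - q k) * ‖pertDeriv r lam k s‖ ^ (q k),
    ?_, fun s => Finset.sum_nonneg fun k _ => by positivity, fun s => ?_⟩
  · refine integrable_finsetSum _ fun k hk => ?_
    obtain ⟨h1, -, h3⟩ := hq k hk
    exact (integrableOn_rpow_of_memLp h1 h3).const_mul _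
  · have h1 : pertNorm r lam s ≤ ∑ k ∈ Finset.Icc 1 n, (η / (n + 1) +
        (η / (n + 1)) ^ (1 - q k) * ‖pertDeriv r lam k s‖ ^ (q k)) :=
      Finset.sum_le_sum fun k hk => le_add_rpow (norm_nonneg _) hη' (hq k hk).1
    refine h1.trans ?_
    rw [Finset.sum_add_distrib]
    gcongr
    simp only [Finset.sum_const, Nat.card_Icc, nsmul_eq_mul, Nat.add_sub_cancel]
    rw [mul_div_assoc', div_le_iff₀ (by positivity)]
    nlinarith

/-- The constant part contributes η times the mass of the kernel, the integrable part at most its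
own tail; neither depends on t. -/
theorem IsSmallAtTop.expInt_le {t₀ : ℝ} {h : ℝ → ℝ} (hs : IsSmallAtTop t₀ h) {δ ε : ℝ}
    (hδ : 0 < δ) (hε : 0 < ε) :
    ∀ᶠ T in atTop, ∀ t, expInt δ T h t ≤ ENNReal.ofReal ε := by
  have hK := expMass_nonneg δ
  obtain ⟨g, hg, hg0, hle⟩ := hs (ε / 2 / (expMass δ + 1)) (by positivity)
  have h1 := tendsto_setLIntegral_Ici (t₀ := t₀) (φ := fun s => ENNReal.ofReal (g s))
    (hg.lintegral_lt_top).ne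
  have h2 : (0 : ℝ≥0∞) < ENNReal.ofReal (ε / 2) := by simpa using hε
  filter_upwards [h1.eventually_le_const h2] with T hT t
  calc expInt δ T h t ≤ ∫⁻ s in Ici T, (ENNReal.ofReal (ε / 2 / (expMass δ + 1)) *
        ENNReal.ofReal (Real.exp (-δ * |t - s|)) + ENNReal.ofReal (g s)) := by
        refine lintegral_mono fun s => ?_
        rw [← ENNReal.ofReal_mul (by positivity), ← ENNReal.ofReal_add (by positivity) (hg0 s)]
        refine ENNReal.ofReal_le_ofReal ?_
        have h3 : Real.exp (-δ * |t - s|) ≤ 1 := Real.exp_le_one_iff.2 (by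
          rw [neg_mul, neg_nonpos]; positivity)
        have h4 := Real.exp_pos (-δ * |t - s|)
        nlinarith [hle s, hg0 s]
    _ ≤ ENNReal.ofReal (ε / 2 / (expMass δ + 1)) * ENNReal.ofReal (expMass δ) +
        ENNReal.ofReal (ε / 2) := by
        rw [lintegral_add_left (by fun_prop), lintegral_const_mul _ (by fun_prop)]
        gcongr
        rw [← lintegral_exp_neg_mul_abs_sub hδ t]
        exact setLIntegral_le_lintegral _ _
    _ ≤ ENNReal.ofReal ε := by
        rw [← ENNReal.ofReal_mul (by positivity), ← ENNReal.ofReal_add (by positivity)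
          (by positivity)]
        refine ENNReal.ofReal_le_ofReal ?_
        have : ε / 2 / (expMass δ + 1) * expMass δ ≤ ε / 2 := by
          rw [div_mul_eq_mul_div, div_le_iff₀ (by positivity)]
          nlinarith
        linarith

/-! Slowly varying majorants -/

theorem continuous_of_slowly_varying {c : ℝ} {W : ℝ → ℝ}
    (h : ∀ s t, W s ≤ Real.exp (c * |s - t|) * W t) : Continuous W := by
  refine continuous_iff_continuousAt.2 fun t => ?_
  have h1 : Tendsto (fun s => Real.exp (c * |s - t|) * W t) (𝓝 t) (𝓝 (W t)) := by
    have : Continuous fun s => Real.exp (c * |s - t|) * W t := by fun_prop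
    simpa using this.tendsto t
  have h2 : Tendsto (fun s => Real.exp (-(c * |s - t|)) * W t) (𝓝 t) (𝓝 (W t)) := by
    have : Continuous fun s => Real.exp (-(c * |s - t|)) * W t := by fun_prop
    simpa using this.tendsto t
  refine tendsto_of_tendsto_of_tendsto_of_le_of_le h2 h1 (fun s => ?_) fun s => h s t
  have h3 := h t s
  rw [abs_sub_comm] at h3
  have h4 := mul_le_mul_of_nonneg_left h3 (Real.exp_pos (-(c * |s - t|))).le
  rwa [← mul_assoc, ← Real.exp_add, neg_add_cancel, Real.exp_zero, one_mul] at h4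

/-- On [t, t+1] the function stays above e^(-c) W(t), so W(t) is at most e^c times the tail integral
of W. -/
theorem tendsto_zero_of_slowly_varying {c t₀ : ℝ} (hc : 0 ≤ c) {W : ℝ → ℝ} (hW : ∀ t, 0 < W t)
    (h : ∀ s t, W s ≤ Real.exp (c * |s - t|) * W t) (hi : IntegrableOn W (Ici t₀)) :
    Tendsto W atTop (𝓝 0) := by
  have h1 := tendsto_setLIntegral_Ici (t₀ := t₀) (φ := fun s => ENNReal.ofReal (W s))
    (hi.lintegral_lt_top).ne
  have h2 : Tendsto (fun t => ENNReal.ofReal (Real.exp (-c) * W t)) atTop (𝓝 0) := by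
    refine tendsto_of_tendsto_of_tendsto_of_le_of_le tendsto_const_nhds h1 (fun _ => zero_le)
      fun t => ?_
    calc ENNReal.ofReal (Real.exp (-c) * W t)
        = ∫⁻ s in Icc t (t + 1), ENNReal.ofReal (Real.exp (-c) * W t) := by simp
      _ ≤ ∫⁻ s in Icc t (t + 1), ENNReal.ofReal (W s) := by
          refine setLIntegral_mono' measurableSet_Icc fun s hs => ENNReal.ofReal_le_ofReal ?_
          have h3 := h t s
          rw [Real.exp_neg, inv_mul_le_iff₀ (Real.exp_pos _)]
          refine h3.trans (mul_le_mul_of_nonneg_right (Real.exp_le_exp.2 ?_) (hW s).le)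
          refine mul_le_of_le_one_right hc (abs_le.2 ⟨?_, ?_⟩) <;> linarith [hs.1, hs.2]
      _ ≤ _ := lintegral_mono_set Icc_subset_Ici_self
  have h3 := (ENNReal.tendsto_toReal ENNReal.zero_ne_top).comp h2
  have h4 := h3.const_mul (Real.exp c)
  simp only [ENNReal.toReal_zero, mul_zero] at h4
  refine h4.congr fun t => ?_
  rw [Function.comp_apply, ENNReal.toReal_ofReal (mul_pos (Real.exp_pos _) (hW t)).le, ← mul_assoc,
    ← Real.exp_add, add_neg_cancel, Real.exp_zero, one_mul]

theorem exp_neg_mul_abs_sub_le {c : ℝ} (hc : 0 ≤ c) (s t x : ℝ) :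
    Real.exp (-c * |s - x|) ≤ Real.exp (c * |s - t|) * Real.exp (-c * |t - x|) := by
  rw [← Real.exp_add]
  refine Real.exp_le_exp.2 ?_
  have := abs_sub_le t s x
  rw [abs_sub_comm t s] at this
  nlinarith

/-- W is the convolution of φ with e^(-c|·|), integrable by Fubini and slowly varying by the
triangle inequality. The added e^(-c|t-t₀|) keeps W positive where φ gives nothing. -/
theorem exists_slowly_varying_of_integrable {c t₀ : ℝ} (hc : 0 < c) {φ : ℝ → ℝ}
    (hφ : IntegrableOn φ (Ici t₀)) (hφ0 : ∀ s, 0 ≤ φ s) :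
    ∃ W : ℝ → ℝ, (∀ t, 0 < W t) ∧ (∀ s t, W s ≤ Real.exp (c * |s - t|) * W t) ∧
      IntegrableOn W (Ici t₀) ∧ ∀ t, expInt c t₀ φ t ≤ ENNReal.ofReal (W t) := by
  have hi : ∀ t, IntegrableOn (fun s => Real.exp (-c * |t - s|) * φ s) (Ici t₀) := fun t => by
    refine Integrable.mono hφ ?_ (Eventually.of_forall fun s => ?_)
    · exact (by fun_prop : Continuous fun s => Real.exp (-c * |t - s|)).aestronglyMeasurable.mul
        hφ.aestronglyMeasurable
    · rw [norm_mul, Real.norm_eq_abs, Real.abs_exp]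
      refine mul_le_of_le_one_left (norm_nonneg _) (Real.exp_le_one_iff.2 ?_)
      rw [neg_mul, neg_nonpos]; positivity
  have h0 : ∀ t, 0 ≤ ∫ s in Ici t₀, Real.exp (-c * |t - s|) * φ s := fun t =>
    integral_nonneg fun s => mul_nonneg (Real.exp_pos _).le (hφ0 s)
  refine ⟨fun t => (∫ s in Ici t₀, Real.exp (-c * |t - s|) * φ s) + Real.exp (-c * |t - t₀|),
    fun t => add_pos_of_nonneg_of_pos (h0 t) (Real.exp_pos _), fun s t => ?_, ?_, fun t => ?_⟩
  · rw [mul_add, ← integral_const_mul]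
    refine add_le_add (integral_mono (hi s) ((hi t).const_mul _) fun x => ?_)
      (exp_neg_mul_abs_sub_le hc.le s t t₀)
    dsimp only
    rw [← mul_assoc]
    exact mul_le_mul_of_nonneg_right (exp_neg_mul_abs_sub_le hc.le s t x) (hφ0 x)
  · refine Integrable.add ?_ ?_
    · have h1 := ((integrable_indicator_iff measurableSet_Ici).2 hφ).integrable_convolution
        (ContinuousLinearMap.mul ℝ ℝ) (integrable_exp_neg_mul_abs hc)
      refine (h1.congr (Eventually.of_forall fun t => ?_)).integrableOn
      dsimp only [convolution_def]
      rw [← integral_indicator measurableSet_Ici]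
      congr 1
      funext s
      simp only [ContinuousLinearMap.mul_apply', indicator]
      split_ifs <;> ring
    · exact ((integrable_exp_neg_mul_abs hc).comp_sub_right t₀).integrableOn
  · rw [expInt, ← ofReal_integral_eq_lintegral_ofReal (hi t)
      (Eventually.of_forall fun s => mul_nonneg (Real.exp_pos _).le (hφ0 s))]
    exact ENNReal.ofReal_le_ofReal (le_add_of_nonneg_right (Real.exp_pos _).le)

theorem le_one_add_rpow {x p : ℝ} (hx : 0 ≤ x) (hp : 1 < p) : x ≤ 1 + x ^ p := by
  simpa using le_add_rpow hx one_pos hp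

/-- A slowly varying majorant in `L^p` for the exponential averages of a function in `L^p`. -/
theorem exists_majorant {β t₀ p : ℝ} (hβ : 0 < β) (hp : 1 < p) {g : ℝ → ℂ}
    (hg : MemLp g (ENNReal.ofReal p) (volume.restrict (Ici t₀))) :
    ∃ w : ℝ → ℝ, (∀ t, 0 < w t) ∧ (∀ s t, w s ≤ Real.exp (β * |s - t|) * w t) ∧
      IntegrableOn (fun t => w t ^ p) (Ici t₀) ∧ Continuous w ∧ Tendsto w atTop (𝓝 0) ∧
      ∀ α, β < α → ∃ C, 0 ≤ C ∧
        ∀ t, expInt α t₀ (fun s => ‖g s‖) t ≤ ENNReal.ofReal (C * w t) := by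
  have hp0 : 0 < p := by linarith
  -- W majorizes the averages of ‖g‖^p at the rate β p, so that w = W^(1/p) varies at the rate β and
  -- w^p is integrable.
  obtain ⟨W, hW0, hWs, hWi, hWe⟩ := exists_slowly_varying_of_integrable (mul_pos hβ hp0)
    (integrableOn_rpow_of_memLp hp hg) (fun s => by positivity)
  have hws : ∀ s t, W s ^ p⁻¹ ≤ Real.exp (β * |s - t|) * W t ^ p⁻¹ := fun s t => by
    refine (Real.rpow_le_rpow (hW0 s).le (hWs s t) (by positivity)).trans_eq ?_
    rw [Real.mul_rpow (Real.exp_pos _).le (hW0 t).le, ← Real.exp_mul]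
    congr 2
    field_simp
  have hwp : ∀ t, (W t ^ p⁻¹) ^ p = W t := fun t => Real.rpow_inv_rpow (hW0 t).le hp0.ne'
  refine ⟨fun t => W t ^ p⁻¹, fun t => Real.rpow_pos_of_pos (hW0 t) _, hws, ?_,
    continuous_of_slowly_varying hws, ?_, fun α hα => ?_⟩
  · simpa only [hwp] using hWi
  · have := (tendsto_zero_of_slowly_varying (by positivity) hW0 hWs hWi).rpow_const
      (p := p⁻¹) (Or.inr (by positivity))
    rwa [Real.zero_rpow (by positivity)] at this
  · have hK := expMass_nonneg (α - β)
    refine ⟨expMass (α - β) + 1, by positivity, fun t => ?_⟩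
    have hw := Real.rpow_pos_of_pos (hW0 t) p⁻¹
    have hwt := hwp t
    have hWt := hW0 t
    have hWet := hWe t
    beta_reduce
    generalize W t ^ p⁻¹ = w at hw hwt ⊢
    calc expInt α t₀ (fun s => ‖g s‖) t
        ≤ ∫⁻ s in Ici t₀, (ENNReal.ofReal w * ENNReal.ofReal (Real.exp (-(α - β) * |t - s|)) +
          ENNReal.ofReal (w / W t) *
            ENNReal.ofReal (Real.exp (-(β * p) * |t - s|) * ‖g s‖ ^ p)) := by
          refine lintegral_mono fun s => ?_
          rw [← ENNReal.ofReal_mul hw.le, ← ENNReal.ofReal_mul (by positivity),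
            ← ENNReal.ofReal_add (by positivity) (by positivity)]
          refine ENNReal.ofReal_le_ofReal ?_
          have e1 : Real.exp (-α * |t - s|) =
              Real.exp (-(α - β) * |t - s|) * Real.exp (-β * |t - s|) := by
            rw [← Real.exp_add]; ring_nf
          have e2 : (Real.exp (-β * |t - s|) * ‖g s‖ / w) ^ p =
              Real.exp (-(β * p) * |t - s|) * ‖g s‖ ^ p / W t := by
            rw [Real.div_rpow (by positivity) hw.le, hwt, Real.mul_rpow (Real.exp_pos _).le
              (norm_nonneg _), ← Real.exp_mul]
            ring_nf
          -- The inequality x ≤ 1 + x^p, scaled by w(t), takes the place of Hölder's: the 1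
          -- integrates to the mass of the kernel of rate α - β, and the power to at most W(t)/W(t)
          -- = 1.
          have e3 := le_one_add_rpow (x := Real.exp (-β * |t - s|) * ‖g s‖ / w) (by positivity) hp
          rw [e2, div_le_iff₀ hw] at e3
          have e4 : Real.exp (-(α - β) * |t - s|) ≤ 1 := Real.exp_le_one_iff.2 (by
            have := abs_nonneg (t - s); nlinarith)
          rw [e1, mul_assoc]
          calc _ ≤ Real.exp (-(α - β) * |t - s|) *
                ((1 + Real.exp (-(β * p) * |t - s|) * ‖g s‖ ^ p / W t) * w) := by gcongr
            _ = w * Real.exp (-(α - β) * |t - s|) + Real.exp (-(α - β) * |t - s|) *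
                (w / W t * (Real.exp (-(β * p) * |t - s|) * ‖g s‖ ^ p)) := by ring
            _ ≤ _ := by
                exact add_le_add le_rfl (mul_le_of_le_one_left (by positivity) e4)
      _ ≤ ENNReal.ofReal w * ENNReal.ofReal (expMass (α - β)) +
          ENNReal.ofReal (w / W t) * ENNReal.ofReal (W t) := by
          rw [lintegral_add_left (by fun_prop), lintegral_const_mul _ (by fun_prop),
            lintegral_const_mul' _ _ ENNReal.ofReal_ne_top]
          gcongr
          · rw [← lintegral_exp_neg_mul_abs_sub (sub_pos.2 hα) t]
            exact setLIntegral_le_lintegral _ _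
          · exact hWet
      _ = _ := by
          rw [← ENNReal.ofReal_mul hw.le, ← ENNReal.ofReal_mul (by positivity),
            ← ENNReal.ofReal_add (by positivity) (by positivity)]
          congr 1
          field_simp

/-- Slow variation replaces w(s) by e^(β|s-t|) w(t), which is paid for by β of the decay rate. -/
theorem expInt_mul_le {α β T t : ℝ} {κ w : ℝ → ℝ} (hκ : ∀ s, 0 ≤ κ s)
    (hw : ∀ s t, w s ≤ Real.exp (β * |s - t|) * w t) :
    expInt α T (fun s => κ s * w s) t ≤ expInt (α - β) T κ t * ENNReal.ofReal (w t) := by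
  rw [expInt, expInt, ← lintegral_mul_const' _ _ ENNReal.ofReal_ne_top]
  refine lintegral_mono fun s => ?_
  rw [← ENNReal.ofReal_mul (mul_nonneg (Real.exp_pos _).le (hκ s))]
  refine ENNReal.ofReal_le_ofReal ?_
  have h := hw s t
  rw [abs_sub_comm] at h
  calc _ ≤ Real.exp (-α * |t - s|) * (κ s * (Real.exp (β * |t - s|) * w t)) := by
        gcongr
        exact hκ s
    _ = (Real.exp (-α * |t - s|) * Real.exp (β * |t - s|)) * κ s * w t := by ring
    _ = _ := by rw [← Real.exp_add]; ring_nf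

/-! ### Fixed points in weighted norms -/

/-- The contraction principle in a ball of a weighted sup norm. -/
theorem exists_weighted_fixedPoint {E : Type*} [NormedAddCommGroup E] [NormedSpace ℝ E]
    [CompleteSpace E] {S : Set ℝ} {w : ℝ → ℝ} (hw : ContinuousOn w S) (hw0 : ∀ t ∈ S, 0 < w t)
    {M : ℝ} (hM : 0 ≤ M) (Φ : (ℝ → E) → ℝ → E)
    (hcont : ∀ U, ContinuousOn U S → (∀ t ∈ S, ‖U t‖ ≤ M * w t) → ContinuousOn (Φ U) S)
    (hmap : ∀ U, ContinuousOn U S → (∀ t ∈ S, ‖U t‖ ≤ M * w t) → ∀ t ∈ S, ‖Φ U t‖ ≤ M * w t)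
    (hlip : ∀ U U', ContinuousOn U S → (∀ t ∈ S, ‖U t‖ ≤ M * w t) → ContinuousOn U' S →
      (∀ t ∈ S, ‖U' t‖ ≤ M * w t) → ∀ D, 0 ≤ D → (∀ t ∈ S, ‖U t - U' t‖ ≤ D * w t) →
      ∀ t ∈ S, ‖Φ U t - Φ U' t‖ ≤ D / 2 * w t) :
    ∃ U, ContinuousOn U S ∧ (∀ t ∈ S, ‖U t‖ ≤ M * w t) ∧ ∀ t ∈ S, U t = Φ U t := by
  classical
  let X := BoundedContinuousFunction S E
  -- A bounded continuous `V` stands for the function w V, so the weighted ball becomes a closed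
  -- ball in a Banach space.
  let ext : X → ℝ → E := fun V t => if h : t ∈ S then w t • V ⟨t, h⟩ else 0
  have ext_apply : ∀ V : X, ∀ t : S, ext V t = w t • V t := fun V t => by simp [ext]
  have ext_cont : ∀ V : X, ContinuousOn (ext V) S := fun V => by
    rw [continuousOn_iff_continuous_domRestrict] at hw ⊢
    have : S.domRestrict (ext V) = fun t : S => w t • V t := by
      funext t; exact ext_apply V t
    rw [this]
    exact hw.smul V.continuous
  have ext_le : ∀ V : X, V ∈ Metric.closedBall (0 : X) M → ∀ t ∈ S, ‖ext V t‖ ≤ M * w t := by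
    intro V hV t ht
    rw [mem_closedBall_zero_iff] at hV
    rw [ext_apply V ⟨t, ht⟩, norm_smul, Real.norm_of_nonneg (hw0 t ht).le, mul_comm]
    exact mul_le_mul_of_nonneg_right ((V.norm_coe_le_norm _).trans hV) (hw0 t ht).le
  let Ψ : Metric.closedBall (0 : X) M → X := fun V =>
    BoundedContinuousFunction.ofNormedAddCommGroup (fun t : S => (w t)⁻¹ • Φ (ext V.1) t)
      (by
        have h1 := hcont _ (ext_cont V.1) (ext_le V.1 V.2)
        rw [continuousOn_iff_continuous_domRestrict] at h1 hw
        exact (hw.inv₀ fun t => (hw0 t t.2).ne').smul h1) M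
      (fun t => by
        have h1 := hmap _ (ext_cont V.1) (ext_le V.1 V.2) t t.2
        rw [norm_smul, norm_inv, Real.norm_of_nonneg (hw0 t t.2).le,
          inv_mul_le_iff₀ (hw0 t t.2), mul_comm]
        exact h1)
  have Ψ_apply : ∀ V, ∀ t : S, Ψ V t = (w t)⁻¹ • Φ (ext V.1) t := fun V t => rfl
  have Ψ_mem : ∀ V, Ψ V ∈ Metric.closedBall (0 : X) M := fun V => by
    rw [mem_closedBall_zero_iff]
    exact BoundedContinuousFunction.norm_ofNormedAddCommGroup_le _ hM _
  let F : Metric.closedBall (0 : X) M → Metric.closedBall (0 : X) M := fun V => ⟨Ψ V, Ψ_mem V⟩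
  have hF : ContractingWith (1 / 2) F := by
    refine ⟨by norm_num, LipschitzWith.of_dist_le_mul fun V V' => ?_⟩
    change dist (Ψ V) (Ψ V') ≤ _ * dist V.1 V'.1
    refine (BoundedContinuousFunction.dist_le (by positivity)).2 fun t => ?_
    have h1 := hlip _ _ (ext_cont V.1) (ext_le V.1 V.2) (ext_cont V'.1) (ext_le V'.1 V'.2)
      (dist V.1 V'.1) dist_nonneg (fun s hs => by
        rw [ext_apply V.1 ⟨s, hs⟩, ext_apply V'.1 ⟨s, hs⟩, ← smul_sub, norm_smul,
          Real.norm_of_nonneg (hw0 s hs).le, mul_comm, ← dist_eq_norm]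
        exact mul_le_mul_of_nonneg_right (BoundedContinuousFunction.dist_coe_le_dist _)
          (hw0 s hs).le) t t.2
    rw [dist_eq_norm, Ψ_apply, Ψ_apply, ← smul_sub, norm_smul, norm_inv,
      Real.norm_of_nonneg (hw0 t t.2).le, inv_mul_le_iff₀ (hw0 t t.2)]
    refine h1.trans_eq ?_
    push_cast
    ring
  have : Nonempty (Metric.closedBall (0 : X) M) := ⟨⟨0, Metric.mem_closedBall_self hM⟩⟩
  have : CompleteSpace (Metric.closedBall (0 : X) M) :=
    Metric.isClosed_closedBall.completeSpace_coe
  obtain ⟨V, hV⟩ : ∃ V, F V = V := ⟨_, hF.fixedPoint_isFixedPt⟩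
  refine ⟨ext V.1, ext_cont V.1, ext_le V.1 V.2, fun t ht => ?_⟩
  have h1 : Ψ V = V.1 := congrArg Subtype.val hV
  have h2 := Ψ_apply V ⟨t, ht⟩
  rw [h1] at h2
  rw [ext_apply V.1 ⟨t, ht⟩, h2, smul_smul, mul_inv_cancel₀ (hw0 t ht).ne', one_smul]

/-- A Hammerstein type equation with Green's kernels. -/
theorem exists_green_fixedPoint {m : ℕ} {γ : Fin m → ℂ} (hγ : ∀ j, (γ j).re ≠ 0)
    (c : Fin m → Fin m → ℂ) {T : ℝ} {w κ : ℝ → ℝ} (hw : ContinuousOn w (Ici T))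
    (hw0 : ∀ t, 0 < w t) {M τ B : ℝ} (hM : 0 ≤ M) (hτ : 0 ≤ τ) (hB : ∀ i, ∑ j, ‖c i j‖ ≤ B)
    (hBτ : B * τ ≤ 1 / 2) (hκ0 : ∀ s, 0 ≤ κ s)
    (hκ : ∀ j, ∀ t ∈ Ici T, expInt |(γ j).re| T (fun s => κ s * w s) t ≤ ENNReal.ofReal (τ * w t))
    {N : ℝ → (Fin m → ℂ) → ℂ} (hN0 : ∀ s, N s 0 = 0)
    (hNl : ∀ U : ℝ → Fin m → ℂ, ContinuousOn U (Ici T) →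
      LocallyIntegrableOn (fun s => N s (U s)) (Ici T))
    (hN : ∀ s ∈ Ici T, ∀ x x', ‖x‖ ≤ M * w s → ‖x'‖ ≤ M * w s →
      ‖N s x - N s x'‖ ≤ κ s * ‖x - x'‖)
    {b : ℝ → Fin m → ℂ} (hb : ContinuousOn b (Ici T)) (hbw : ∀ t ∈ Ici T, ‖b t‖ ≤ M / 2 * w t) :
    ∃ U : ℝ → Fin m → ℂ, ContinuousOn U (Ici T) ∧ (∀ t ∈ Ici T, ‖U t‖ ≤ M * w t) ∧
      (∀ j, ∀ t ∈ Ici T,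
        absGreenOp T (γ j) (fun s => N s (U s)) t ≤ ENNReal.ofReal (M * (τ * w t))) ∧
      ∀ t ∈ Ici T, ∀ i, U t i =
        b t i - ∑ j, c i j * greenOp T (γ j) (fun s => N s (U s)) t := by
  -- The source of both the map and the Lipschitz estimates: forcing bounded by κ D w has Green
  -- integrals bounded by D τ w.
  have habs : ∀ (φ : ℝ → ℂ) (D : ℝ), 0 ≤ D → (∀ s ∈ Ici T, ‖φ s‖ ≤ κ s * (D * w s)) → ∀ j,
      ∀ t ∈ Ici T, absGreenOp T (γ j) φ t ≤ ENNReal.ofReal (D * (τ * w t)) := by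
    intro φ D hD hφ j t ht
    calc absGreenOp T (γ j) φ t ≤ expInt |(γ j).re| T (fun s => ‖φ s‖) t :=
          absGreenOp_le_expInt _ _ _ _
      _ ≤ expInt |(γ j).re| T (fun s => κ s * (D * w s)) t :=
          expInt_mono le_rfl (fun s _ => norm_nonneg _) hφ
      _ = ENNReal.ofReal D * expInt |(γ j).re| T (fun s => κ s * w s) t := by
          rw [expInt, expInt, ← lintegral_const_mul' _ _ ENNReal.ofReal_ne_top]
          refine lintegral_congr fun s => ?_
          rw [← ENNReal.ofReal_mul hD]
          ring_nf
      _ ≤ ENNReal.ofReal D * ENNReal.ofReal (τ * w t) := by gcongr; exact hκ j t ht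
      _ = _ := by rw [← ENNReal.ofReal_mul hD]
  have hNU : ∀ U : ℝ → Fin m → ℂ, (∀ t ∈ Ici T, ‖U t‖ ≤ M * w t) →
      ∀ s ∈ Ici T, ‖N s (U s)‖ ≤ κ s * (M * w s) := by
    intro U hU s hs
    have h := hN s hs (U s) 0 (hU s hs) (by simpa using mul_nonneg hM (hw0 s).le)
    rw [hN0, sub_zero, sub_zero] at h
    exact h.trans (mul_le_mul_of_nonneg_left (hU s hs) (hκ0 s))
  have hfin : ∀ U : ℝ → Fin m → ℂ, (∀ t ∈ Ici T, ‖U t‖ ≤ M * w t) →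
      ∀ j, ∀ t ∈ Ici T, absGreenOp T (γ j) (fun s => N s (U s)) t ≠ ∞ := fun U hU j t ht =>
    ((habs _ M hM (hNU U hU) j t ht).trans_lt ENNReal.ofReal_lt_top).ne
  have hdiff : ∀ U U' : ℝ → Fin m → ℂ, ContinuousOn U (Ici T) → (∀ t ∈ Ici T, ‖U t‖ ≤ M * w t) →
      ContinuousOn U' (Ici T) → (∀ t ∈ Ici T, ‖U' t‖ ≤ M * w t) → ∀ D, 0 ≤ D →
      (∀ t ∈ Ici T, ‖U t - U' t‖ ≤ D * w t) → ∀ t ∈ Ici T,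
      ‖(fun i => b t i - ∑ j, c i j * greenOp T (γ j) (fun s => N s (U s)) t) -
        (fun i => b t i - ∑ j, c i j * greenOp T (γ j) (fun s => N s (U' s)) t)‖ ≤
          D / 2 * w t := by
    intro U U' hU hUM hU' hUM' D hD hUU t ht
    have hj : ∀ j, ‖greenOp T (γ j) (fun s => N s (U s)) t -
        greenOp T (γ j) (fun s => N s (U' s)) t‖ ≤ D * (τ * w t) := by
      intro j
      have hl := hNl U hU
      have hl' := hNl U' hU'
      rw [greenOp_eq_integral hl (hfin U hUM j t ht), greenOp_eq_integral hl' (hfin U' hUM' j t ht),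
        ← integral_sub]
      · have h1 := habs (fun s => N s (U s) - N s (U' s)) D hD (fun s hs =>
          (hN s hs _ _ (hUM s hs) (hUM' s hs)).trans
            (mul_le_mul_of_nonneg_left (hUU s hs) (hκ0 s))) j t ht
        have h2 := (enorm_integral_le_lintegral_enorm (μ := volume.restrict (Ici T))
          (fun s => greenKernel (γ j) t s * N s (U s) - greenKernel (γ j) t s * N s (U' s)))
        simp only [← mul_sub] at h2 ⊢
        have h3 := h2.trans h1
        rwa [← ofReal_norm, ENNReal.ofReal_le_ofReal_iff
          (mul_nonneg hD (mul_nonneg hτ (hw0 t).le))] at h3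
      · exact ⟨(locallyIntegrableOn_greenKernel_mul hl _ t).aestronglyMeasurable,
          lt_top_iff_ne_top.2 (hfin U hUM j t ht)⟩
      · exact ⟨(locallyIntegrableOn_greenKernel_mul hl' _ t).aestronglyMeasurable,
          lt_top_iff_ne_top.2 (hfin U' hUM' j t ht)⟩
    refine (pi_norm_le_iff_of_nonneg (mul_nonneg (by positivity) (hw0 t).le)).2 fun i => ?_
    simp only [Pi.sub_apply]
    rw [sub_sub_sub_cancel_left, ← Finset.sum_sub_distrib]
    calc _ ≤ ∑ j, ‖c i j‖ * (D * (τ * w t)) := by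
          refine (norm_sum_le _ _).trans (Finset.sum_le_sum fun j _ => ?_)
          rw [← mul_sub, norm_mul, norm_sub_rev]
          exact mul_le_mul_of_nonneg_left (hj j) (norm_nonneg _)
      _ ≤ B * (D * (τ * w t)) := by
          rw [← Finset.sum_mul]
          exact mul_le_mul_of_nonneg_right (hB i) (mul_nonneg hD (mul_nonneg hτ (hw0 t).le))
      _ = B * τ * (D * w t) := by ring
      _ ≤ 1 / 2 * (D * w t) := mul_le_mul_of_nonneg_right hBτ (mul_nonneg hD (hw0 t).le)
      _ = _ := by ring
  have hM0 : ∀ t ∈ Ici T, ‖(0 : Fin m → ℂ)‖ ≤ M * w t := fun t _ => by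
    simpa using mul_nonneg hM (hw0 t).le
  have hcont : ∀ U : ℝ → Fin m → ℂ, ContinuousOn U (Ici T) → (∀ t ∈ Ici T, ‖U t‖ ≤ M * w t) →
      ContinuousOn (fun t i => b t i - ∑ j, c i j * greenOp T (γ j) (fun s => N s (U s)) t)
        (Ici T) := by
    intro U hU hUM
    refine continuousOn_pi.2 fun i => ((continuousOn_pi.1 hb) i).sub
      (continuousOn_finsetSum _ fun j _ => continuousOn_const.mul ?_)
    exact (isPrimitiveOn_greenOp (hγ j) (hNl U hU)
      (greenConverges_of_absGreenOp_ne_top (hNl U hU) (hfin U hUM j))).continuousOn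
  have hmap : ∀ U : ℝ → Fin m → ℂ, ContinuousOn U (Ici T) → (∀ t ∈ Ici T, ‖U t‖ ≤ M * w t) →
      ∀ t ∈ Ici T, ‖fun i => b t i - ∑ j, c i j * greenOp T (γ j) (fun s => N s (U s)) t‖ ≤
        M * w t := by
    intro U hU hUM t ht
    -- The image of 0 is `b`, of size M/2, and the contraction factor 1/2 moves the image of `U`
    -- from it by at most another M/2.
    have h1 := hdiff U (fun _ => 0) hU hUM continuousOn_const hM0 M hM
      (fun s hs => by simpa using hUM s hs) t ht
    have h2 : (fun i => b t i - ∑ j, c i j * greenOp T (γ j) (fun s => N s 0) t) = b t := by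
      have : ∀ j, greenOp T (γ j) (fun s => N s 0) t = 0 := fun j => by
        simp only [hN0, greenOp, mul_zero, intervalIntegral.integral_zero]
        exact tendsto_const_nhds.limUnder_eq
      simp [this]
    rw [h2] at h1
    have h3 := norm_add_le_of_le h1 (hbw t ht)
    rw [sub_add_cancel] at h3
    exact h3.trans_eq (by ring)
  obtain ⟨U, hU, hUM, hUeq⟩ := exists_weighted_fixedPoint (S := Ici T) hw (fun t _ => hw0 t) hM
    (fun U t i => b t i - ∑ j, c i j * greenOp T (γ j) (fun s => N s (U s)) t) hcont hmap hdiff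
  exact ⟨U, hU, hUM, habs _ M hM (hNU U hUM), fun t ht i => congrFun (hUeq t ht) i⟩

/-! ### Backward solvability of the linear equation -/

theorem exists_setIntegral_sub_le {A : ℝ → ℝ} {S : Set ℝ} (hA : IntegrableOn A S) {ε : ℝ}
    (hε : 0 < ε) : ∃ N : ℝ, 0 < N ∧ ∫ s in S, max (A s - N) 0 ≤ ε := by
  have h1 : Tendsto (fun N : ℝ => ∫ s in S, max (A s - N) 0) atTop (𝓝 (∫ s in S, (0 : ℝ))) := by
    refine tendsto_integral_filter_of_dominated_convergence (fun s => ‖A s‖) ?_ ?_ hA.norm ?_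
    · exact Eventually.of_forall fun N =>
        (hA.aestronglyMeasurable.sub aestronglyMeasurable_const).sup aestronglyMeasurable_const
    · filter_upwards [eventually_ge_atTop 0] with N hN
      refine Eventually.of_forall fun s => ?_
      rw [Real.norm_of_nonneg (le_max_right _ _)]
      exact max_le ((sub_le_self _ hN).trans (le_abs_self _)) (norm_nonneg _)
    · refine Eventually.of_forall fun s => tendsto_const_nhds.congr' ?_
      filter_upwards [eventually_ge_atTop (A s)] with N hN
      rw [max_eq_right (by linarith)]
  rw [integral_zero] at h1
  obtain ⟨N, hN, h2⟩ := ((eventually_gt_atTop 0).and (h1.eventually_le_const hε)).exists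
  exact ⟨N, hN, h2⟩

/-- An exponential weight for which the Volterra operator with the majorant `A` is a contraction. -/
theorem exists_exp_weight {A : ℝ → ℝ} {t₀ T : ℝ} (hA : IntegrableOn A (Icc t₀ T)) :
    ∃ K : ℝ, 0 < K ∧ ∀ t ∈ Icc t₀ T,
      ∫ s in t..T, A s * Real.exp (K * (T - s)) ≤ 1 / 2 * Real.exp (K * (T - t)) := by
  -- Split A ≤ N + (A - N)⁺. The bounded part contributes at most N/K = 1/4 of the weight at `t`,
  -- hence K = 4N; the excess has integral at most 1/4.
  obtain ⟨N, hN, hN'⟩ := exists_setIntegral_sub_le hA (ε := 1 / 4) (by norm_num)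
  refine ⟨4 * N, by positivity, fun t ht => ?_⟩
  set K := 4 * N with hK
  have hK0 : 0 < K := by positivity
  have hAi : IntervalIntegrable A volume t T := by
    rw [intervalIntegrable_iff_integrableOn_Icc_of_le ht.2]
    exact hA.mono_set (Icc_subset_Icc_left ht.1)
  have hP : IntegrableOn (fun s => max (A s - N) 0) (Icc t₀ T) :=
    (hA.sub (integrableOn_const (by simp))).sup (integrableOn_const (by simp))
  have hPi : IntervalIntegrable (fun s => max (A s - N) 0) volume t T := by
    rw [intervalIntegrable_iff_integrableOn_Icc_of_le ht.2]
    exact hP.mono_set (Icc_subset_Icc_left ht.1)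
  have hE : Continuous fun s => Real.exp (K * (T - s)) := by fun_prop
  have h1 : ∫ s in t..T, A s * Real.exp (K * (T - s)) ≤
      ∫ s in t..T, (N * Real.exp (K * (T - s)) + max (A s - N) 0 * Real.exp (K * (T - t))) := by
    refine intervalIntegral.integral_mono_on ht.2 (hAi.mul_continuousOn hE.continuousOn)
      (((hE.intervalIntegrable _ _).const_mul N).add (hPi.mul_const _)) fun s hs => ?_
    have h2 : Real.exp (K * (T - s)) ≤ Real.exp (K * (T - t)) :=
      Real.exp_le_exp.2 (mul_le_mul_of_nonneg_left (by linarith [hs.1]) hK0.le)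
    have h3 := Real.exp_pos (K * (T - s))
    have h4 := le_max_left (A s - N) 0
    have h5 := le_max_right (A s - N) 0
    nlinarith
  have h2 : ∫ s in t..T, Real.exp (K * (T - s)) = (Real.exp (K * (T - t)) - 1) / K := by
    have h3 : ∀ s ∈ uIcc t T,
        HasDerivAt (fun s => -Real.exp (K * (T - s)) / K) (Real.exp (K * (T - s))) s := by
      intro s _
      have h4 := ((((hasDerivAt_id s).const_sub T).const_mul K).exp.neg).div_const K
      convert! h4 using 1
      simp
      field_simp
    rw [intervalIntegral.integral_eq_sub_of_hasDerivAt h3 (hE.intervalIntegrable _ _)]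
    simp
    ring
  rw [intervalIntegral.integral_add ((hE.intervalIntegrable _ _).const_mul N)
    (hPi.mul_const _), intervalIntegral.integral_const_mul, intervalIntegral.integral_mul_const,
    h2] at h1
  have h3 : ∫ s in t..T, max (A s - N) 0 ≤ 1 / 4 := by
    rw [intervalIntegral.integral_of_le ht.2]
    refine (setIntegral_mono_set hP (Eventually.of_forall fun s => le_max_right _ _) ?_).trans hN'
    exact (Ioc_subset_Icc_self.trans (Icc_subset_Icc_left ht.1)).eventuallyLE
  have h4 := Real.exp_pos (K * (T - t))
  have h5 : N * ((Real.exp (K * (T - t)) - 1) / K) = (Real.exp (K * (T - t)) - 1) / 4 := by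
    rw [hK]; field_simp
  nlinarith

/-- The right hand side of the first order system of the linear equation. -/
noncomputable def companion {n : ℕ} (a : Fin n → ℂ) (r : Fin n → ℝ → ℂ) (s : ℝ) (x : Fin n → ℂ)
    (i : Fin n) : ℂ :=
  if h : (i : ℕ) + 1 < n then x ⟨i + 1, h⟩ else -∑ k, (a k + r k s) * x k

theorem companion_sub {n : ℕ} (a : Fin n → ℂ) (r : Fin n → ℝ → ℂ) (s : ℝ) (x x' : Fin n → ℂ)
    (i : Fin n) : companion a r s x i - companion a r s x' i = companion a r s (x - x') i := by
  unfold companion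
  split_ifs
  · rfl
  · rw [neg_sub_neg, ← neg_sub, ← Finset.sum_sub_distrib]
    simp only [Pi.sub_apply, mul_sub]

theorem norm_companion_le {n : ℕ} (a : Fin n → ℂ) (r : Fin n → ℝ → ℂ) (s : ℝ) (x : Fin n → ℂ)
    (i : Fin n) : ‖companion a r s x i‖ ≤ (1 + ∑ k, ‖a k + r k s‖) * ‖x‖ := by
  have h0 : 0 ≤ ∑ k, ‖a k + r k s‖ := Finset.sum_nonneg fun _ _ => norm_nonneg _
  unfold companion
  split_ifs with h
  · exact (norm_le_pi_norm x _).trans (le_mul_of_one_le_left (norm_nonneg _) (by linarith))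
  · rw [norm_neg]
    have h1 : ‖∑ k, (a k + r k s) * x k‖ ≤ (∑ k, ‖a k + r k s‖) * ‖x‖ := by
      rw [Finset.sum_mul]
      refine (norm_sum_le _ _).trans (Finset.sum_le_sum fun k _ => ?_)
      rw [norm_mul]
      exact mul_le_mul_of_nonneg_left (norm_le_pi_norm x k) (norm_nonneg _)
    nlinarith [norm_nonneg x]

theorem integrableOn_companion {n : ℕ} {a : Fin n → ℂ} {r : Fin n → ℝ → ℂ} {t₀ T : ℝ}
    (hr : ∀ i, IntegrableOn (r i) (Icc t₀ T)) {U : ℝ → Fin n → ℂ}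
    (hU : ContinuousOn U (Icc t₀ T)) (i : Fin n) :
    IntegrableOn (fun s => companion a r s (U s) i) (Icc t₀ T) := by
  unfold companion
  split_ifs with h
  · exact (continuousOn_pi.1 hU _).integrableOn_Icc
  · refine (integrable_finsetSum _ fun k _ => ?_).neg
    exact IntegrableOn.mul_continuousOn (((integrableOn_const (by simp)).add (hr k)))
      (continuousOn_pi.1 hU k) isCompact_Icc

/-- Backward solvability of the linear system. -/
theorem exists_backward_solution {n : ℕ} (a : Fin n → ℂ) {r : Fin n → ℝ → ℂ} {t₀ T : ℝ}
    (hr : ∀ i, IntegrableOn (r i) (Icc t₀ T)) (v : Fin n → ℂ) :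
    ∃ U : ℝ → Fin n → ℂ, ContinuousOn U (Icc t₀ T) ∧ ∀ t ∈ Icc t₀ T, ∀ i,
      U t i = v i - ∫ s in t..T, companion a r s (U s) i := by
  have hA : IntegrableOn (fun s => 1 + ∑ k, ‖a k + r k s‖) (Icc t₀ T) :=
    (integrableOn_const (by simp)).add (integrable_finsetSum _ fun k _ =>
      ((integrableOn_const (by simp)).add (hr k)).norm)
  obtain ⟨K, hK, hKw⟩ := exists_exp_weight hA
  have hint : ∀ U : ℝ → Fin n → ℂ, ContinuousOn U (Icc t₀ T) → ∀ t ∈ Icc t₀ T, ∀ i,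
      IntervalIntegrable (fun s => companion a r s (U s) i) volume t T := fun U hU t ht i => by
    rw [intervalIntegrable_iff_integrableOn_Icc_of_le ht.2]
    exact (integrableOn_companion hr hU i).mono_set (Icc_subset_Icc_left ht.1)
  have hdiff : ∀ U U' : ℝ → Fin n → ℂ, ContinuousOn U (Icc t₀ T) → ContinuousOn U' (Icc t₀ T) →
      ∀ D, 0 ≤ D → (∀ t ∈ Icc t₀ T, ‖U t - U' t‖ ≤ D * Real.exp (K * (T - t))) →
      ∀ t ∈ Icc t₀ T, ‖(fun i => v i - ∫ s in t..T, companion a r s (U s) i) -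
        (fun i => v i - ∫ s in t..T, companion a r s (U' s) i)‖ ≤
          D / 2 * Real.exp (K * (T - t)) := by
    intro U U' hU hU' D hD hUU t ht
    refine (pi_norm_le_iff_of_nonneg (by positivity)).2 fun i => ?_
    simp only [Pi.sub_apply]
    rw [sub_sub_sub_cancel_left, norm_sub_rev,
      ← intervalIntegral.integral_sub (hint U hU t ht i) (hint U' hU' t ht i)]
    calc _ ≤ ∫ s in t..T, D * ((1 + ∑ k, ‖a k + r k s‖) * Real.exp (K * (T - s))) := by
          refine intervalIntegral.norm_integral_le_of_norm_le ht.2 ?_ ?_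
          · refine Eventually.of_forall fun s hs => ?_
            rw [companion_sub]
            refine (norm_companion_le _ _ _ _ _).trans ?_
            have h1 := hUU s ⟨ht.1.trans hs.1.le, hs.2⟩
            have h2 : 0 ≤ ∑ k, ‖a k + r k s‖ := Finset.sum_nonneg fun _ _ => norm_nonneg _
            calc _ ≤ (1 + ∑ k, ‖a k + r k s‖) * (D * Real.exp (K * (T - s))) := by gcongr
              _ = _ := by ring
          · refine IntervalIntegrable.const_mul (IntervalIntegrable.mul_continuousOn ?_
              (by fun_prop)) D
            rw [intervalIntegrable_iff_integrableOn_Icc_of_le ht.2]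
            exact hA.mono_set (Icc_subset_Icc_left ht.1)
      _ ≤ D * (1 / 2 * Real.exp (K * (T - t))) := by
          rw [intervalIntegral.integral_const_mul]
          exact mul_le_mul_of_nonneg_left (hKw t ht) hD
      _ = _ := by ring
  -- The weight is at least 1, so the constant `v` fills at most half of the ball of radius 2‖v‖.
  have h1 : ∀ t ∈ Icc t₀ T, 1 ≤ Real.exp (K * (T - t)) := fun t ht =>
    Real.one_le_exp (mul_nonneg hK.le (sub_nonneg.2 ht.2))
  have hcont : ∀ U : ℝ → Fin n → ℂ, ContinuousOn U (Icc t₀ T) →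
      ContinuousOn (fun t i => v i - ∫ s in t..T, companion a r s (U s) i) (Icc t₀ T) := by
    intro U hU
    refine continuousOn_pi.2 fun i => continuousOn_const.sub ?_
    rcases lt_or_ge T t₀ with h | h
    · simp [Icc_eq_empty_of_lt h]
    · have h2 := intervalIntegral.continuousOn_primitive_interval_left (a := t₀) (b := T)
        (f := fun s => companion a r s (U s) i) (μ := volume)
        (by rw [uIcc_of_le h]; exact integrableOn_companion hr hU i)
      rwa [uIcc_of_le h] at h2
  have hmap : ∀ U : ℝ → Fin n → ℂ, ContinuousOn U (Icc t₀ T) →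
      (∀ t ∈ Icc t₀ T, ‖U t‖ ≤ 2 * ‖v‖ * Real.exp (K * (T - t))) → ∀ t ∈ Icc t₀ T,
      ‖fun i => v i - ∫ s in t..T, companion a r s (U s) i‖ ≤
        2 * ‖v‖ * Real.exp (K * (T - t)) := by
    intro U hU hUM t ht
    have h2 := hdiff U (fun _ => 0) hU continuousOn_const (2 * ‖v‖) (by positivity)
      (fun s hs => by simpa using hUM s hs) t ht
    have h3 : (fun i => v i - ∫ s in t..T, companion a r s (0 : Fin n → ℂ) i) = v := by
      funext i
      have : ∀ s, companion a r s (0 : Fin n → ℂ) i = 0 := fun s => by simp [companion]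
      simp [this]
    rw [h3] at h2
    have h4 := norm_add_le_of_le h2 (le_mul_of_one_le_right (norm_nonneg v) (h1 t ht))
    rw [sub_add_cancel] at h4
    exact h4.trans_eq (by ring)
  obtain ⟨U, hU, -, hUeq⟩ := exists_weighted_fixedPoint (S := Icc t₀ T)
    (w := fun t => Real.exp (K * (T - t))) (by fun_prop) (fun _ _ => Real.exp_pos _)
    (by positivity) (fun U t i => v i - ∫ s in t..T, companion a r s (U s) i)
    (fun U hU _ => hcont U hU) hmap (fun U U' hU _ hU' _ => hdiff U U' hU hU')
  exact ⟨U, hU, fun t ht i => congrFun (hUeq t ht) i⟩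

theorem isSolution_of_chain {n : ℕ} (hn : 0 < n) {a : Fin n → ℂ} {r : Fin n → ℝ → ℂ} {t₀ : ℝ}
    {Y : ℕ → ℝ → ℂ} (h : ∀ i < n, IsPrimitiveOn t₀ (Y i) (Y (i + 1)))
    (hY : ∀ t ∈ Ici t₀, Y n t = -∑ k : Fin n, (a k + r k t) * Y k t) :
    IsSolution a r t₀ (Y 0) ∧ ∀ i ≤ n - 1, ∀ t ∈ Ici t₀, jet t₀ (Y 0) t i = Y i t := by
  obtain ⟨hj, hcd⟩ := jet_eq_of_chain (k := n - 1) (fun i hi => h i (by omega))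
    (h (n - 1) (by omega)).continuousOn
  refine ⟨⟨hcd, fun t ht => ?_⟩, hj⟩
  rw [hj _ le_rfl t ht, hj _ le_rfl t₀ self_mem_Ici, (h (n - 1) (by omega)).eq t ht,
    Nat.sub_add_cancel hn, sub_eq_add_neg, ← intervalIntegral.integral_neg]
  congr 1
  refine intervalIntegral.integral_congr fun s hs => ?_
  rw [uIcc_of_le ht] at hs
  rw [hY s hs.1]
  congr 1
  refine Finset.sum_congr rfl fun k _ => ?_
  rw [hj k (by omega) s hs.1]

/-- The companion system is solved backward from `T` with the data Y_i(T) and glued to `Y`. On both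
sides of `T` the entries are integrals of the same expressions and they agree at `T`, so the glued
entries form one chain on [t₀,∞). -/
theorem exists_extension {n : ℕ} (hn : 0 < n) {a : Fin n → ℂ} {r : Fin n → ℝ → ℂ} {t₀ T : ℝ}
    (hr : ∀ i, LocallyIntegrableOn (r i) (Ici t₀)) (hT : t₀ ≤ T)
    {Y : ℕ → ℝ → ℂ} (h : ∀ i < n, IsPrimitiveOn T (Y i) (Y (i + 1)))
    (hY : ∀ t ∈ Ici T, Y n t = -∑ k : Fin n, (a k + r k t) * Y k t) :
    ∃ y : ℝ → ℂ, IsSolution a r t₀ y ∧ ∀ i ≤ n - 1, ∀ t ∈ Ici T, jet t₀ y t i = Y i t := by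
  obtain ⟨U, hU, hUeq⟩ := exists_backward_solution a (fun i =>
    (hr i).integrableOn_compact_subset (t := Icc t₀ T) Icc_subset_Ici_self isCompact_Icc)
    (fun i => Y i T)
  have hUT : ∀ i : Fin n, U T i = Y i T := fun i => by
    rw [hUeq T ⟨hT, le_rfl⟩ i, intervalIntegral.integral_same, sub_zero]
  let V : ℕ → ℝ → ℂ := fun i t => if h : i < n then (if t ≤ T then U t ⟨i, h⟩ else Y i t) else 0
  -- The n-th entry is given by the equation itself, so only the continuous entries below n have to
  -- be glued.
  let Yg : ℕ → ℝ → ℂ := fun i t =>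
    if i < n then V i t else -∑ k : Fin n, (a k + r k t) * V k t
  have hVl : ∀ i : Fin n, EqOn (V i) (fun t => U t i) (Icc t₀ T) := fun i t ht => by
    simp [V, ht.2]
  have hVr : ∀ i : Fin n, EqOn (V i) (Y i) (Ici T) := fun i t ht => by
    rcases (mem_Ici.1 ht).eq_or_lt with rfl | ht'
    · simp [V, hUT]
    · simp [V, not_le.2 ht']
  have hVc : ∀ i : Fin n, ContinuousOn (V i) (Ici t₀) := fun i => by
    rw [← Icc_union_Ici_eq_Ici hT]
    exact ((continuousOn_pi.1 hU i).congr (hVl i)).union_of_isClosed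
      ((h i i.2).continuousOn.congr (hVr i)) isClosed_Icc isClosed_Ici
  have hYg : ∀ i : Fin n, Yg i = V i := fun i => by funext t; simp [Yg]
  have hYgn : Yg n = fun t => -∑ k : Fin n, (a k + r k t) * V k t := by funext t; simp [Yg]
  have hYr : ∀ i ≤ n, EqOn (Yg i) (Y i) (Ici T) := fun i hi t ht => by
    rcases hi.eq_or_lt with rfl | hi
    · rw [hYgn, hY t ht]
      simp only [hVr _ ht]
    · exact (congrFun (hYg ⟨i, hi⟩) t).trans (hVr ⟨i, hi⟩ ht)
  have hYl : ∀ i : Fin n, ∀ t ∈ Icc t₀ T, Yg (i + 1) t = companion a r t (U t) i :=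
    fun i t ht => by
    unfold companion
    split_ifs with hi
    · exact (congrFun (hYg ⟨i + 1, hi⟩) t).trans (hVl ⟨i + 1, hi⟩ ht)
    · have : (i : ℕ) + 1 = n := by omega
      rw [this, hYgn]
      simp only [hVl _ ht]
  have hloc : ∀ i < n, LocallyIntegrableOn (Yg (i + 1)) (Ici t₀) := fun i hi => by
    rcases (Nat.succ_le_of_lt hi).eq_or_lt with hi' | hi'
    · rw [show i + 1 = n from hi', hYgn]
      refine (LocallyIntegrableOn.finsetSum _ fun k _ => ?_).neg
      exact ((continuousOn_const.locallyIntegrableOn measurableSet_Ici).add (hr k)).mul_continuousOn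
        (hVc k) isLocallyClosed_Ici
    · rw [show Yg (i + 1) = V (i + 1) from hYg ⟨i + 1, hi'⟩]
      exact (hVc ⟨i + 1, hi'⟩).locallyIntegrableOn measurableSet_Ici
  have hchain : ∀ i < n, IsPrimitiveOn t₀ (Yg i) (Yg (i + 1)) := fun i hi => by
    have hI := fun {b c : ℝ} (hb : t₀ ≤ b) (hc : t₀ ≤ c) =>
      intervalIntegrable_of_locallyIntegrableOn (hloc i hi) hb hc
    have hl : ∀ t ∈ Icc t₀ T, Yg i t = Yg i T - ∫ s in t..T, Yg (i + 1) s := fun t ht => by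
      rw [show Yg i = V i from hYg ⟨i, hi⟩, hVl ⟨i, hi⟩ ht, hVr ⟨i, hi⟩ self_mem_Ici]
      dsimp only
      rw [hUeq t ht]
      congr 1
      refine intervalIntegral.integral_congr fun s hs => ?_
      rw [uIcc_of_le ht.2] at hs
      exact (hYl ⟨i, hi⟩ s ⟨ht.1.trans hs.1, hs.2⟩).symm
    refine ⟨hloc i hi, fun t ht => ?_⟩
    rcases le_total t T with htT | htT
    · rw [hl t ⟨ht, htT⟩, hl t₀ ⟨le_rfl, hT⟩,
        ← intervalIntegral.integral_add_adjacent_intervals (hI le_rfl ht) (hI ht hT)]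
      ring
    · have hc : ∫ s in T..t, Yg (i + 1) s = ∫ s in T..t, Y (i + 1) s :=
        intervalIntegral.integral_congr fun s hs => by
          rw [uIcc_of_le htT] at hs
          exact hYr (i + 1) hi hs.1
      rw [hl t₀ ⟨le_rfl, hT⟩,
        ← intervalIntegral.integral_add_adjacent_intervals (hI le_rfl hT) (hI hT ht),
        hYr i hi.le htT, hYr i hi.le self_mem_Ici, (h i hi).eq t htT, hc]
      ring
  obtain ⟨hsol, hj⟩ := isSolution_of_chain (a := a) (r := r) hn hchain (fun t _ => by
    rw [hYgn]; simp only [hYg])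
  exact ⟨Yg 0, hsol, fun i hi t ht => (hj i hi t (hT.trans ht)).trans
    (hYr i (by omega) ht)⟩

/-! The derivatives of `G[f]` -/

/-- `∑_j Γ_j⁻¹ γ_j^i G_{γ_j}[f]`, which for `i < m` is the `i`-th derivative of `G[f]`. -/
noncomputable def greenJet {m : ℕ} (T : ℝ) (γ : Fin m → ℂ) (f : ℝ → ℂ) (i : ℕ) (t : ℝ) : ℂ :=
  ∑ j, (Gam γ j)⁻¹ * γ j ^ i * greenOp T (γ j) f t

theorem greenJet_zero {m : ℕ} (T : ℝ) (γ : Fin m → ℂ) (f : ℝ → ℂ) (t : ℝ) :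
    greenJet T γ f 0 t = greenSum T γ f t := by
  simp [greenJet, greenSum]

/-- Each G_{γ_j}[f] contributes `f` to its derivative, with total weight ∑ Γ_j⁻¹ γ_j^i, which is 0
until i = m-1 and then 1. -/
theorem isPrimitiveOn_greenJet {m : ℕ} {T : ℝ} {γ : Fin m → ℂ} {f : ℝ → ℂ}
    (hinj : Function.Injective γ) (hγ : ∀ j, (γ j).re ≠ 0) (hf : LocallyIntegrableOn f (Ici T))
    (h : ∀ j, GreenConverges T (γ j) f) {i : ℕ} (hi : i < m) :
    IsPrimitiveOn T (greenJet T γ f i)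
      (fun t => greenJet T γ f (i + 1) t + if i + 1 = m then f t else 0) := by
  have h1 : IsPrimitiveOn T (greenJet T γ f i) _ := IsPrimitiveOn.sum (s := Finset.univ)
    fun j _ => (isPrimitiveOn_greenOp (hγ j) hf (h j)).const_mul ((Gam γ j)⁻¹ * γ j ^ i)
  refine h1.congr (fun _ _ => rfl) fun t _ => ?_
  have h2 := sum_pow_div_Gam hinj hi
  have h3 : (if i + 1 = m then f t else 0) = (∑ j, (Gam γ j)⁻¹ * γ j ^ i) * f t := by
    rw [h2]; split_ifs <;> simp
  dsimp only
  rw [h3, greenJet, Finset.sum_mul, ← Finset.sum_add_distrib]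
  refine Finset.sum_congr rfl fun j _ => ?_
  ring

theorem continuousOn_greenJet {m : ℕ} {T : ℝ} {γ : Fin m → ℂ} {f : ℝ → ℂ}
    (hγ : ∀ j, (γ j).re ≠ 0) (hf : LocallyIntegrableOn f (Ici T))
    (h : ∀ j, GreenConverges T (γ j) f) (i : ℕ) : ContinuousOn (greenJet T γ f i) (Ici T) :=
  continuousOn_finsetSum _ fun j _ =>
    continuousOn_const.mul (isPrimitiveOn_greenOp (hγ j) hf (h j)).continuousOn

theorem greenOp_congr {T : ℝ} {ω : ℂ} {f g : ℝ → ℂ} (h : EqOn f g (Ici T)) (t : ℝ) :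
    greenOp T ω f t = greenOp T ω g t := by
  unfold greenOp limUnder
  congr 1
  refine Filter.map_congr ?_
  filter_upwards [eventually_ge_atTop T] with S hS
  refine intervalIntegral.integral_congr fun s hs => ?_
  rw [uIcc_of_le hS] at hs
  rw [h hs.1]

theorem greenJet_congr {m : ℕ} {T : ℝ} {γ : Fin m → ℂ} {f g : ℝ → ℂ} (h : EqOn f g (Ici T))
    (i : ℕ) (t : ℝ) : greenJet T γ f i t = greenJet T γ g i t := by
  simp only [greenJet, greenOp_congr h]

theorem absGreenOp_congr {T : ℝ} {ω : ℂ} {f g : ℝ → ℂ} (h : EqOn f g (Ici T)) (t : ℝ) :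
    absGreenOp T ω f t = absGreenOp T ω g t :=
  setLIntegral_congr_fun measurableSet_Ici fun s hs => by rw [h hs]

theorem expInt_mul_add_le {δ T A B t : ℝ} {h : ℝ → ℝ} (hδ : 0 < δ) (hA : 0 ≤ A) (hB : 0 ≤ B)
    (hh : ∀ s, 0 ≤ h s) :
    expInt δ T (fun s => A * h s + B) t ≤
      ENNReal.ofReal A * expInt δ T h t + ENNReal.ofReal (B * expMass δ) := by
  have h1 : expInt δ T (fun s => A * h s + B) t =
      ∫⁻ s in Ici T, (ENNReal.ofReal B * ENNReal.ofReal (Real.exp (-δ * |t - s|)) +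
        ENNReal.ofReal A * ENNReal.ofReal (Real.exp (-δ * |t - s|) * h s)) := by
    refine lintegral_congr fun s => ?_
    rw [← ENNReal.ofReal_mul hA, ← ENNReal.ofReal_mul hB, ← ENNReal.ofReal_add (by positivity)
      (mul_nonneg hA (mul_nonneg (Real.exp_pos _).le (hh s)))]
    ring_nf
  rw [h1, lintegral_add_left (by fun_prop), lintegral_const_mul _ (by fun_prop),
    lintegral_const_mul' _ _ ENNReal.ofReal_ne_top, add_comm, ENNReal.ofReal_mul hB,
    ← lintegral_exp_neg_mul_abs_sub hδ t, expInt]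
  gcongr
  exact Measure.restrict_le_self

/-! Integrability of products -/

/-- Young's inequality; since y ≤ 1, the conjugate exponent may be lowered to p. -/
theorem mul_le_rpow_add_rpow {x y p q q' : ℝ} (hx : 0 ≤ x) (hy : 0 ≤ y) (hy1 : y ≤ 1)
    (hq : q.HolderConjugate q') (hp : p ≤ q') (hp0 : 0 < p) : x * y ≤ x ^ q + y ^ p := by
  have h1 := Real.young_inequality_of_nonneg hx hy hq
  have h2 : x ^ q / q ≤ x ^ q := div_le_self (by positivity) hq.lt.le
  have h3 : y ^ q' / q' ≤ y ^ q' := div_le_self (by positivity) hq.symm.lt.le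
  have h4 : y ^ q' ≤ y ^ p := Real.rpow_le_rpow_of_exponent_ge' hy hy1 hp0.le hp
  linarith

theorem integrableOn_norm_mul {T p q q' : ℝ} {f : ℝ → ℂ} {w : ℝ → ℝ} (hw : Continuous w)
    (hw0 : ∀ t, 0 < w t) (hw1 : ∀ t ∈ Ici T, w t ≤ 1)
    (hwp : IntegrableOn (fun t => w t ^ p) (Ici T))
    (hq : q.HolderConjugate q') (hp : p ≤ q') (hp0 : 0 < p)
    (hf : MemLp f (ENNReal.ofReal q) (volume.restrict (Ici T))) :
    IntegrableOn (fun t => ‖f t‖ * w t) (Ici T) := by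
  refine Integrable.mono' ((integrableOn_rpow_of_memLp hq.lt hf).add hwp)
    (hf.aestronglyMeasurable.norm.mul hw.aestronglyMeasurable) ?_
  filter_upwards [ae_restrict_mem measurableSet_Ici] with t ht
  rw [Real.norm_of_nonneg (mul_nonneg (norm_nonneg _) (hw0 t).le)]
  exact mul_le_rpow_add_rpow (norm_nonneg _) (hw0 t).le (hw1 t ht) hq hp hp0

/-- As q_k ≤ 2, the exponent conjugate to q_k is at least 2, hence at least p. This is the use of
the upper bound 2 on the exponents. -/
theorem integrableOn_pertNorm_mul {n : ℕ} {r : Fin n → ℝ → ℂ} {lam : ℂ} {T p : ℝ} {q : ℕ → ℝ}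
    (hq : ∀ k ∈ Finset.Icc 1 n, 1 < q k ∧ q k ≤ 2 ∧
      MemLp (pertDeriv r lam k) (ENNReal.ofReal (q k)) (volume.restrict (Ici T)))
    (hp0 : 0 < p) (hp2 : p ≤ 2) {w : ℝ → ℝ} (hw : Continuous w)
    (hw0 : ∀ t, 0 < w t) (hw1 : ∀ t ∈ Ici T, w t ≤ 1)
    (hwp : IntegrableOn (fun t => w t ^ p) (Ici T)) :
    IntegrableOn (fun t => pertNorm r lam t * w t) (Ici T) := by
  simp only [pertNorm, Finset.sum_mul]
  refine integrable_finsetSum _ fun k hk => ?_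
  obtain ⟨h1, h2, h3⟩ := hq k hk
  refine integrableOn_norm_mul hw hw0 hw1 hwp (Real.HolderConjugate.conjExponent h1) ?_ hp0 h3
  rw [Real.conjExponent, le_div_iff₀ (by linarith)]
  nlinarith

/-! ### Existence for the integrated Riccati type equation -/

/-- Extension of a finite sequence by zero. -/
def zeroExt {m : ℕ} (x : Fin m → ℂ) (k : ℕ) : ℂ := if h : k < m then x ⟨k, h⟩ else 0

theorem zeroExt_of_lt {m : ℕ} (x : Fin m → ℂ) {k : ℕ} (h : k < m) : zeroExt x k = x ⟨k, h⟩ :=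
  dif_pos h

theorem zeroExt_zero {m : ℕ} : zeroExt (0 : Fin m → ℂ) = 0 := by
  funext k; simp [zeroExt]

theorem norm_zeroExt_le {m : ℕ} (x : Fin m → ℂ) (k : ℕ) : ‖zeroExt x k‖ ≤ ‖x‖ := by
  unfold zeroExt
  split_ifs with h
  · exact norm_le_pi_norm x _
  · simp

theorem norm_zeroExt_sub_le {m : ℕ} (x x' : Fin m → ℂ) (k : ℕ) :
    ‖zeroExt x k - zeroExt x' k‖ ≤ ‖x - x'‖ := by
  unfold zeroExt
  split_ifs with h
  · exact norm_le_pi_norm (x - x') _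
  · simp

theorem linPart_zero {n : ℕ} (r : Fin n → ℝ → ℂ) (lam : ℂ) (t : ℝ) : linPart r lam t 0 = 0 := by
  simp [linPart]

theorem linPart_add {n : ℕ} (r : Fin n → ℝ → ℂ) (lam : ℂ) (t : ℝ) (Z Z' : ℕ → ℂ) :
    linPart r lam t (Z + Z') = linPart r lam t Z + linPart r lam t Z' := by
  simp [linPart, mul_add, Finset.sum_add_distrib]

theorem norm_greenJet_le {m : ℕ} {T : ℝ} {γ : Fin m → ℂ} {f : ℝ → ℂ} {t D : ℝ}
    (h : ∀ j, ‖greenOp T (γ j) f t‖ ≤ D) (i : ℕ) :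
    ‖greenJet T γ f i t‖ ≤ (∑ j, ‖(Gam γ j)⁻¹ * γ j ^ i‖) * D := by
  rw [greenJet, Finset.sum_mul]
  refine (norm_sum_le _ _).trans (Finset.sum_le_sum fun j _ => ?_)
  rw [norm_mul]
  exact mul_le_mul_of_nonneg_left (h j) (norm_nonneg _)

theorem norm_greenOp_le_of_absGreenOp_le {T : ℝ} {ω : ℂ} {f : ℝ → ℂ} {t D : ℝ}
    (hf : LocallyIntegrableOn f (Ici T)) (hD : 0 ≤ D) (h : absGreenOp T ω f t ≤ ENNReal.ofReal D) :
    ‖greenOp T ω f t‖ ≤ D := by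
  have h1 := (enorm_greenOp_le (ω := ω) (t := t) hf).trans h
  rwa [← ofReal_norm, ENNReal.ofReal_le_ofReal_iff hD] at h1

/-- The linear and the shifted nonlinear part, as a function of finitely many variables. -/
noncomputable def riccatiRhs {n : ℕ} (a : Fin n → ℂ) (r : Fin n → ℝ → ℂ) (lam : ℂ)
    (Θ : ℝ → ℕ → ℂ) (s : ℝ) (x : Fin (n - 1) → ℂ) : ℂ :=
  linPart r lam s (zeroExt x) + shiftedNonlin a r lam s (Θ s) (zeroExt x)

theorem riccatiRhs_zero {n : ℕ} (a : Fin n → ℂ) (r : Fin n → ℝ → ℂ) (lam : ℂ)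
    (Θ : ℝ → ℕ → ℂ) (s : ℝ) : riccatiRhs a r lam Θ s 0 = 0 := by
  simp [riccatiRhs, zeroExt_zero, linPart_zero, shiftedNonlin]

theorem locallyIntegrableOn_riccatiRhs {n : ℕ} (hn : 0 < n) (a : Fin n → ℂ) {r : Fin n → ℝ → ℂ}
    {lam : ℂ} {Θ : ℝ → ℕ → ℂ} {T : ℝ} (hr : ∀ i, LocallyIntegrableOn (r i) (Ici T))
    (hΘ : ∀ k < n - 1, ContinuousOn (fun t => Θ t k) (Ici T)) {U : ℝ → Fin (n - 1) → ℂ}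
    (hU : ContinuousOn U (Ici T)) :
    LocallyIntegrableOn (fun s => riccatiRhs a r lam Θ s (U s)) (Ici T) := by
  have h1 : ∀ k < n - 1, ContinuousOn (fun t => zeroExt (U t) k) (Ici T) := fun k hk => by
    simp only [zeroExt_of_lt _ hk]
    exact continuousOn_pi.1 hU _
  exact (locallyIntegrableOn_linPart hr lam h1).add
    ((locallyIntegrableOn_nonlinPart hn a hr lam fun k hk => (h1 k hk).add (hΘ k hk)).sub
      (locallyIntegrableOn_nonlinPart hn a hr lam hΘ))

theorem exists_shiftedNonlin_le {n : ℕ} (hn : 0 < n) (a : Fin n → ℂ) (lam : ℂ) :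
    ∃ C : ℝ, 0 ≤ C ∧ ∀ (r : Fin n → ℝ → ℂ) (t : ℝ) (Θ X X' : ℕ → ℂ) (ρ d : ℝ), ρ ≤ 1 →
      0 ≤ ρ → 0 ≤ d → (∀ k < n - 1, ‖X k‖ + ‖Θ k‖ ≤ ρ) → (∀ k < n - 1, ‖X' k‖ + ‖Θ k‖ ≤ ρ) →
      (∀ k < n - 1, ‖X k - X' k‖ ≤ d) →
      ‖shiftedNonlin a r lam t Θ X - shiftedNonlin a r lam t Θ X'‖ ≤
        C * (1 + pertNorm r lam t) * (ρ * d) := by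
  obtain ⟨C, hC0, hC⟩ := exists_nonlinPart_lipschitz hn a lam
  refine ⟨C, hC0, fun r t Θ X X' ρ d hρ1 hρ hd h h' hd' => ?_⟩
  rw [shiftedNonlin, shiftedNonlin, sub_sub_sub_cancel_right]
  refine hC r t (X + Θ) (X' + Θ) ρ d hρ hρ1 hd (fun k hk => (norm_add_le _ _).trans (h k hk))
    (fun k hk => (norm_add_le _ _).trans (h' k hk)) fun k hk => ?_
  simpa using hd' k hk

/-- Existence of a small solution of the integrated Riccati type equation. -/
theorem exists_riccati_solution {n : ℕ} (hn : 2 ≤ n) (a : Fin n → ℂ) {r : Fin n → ℝ → ℂ}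
    {t₀ : ℝ} (hr : ∀ i, LocallyIntegrableOn (r i) (Ici t₀)) (lam : ℂ) {γ : Fin (n - 1) → ℂ}
    (hinj : Function.Injective γ) {Θ : ℝ → ℕ → ℂ}
    (hΘ : ∀ k < n - 1, ContinuousOn (fun t => Θ t k) (Ici t₀))
    (hΘ0 : Tendsto (fun t => ∑ k ∈ Finset.range (n - 1), ‖Θ t k‖) atTop (𝓝 0))
    {p : ℝ} (hp1 : 1 < p) (hp2 : p ≤ 2) {g : ℝ → ℂ} (hgl : LocallyIntegrableOn g (Ici t₀))
    (hg : MemLp g (ENNReal.ofReal p) (volume.restrict (Ici t₀)))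
    {q : ℕ → ℝ} (hq : ∀ k ∈ Finset.Icc 1 n, 1 < q k ∧ q k ≤ 2 ∧
      MemLp (pertDeriv r lam k) (ENNReal.ofReal (q k)) (volume.restrict (Ici t₀)))
    (hγ0 : ∀ j, (γ j).re ≠ 0) :
    (∀ j, GreenConverges t₀ (γ j) g) ∧ ∃ T, t₀ ≤ T ∧ ∃ u f : ℝ → ℂ,
      LocallyIntegrableOn f (Ici T) ∧
      (∀ s ∈ Ici T, f s = linPart r lam s (jet T u s) +
        shiftedNonlin a r lam s (Θ s) (jet T u s)) ∧
      (∀ j, GreenConverges T (γ j) f) ∧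
      (∀ j, Tendsto (greenOp T (γ j) f) atTop (𝓝 0)) ∧
      (∀ k < n - 1, ∀ t ∈ Ici T, jet T u t k =
        -(greenJet t₀ γ g k t + greenJet T γ f k t)) ∧
      (∀ k < n - 1, Tendsto (fun t => jet T u t k) atTop (𝓝 0)) ∧
      IntegrableOn (fun s => linPart r lam s (jet T u s)) (Ici T) ∧
      ((∀ k < n - 1, MemLp (fun t => Θ t k) (ENNReal.ofReal (p / (p - 1)))
          (volume.restrict (Ici t₀))) →
        IntegrableOn (fun s => shiftedNonlin a r lam s (Θ s) (jet T u s)) (Ici T)) := by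
  have : Nonempty (Fin (n - 1)) := ⟨⟨0, by omega⟩⟩
  -- α is the slowest decay rate of the kernels. The weight will vary at the rate α/2, which leaves
  -- α/2 for averaging the coefficients.
  obtain ⟨j₀, hj₀⟩ := Finite.exists_min fun j => |(γ j).re|
  obtain ⟨α, hα⟩ : ∃ α, α = |(γ j₀).re| := ⟨_, rfl⟩
  rw [← hα] at hj₀
  have hα0 : 0 < α := hα ▸ abs_pos.2 (hγ0 j₀)
  obtain ⟨w, hw0, hws, hwp, hwc, hwt, hwg⟩ := exists_majorant (half_pos hα0) hp1 hg
  obtain ⟨Cg, hCg0, hCg⟩ := hwg α (half_lt_self hα0)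
  obtain ⟨C, hC0, hC⟩ := exists_shiftedNonlin_le (by omega : 0 < n) a lam
  -- constants
  let B : ℝ := ∑ i : Fin (n - 1), ∑ j, ‖(Gam γ j)⁻¹ * γ j ^ (i : ℕ)‖
  have hBi : ∀ i : Fin (n - 1), ∑ j, ‖(Gam γ j)⁻¹ * γ j ^ (i : ℕ)‖ ≤ B := fun i =>
    Finset.single_le_sum (f := fun i : Fin (n - 1) => ∑ j, ‖(Gam γ j)⁻¹ * γ j ^ (i : ℕ)‖)
      (fun i _ => Finset.sum_nonneg fun _ _ => norm_nonneg _) (Finset.mem_univ i)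
  have hB0 : 0 ≤ B :=
    Finset.sum_nonneg fun i _ => Finset.sum_nonneg fun _ _ => norm_nonneg _
  have hK := expMass_nonneg (α / 2)
  -- τ is the admissible size of the averaged Lipschitz coefficient, so that B τ ≤ 1/2. Half of it
  -- is reserved for `pertNorm`, the other half for the constant C ρ, which determines ρ.
  obtain ⟨τ, hτ⟩ : ∃ τ, τ = 1 / (2 * (B + 1)) := ⟨_, rfl⟩
  have hτ0 : 0 < τ := by rw [hτ]; positivity
  have hBτ : B * τ ≤ 1 / 2 := by
    rw [hτ, mul_one_div, div_le_div_iff₀ (by positivity) (by positivity)]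
    linarith
  obtain ⟨ρ, hρ⟩ : ∃ ρ, ρ = min 1 (τ / (2 * ((C + 1) * (expMass (α / 2) + 1)))) := ⟨_, rfl⟩
  have hρ0 : 0 < ρ := by rw [hρ]; positivity
  have hρ1 : ρ ≤ 1 := hρ ▸ min_le_left _ _
  have hρK : C * ρ * expMass (α / 2) ≤ τ / 2 := by
    have h1 : ρ ≤ τ / (2 * ((C + 1) * (expMass (α / 2) + 1))) := hρ ▸ min_le_right _ _
    rw [le_div_iff₀ (by positivity)] at h1
    have h2 : C * expMass (α / 2) ≤ (C + 1) * (expMass (α / 2) + 1) := by nlinarith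
    nlinarith
  -- The base term -G[g] and its derivatives are at most B Cg w = (M/2) w.
  let M : ℝ := 2 * (B * Cg)
  have hM0 : 0 ≤ M := by positivity
  -- the base term
  have hgabs : ∀ j, ∀ t, absGreenOp t₀ (γ j) g t ≤ ENNReal.ofReal (Cg * w t) := fun j t =>
    (absGreenOp_le_expInt _ _ _ _).trans ((expInt_mono (hj₀ j) (fun _ _ => norm_nonneg _)
      fun _ _ => le_rfl).trans (hCg t))
  have hgconv : ∀ j, GreenConverges t₀ (γ j) g := fun j =>
    greenConverges_of_absGreenOp_ne_top hgl fun t _ =>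
      ((hgabs j t).trans_lt ENNReal.ofReal_lt_top).ne
  refine ⟨hgconv, ?_⟩
  -- choice of `T`
  have hsmall := (isSmallAtTop_pertNorm hq).expInt_le (half_pos hα0)
    (show (0 : ℝ) < τ / 2 / (1 + C) by positivity)
  obtain ⟨T₀, hT₀⟩ := eventually_atTop.1 (hsmall.and
    ((hΘ0.eventually_le_const (half_pos hρ0)).and
      (((hwt.const_mul M).eventually_le_const (show M * 0 < ρ / 2 by simpa using hρ0)).and
        (hwt.eventually_le_const one_pos))))
  obtain ⟨T, hT⟩ : ∃ T, T = max t₀ T₀ := ⟨_, rfl⟩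
  have htT : t₀ ≤ T := hT ▸ le_max_left _ _
  have hTT : T₀ ≤ T := hT ▸ le_max_right _ _
  have hTs := (hT₀ T hTT).1
  have hTΘ : ∀ t ∈ Ici T, ∀ k < n - 1, ‖Θ t k‖ ≤ ρ / 2 := fun t ht k hk =>
    (Finset.single_le_sum (f := fun k => ‖Θ t k‖) (fun _ _ => norm_nonneg _)
      (Finset.mem_range.2 hk)).trans (hT₀ t (hTT.trans ht)).2.1
  have hTM : ∀ t ∈ Ici T, M * w t ≤ ρ / 2 := fun t ht => (hT₀ t (hTT.trans ht)).2.2.1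
  have hTw : ∀ t ∈ Ici T, w t ≤ 1 := fun t ht => (hT₀ t (hTT.trans ht)).2.2.2
  have hsub : Ici T ⊆ Ici t₀ := Ici_subset_Ici.2 htT
  -- the fixed point
  obtain ⟨U, hU, hUM, hUabs, hUeq⟩ := exists_green_fixedPoint hγ0
    (fun i j => (Gam γ j)⁻¹ * γ j ^ (i : ℕ)) (T := T) (w := w)
    (κ := fun s => (1 + C) * pertNorm r lam s + C * ρ) hwc.continuousOn hw0 hM0 hτ0.le hBi hBτ
    (fun s => by have := pertNorm_nonneg r lam s; positivity)
    (fun j t ht => by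
      refine (expInt_mono (hj₀ j) (fun s _ => ?_) fun s _ => le_rfl).trans
        ((expInt_mul_le (β := α / 2) (fun s => ?_) hws).trans ?_)
      · have := pertNorm_nonneg r lam s
        have := (hw0 s).le
        positivity
      · have := pertNorm_nonneg r lam s
        positivity
      · rw [sub_half, ENNReal.ofReal_mul hτ0.le]
        gcongr
        refine (expInt_mul_add_le (half_pos hα0) (by positivity) (by positivity)
          (pertNorm_nonneg r lam)).trans ?_
        calc _ ≤ ENNReal.ofReal (1 + C) * ENNReal.ofReal (τ / 2 / (1 + C)) +
              ENNReal.ofReal (τ / 2) := by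
              gcongr
              exact hTs t
          _ = ENNReal.ofReal τ := by
              rw [← ENNReal.ofReal_mul (by positivity), mul_div_cancel₀ _ (by positivity),
                ← ENNReal.ofReal_add (by positivity) (by positivity), add_halves])
    (N := riccatiRhs a r lam Θ) (riccatiRhs_zero a r lam Θ)
    (fun U hU => locallyIntegrableOn_riccatiRhs (by omega) a (fun i => (hr i).mono_set hsub)
      (fun k hk => (hΘ k hk).mono hsub) hU)
    (fun s hs x x' hx hx' => by
      have h1 := norm_linPart_sub_le r lam s (norm_nonneg _)
        fun k _ => norm_zeroExt_sub_le x x' k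
      have h2 := hC r s (Θ s) (zeroExt x) (zeroExt x') ρ ‖x - x'‖ hρ1 hρ0.le (norm_nonneg _)
        (fun k hk => by
          linarith [norm_zeroExt_le x k, hTΘ s hs k hk, hTM s hs])
        (fun k hk => by
          linarith [norm_zeroExt_le x' k, hTΘ s hs k hk, hTM s hs])
        fun k _ => norm_zeroExt_sub_le x x' k
      rw [riccatiRhs, riccatiRhs, add_sub_add_comm]
      refine (norm_add_le _ _).trans ((add_le_add h1 h2).trans ?_)
      have h3 := mul_le_mul_of_nonneg_left hρ1
        (mul_nonneg hC0 (mul_nonneg (pertNorm_nonneg r lam s) (norm_nonneg (x - x'))))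
      linarith)
    (b := fun t i => -greenJet t₀ γ g i t)
    (continuousOn_pi.2 fun i => (continuousOn_greenJet hγ0 hgl hgconv i).neg.mono hsub)
    (fun t ht => by
      have := (hw0 t).le
      refine (pi_norm_le_iff_of_nonneg (by positivity)).2 fun i => ?_
      rw [norm_neg]
      refine (norm_greenJet_le (fun j => norm_greenOp_le_of_absGreenOp_le hgl (by positivity)
        (hgabs j t)) i).trans ?_
      calc _ ≤ B * (Cg * w t) := by gcongr; exact hBi i
        _ = M / 2 * w t := by simp only [M]; ring)
  obtain ⟨f, hf⟩ : ∃ f, f = fun s => riccatiRhs a r lam Θ s (U s) := ⟨_, rfl⟩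
  have hfl : LocallyIntegrableOn f (Ici T) := hf ▸ locallyIntegrableOn_riccatiRhs (by omega) a
    (fun i => (hr i).mono_set hsub) (fun k hk => (hΘ k hk).mono hsub) hU
  rw [← hf] at hUabs
  simp only [← hf] at hUeq
  have hfconv : ∀ j, GreenConverges T (γ j) f := fun j =>
    greenConverges_of_absGreenOp_ne_top hfl fun t ht =>
      ((hUabs j t ht).trans_lt ENNReal.ofReal_lt_top).ne
  have hchain : ∀ i < n - 1 - 1, IsPrimitiveOn T
      (fun t => -(greenJet t₀ γ g i t + greenJet T γ f i t))
      (fun t => -(greenJet t₀ γ g (i + 1) t + greenJet T γ f (i + 1) t)) := fun i hi => by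
    have h1 := ((isPrimitiveOn_greenJet hinj hγ0 hgl hgconv (by omega : i < n - 1)).mono htT).add
      (isPrimitiveOn_greenJet hinj hγ0 hfl hfconv (by omega : i < n - 1))
    simp only [if_neg (show ¬ i + 1 = n - 1 by omega), add_zero] at h1
    exact (h1.const_mul (-1)).congr (fun t _ => by ring) fun t _ => by ring
  have hYc : ∀ i, ContinuousOn (fun t => -(greenJet t₀ γ g i t + greenJet T γ f i t)) (Ici T) :=
    fun i => (((continuousOn_greenJet hγ0 hgl hgconv i).mono hsub).add
      (continuousOn_greenJet hγ0 hfl hfconv i)).neg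
  obtain ⟨hj, -⟩ := jet_eq_of_chain
    (Y := fun i t => -(greenJet t₀ γ g i t + greenJet T γ f i t)) hchain (hYc _)
  obtain ⟨u, hu⟩ : ∃ u, u = fun t => -(greenJet t₀ γ g 0 t + greenJet T γ f 0 t) := ⟨_, rfl⟩
  simp only [← hu] at hj
  have hju : ∀ k < n - 1, ∀ t ∈ Ici T,
      jet T u t k = -(greenJet t₀ γ g k t + greenJet T γ f k t) := fun k hk =>
    hj k (by omega)
  -- The components of the fixed point were independent unknowns; the chain of primitives identifies
  -- them with the derivatives of its first component.
  have hjU : ∀ k < n - 1, ∀ t ∈ Ici T, jet T u t k = zeroExt (U t) k := fun k hk t ht => by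
    rw [hju k hk t ht, zeroExt_of_lt _ hk, hUeq t ht ⟨k, hk⟩, neg_add']
    rfl
  have hjM : ∀ k < n - 1, ∀ t ∈ Ici T, ‖jet T u t k‖ ≤ M * w t := fun k hk t ht => by
    rw [hjU k hk t ht]
    exact (norm_zeroExt_le _ _).trans (hUM t ht)
  have hjc : ∀ k < n - 1, ContinuousOn (fun t => jet T u t k) (Ici T) := fun k hk =>
    (hYc k).congr (hju k hk)
  have hlin := locallyIntegrableOn_linPart (fun i => (hr i).mono_set hsub) lam hjc
  have hshift : LocallyIntegrableOn (fun s => shiftedNonlin a r lam s (Θ s) (jet T u s)) (Ici T) :=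
    (locallyIntegrableOn_nonlinPart (by omega) a (fun i => (hr i).mono_set hsub) lam
      fun k hk => (hjc k hk).add ((hΘ k hk).mono hsub)).sub
      (locallyIntegrableOn_nonlinPart (by omega) a (fun i => (hr i).mono_set hsub) lam
        fun k hk => (hΘ k hk).mono hsub)
  have hwpT := hwp.mono_set hsub
  have hpw := integrableOn_pertNorm_mul (fun k hk => ⟨(hq k hk).1, (hq k hk).2.1,
    (hq k hk).2.2.mono_measure (Measure.restrict_mono hsub le_rfl)⟩)
    (by linarith) hp2 hwc hw0 hTw hwpT
  refine ⟨T, htT, u, f, hfl, fun s hs => ?_, hfconv, fun j => ?_, hju, fun k hk => ?_, ?_,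
    fun hΘp => ?_⟩
  · simp only [hf, riccatiRhs, shiftedNonlin]
    rw [linPart_congr r lam s (Z := zeroExt (U s)) (Z' := jet T u s) fun k hk =>
      (hjU k hk s hs).symm, nonlinPart_congr (by omega) a r lam s (Z := zeroExt (U s) + Θ s)
      (Z' := jet T u s + Θ s) fun k hk => by simp [hjU k hk s hs]]
  · refine squeeze_zero_norm' ?_ (by simpa using (hwt.const_mul τ).const_mul M)
    filter_upwards [eventually_ge_atTop T] with t ht
    exact norm_greenOp_le_of_absGreenOp_le hfl
      (mul_nonneg hM0 (mul_nonneg hτ0.le (hw0 t).le)) (hUabs j t ht)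
  · refine squeeze_zero_norm' ?_ (by simpa using hwt.const_mul M)
    filter_upwards [eventually_ge_atTop T] with t ht using hjM k hk t ht
  · refine Integrable.mono' (hpw.mul_const M) hlin.aestronglyMeasurable ?_
    filter_upwards [ae_restrict_mem measurableSet_Ici] with s hs
    have h1 := norm_linPart_sub_le r lam s (Z := jet T u s) (Z' := 0)
      (mul_nonneg hM0 (hw0 s).le) fun k hk => by simpa using hjM k hk s hs
    rw [linPart_zero, sub_zero] at h1
    exact h1.trans_eq (by ring)
  -- The shifted nonlinearity is at most a multiple of (1 + `pertNorm`)(M w + ‖Θ‖) w. Here w² ≤ w^p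
  -- because w ≤ 1 and p ≤ 2, the products ‖Θ‖ w are integrable by duality of p and p/(p-1), and M w
  -- + ‖Θ‖ ≤ 1 reduces the rest to `pertNorm` times w.
  · have hww : IntegrableOn (fun t => w t * w t) (Ici T) := by
      refine Integrable.mono' hwpT (by fun_prop) ?_
      filter_upwards [ae_restrict_mem measurableSet_Ici] with s hs
      rw [Real.norm_of_nonneg (mul_self_nonneg _), ← pow_two, ← Real.rpow_natCast]
      exact Real.rpow_le_rpow_of_exponent_ge (hw0 s) (hTw s hs) (by simpa using hp2)
    have hΘw : IntegrableOn (fun t => ∑ k ∈ Finset.range (n - 1), ‖Θ t k‖ * w t) (Ici T) :=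
      integrable_finsetSum _ fun k hk =>
        integrableOn_norm_mul hwc hw0 hTw hwpT (Real.HolderConjugate.conjExponent hp1).symm
          le_rfl (by linarith) ((hΘp k (Finset.mem_range.1 hk)).mono_measure
            (Measure.restrict_mono hsub le_rfl))
    refine Integrable.mono' ((((hww.const_mul M).add hΘw).add hpw).const_mul (C * M))
      hshift.aestronglyMeasurable ?_
    filter_upwards [ae_restrict_mem measurableSet_Ici] with s hs
    have hw := (hw0 s).le
    have hS0 : 0 ≤ ∑ k ∈ Finset.range (n - 1), ‖Θ s k‖ :=
      Finset.sum_nonneg fun _ _ => norm_nonneg _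
    have hS1 : M * w s + ∑ k ∈ Finset.range (n - 1), ‖Θ s k‖ ≤ 1 := by
      linarith [hTM s hs, (hT₀ s (hTT.trans hs)).2.1]
    have hΘk : ∀ k < n - 1, ‖Θ s k‖ ≤ ∑ k ∈ Finset.range (n - 1), ‖Θ s k‖ := fun k hk =>
      Finset.single_le_sum (f := fun k => ‖Θ s k‖) (fun _ _ => norm_nonneg _)
        (Finset.mem_range.2 hk)
    have h1 := hC r s (Θ s) (jet T u s) 0
      (M * w s + ∑ k ∈ Finset.range (n - 1), ‖Θ s k‖) (M * w s) hS1 (by positivity)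
      (by positivity) (fun k hk => add_le_add (hjM k hk s hs) (hΘk k hk))
      (fun k hk => add_le_add (by simpa using mul_nonneg hM0 hw) (hΘk k hk))
      fun k hk => by simpa using hjM k hk s hs
    have h2 : shiftedNonlin a r lam s (Θ s) 0 = 0 := by simp [shiftedNonlin]
    rw [h2, sub_zero] at h1
    refine h1.trans ?_
    have hp0 := pertNorm_nonneg r lam s
    simp only [Pi.add_apply]
    rw [← Finset.sum_mul]
    generalize ∑ k ∈ Finset.range (n - 1), ‖Θ s k‖ = S at hS0 hS1 ⊢
    have h3 : pertNorm r lam s * (M * w s + S) ≤ pertNorm r lam s :=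
      mul_le_of_le_one_right hp0 hS1
    have h4 : 0 ≤ C * (M * w s) := by positivity
    calc C * (1 + pertNorm r lam s) * ((M * w s + S) * (M * w s))
        = C * (M * w s) * ((M * w s + S) + pertNorm r lam s * (M * w s + S)) := by ring
      _ ≤ C * (M * w s) * ((M * w s + S) + pertNorm r lam s) := by gcongr
      _ = _ := by ring

/-! ### Return to the linear equation and the error term -/

/-- The factor `c` serves both G[f] and θ = -G[f]. -/
theorem jet_mul_greenJet {m : ℕ} {T : ℝ} {γ : Fin m → ℂ} {f : ℝ → ℂ}
    (hinj : Function.Injective γ) (hγ : ∀ j, (γ j).re ≠ 0) (hf : LocallyIntegrableOn f (Ici T))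
    (h : ∀ j, GreenConverges T (γ j) f) (c : ℂ) {k : ℕ} (hk : k < m) {t : ℝ} (ht : T ≤ t) :
    jet T (fun t => c * greenJet T γ f 0 t) t k = c * greenJet T γ f k t := by
  refine (jet_eq_of_chain (k := m - 1) (Y := fun i t => c * greenJet T γ f i t) (fun i hi => ?_)
    (continuousOn_const.mul (continuousOn_greenJet hγ hf h _))).1 k (by omega) t ht
  have h1 := isPrimitiveOn_greenJet hinj hγ hf h (by omega : i < m)
  simp only [if_neg (show ¬ i + 1 = m by omega), add_zero] at h1
  exact h1.const_mul c

/-- From the Riccati type equation back to the linear equation. -/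
theorem exists_solution_of_riccati {n : ℕ} (hn : 2 ≤ n) {a : Fin n → ℂ} {r : Fin n → ℝ → ℂ}
    {t₀ T : ℝ} (hr : ∀ i, LocallyIntegrableOn (r i) (Ici t₀)) (hT : t₀ ≤ T) {lam : ℂ}
    (hlam : (charPoly a).IsRoot lam) {Z : ℝ → ℕ → ℂ}
    (hZ : ∀ i < n - 1, IsPrimitiveOn T (fun t => Z t i) (fun t => Z t (i + 1)))
    (heq : ∀ t ∈ Ici T, pertDeriv r lam 0 t +
      ∑ k ∈ Finset.Icc 1 n, (Polynomial.taylor lam (charPoly a)).coeff k * Z t (k - 1) +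
        linPart r lam t (Z t) + nonlinPart a r lam t (Z t) = 0) (c : ℂ) :
    ∃ y, IsSolution a r t₀ y ∧ ∀ i ≤ n - 1, ∀ t ∈ Ici T, jet t₀ y t i =
      c * Complex.exp (∫ s in T..t, (lam + Z s 0)) * expBell lam (Z t) i := by
  have hc : ContinuousOn (fun t => lam + Z t 0) (Ici T) :=
    continuousOn_const.add (hZ 0 (by omega)).continuousOn
  have h1 := IsPrimitiveOn.integral (hc.locallyIntegrableOn measurableSet_Ici) 0
  have hy : IsPrimitiveOn T (fun t => c * Complex.exp (∫ s in T..t, (lam + Z s 0)))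
      (fun t => (lam + Z t 0) * (c * Complex.exp (∫ s in T..t, (lam + Z s 0)))) := by
    refine ((h1.exp hc).const_mul c).congr (fun t _ => by simp) fun t _ => ?_
    simp only [zero_add]
    ring
  refine exists_extension (by omega) hr hT
    (Y := fun i t => c * Complex.exp (∫ s in T..t, (lam + Z s 0)) * expBell lam (Z t) i)
    (fun i hi => isPrimitiveOn_expBell hy i fun k hk => hZ k (by omega)) fun t ht => ?_
  have h2 := sum_mul_expBell hn hlam (r := r) t (Z t)
  rw [heq t ht] at h2
  rw [eq_neg_of_add_eq_zero_left h2, mul_neg, Finset.mul_sum]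
  congr 1
  refine Finset.sum_congr rfl fun k _ => ?_
  ring

/-- The exponent tends to zero, by hypothesis in its Green terms and by integrability in its tail;
so eventually |e^x - 1| ≤ 2|x|, and each summand of x has its counterpart in the bound. -/
theorem exists_enorm_exp_sub_one_le {m : ℕ} (d : Fin m → ℂ) (S : ℂ) {T : ℝ} {γ : Fin m → ℂ}
    {f : ℝ → ℂ} (hf : IntegrableOn f (Ici T))
    (h0 : ∀ j, Tendsto (greenOp T (γ j) f) atTop (𝓝 0)) :
    ∃ K : ℝ≥0, ∀ᶠ t in atTop,
      ‖Complex.exp (-∑ j, d j * greenOp T (γ j) f t - S * ∫ s in Ioi t, f s) - 1‖ₑ ≤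
        (K : ℝ≥0∞) * (∑ j, absGreenOp T ((γ j).re : ℂ) f t + ∫⁻ s in Ici t, ‖f s‖ₑ) := by
  have htail : Tendsto (fun t => ∫ s in Ioi t, f s) atTop (𝓝 0) := by
    have h1 := tendsto_setLIntegral_Ici (t₀ := T) (φ := fun s => ‖f s‖ₑ) hf.2.ne
    rw [tendsto_zero_iff_enorm_tendsto_zero]
    exact tendsto_of_tendsto_of_tendsto_of_le_of_le tendsto_const_nhds h1 (fun _ => zero_le)
      fun t => (enorm_integral_le_lintegral_enorm _).trans (lintegral_mono_set Ioi_subset_Ici_self)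
  have hx : Tendsto (fun t => -∑ j, d j * greenOp T (γ j) f t - S * ∫ s in Ioi t, f s) atTop
      (𝓝 0) := by
    have h1 : Tendsto (fun t => ∑ j, d j * greenOp T (γ j) f t) atTop (𝓝 (∑ j : Fin m, 0)) :=
      tendsto_finsetSum _ fun j _ => by simpa using (h0 j).const_mul (d j)
    simpa using h1.neg.sub (htail.const_mul S)
  refine ⟨2 * (∑ j, ‖d j‖₊ + ‖S‖₊), ?_⟩
  filter_upwards [hx.norm.eventually_le_const (show ‖(0 : ℂ)‖ < 1 by simp)] with t ht
  have h1 : ‖Complex.exp (-∑ j, d j * greenOp T (γ j) f t - S * ∫ s in Ioi t, f s) - 1‖ₑ ≤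
      2 * ‖-∑ j, d j * greenOp T (γ j) f t - S * ∫ s in Ioi t, f s‖ₑ := by
    have h2 := ENNReal.ofReal_le_ofReal (Complex.norm_exp_sub_one_le ht)
    rwa [ENNReal.ofReal_mul (by norm_num), ofReal_norm, ofReal_norm, ENNReal.ofReal_ofNat] at h2
  refine h1.trans ?_
  push_cast
  rw [mul_assoc]
  gcongr
  refine enorm_sub_le.trans ?_
  rw [enorm_neg, add_mul]
  gcongr
  · refine (enorm_sum_le _ _).trans ?_
    rw [Finset.sum_mul]
    refine Finset.sum_le_sum fun j _ => ?_
    rw [enorm_mul, enorm_eq_nnnorm]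
    gcongr
    refine (enorm_greenOp_le hf.locallyIntegrableOn).trans ?_
    rw [← absGreenOp_re]
    exact (Finset.single_le_sum (f := fun j => absGreenOp T ((γ j).re : ℂ) f t)
      (fun _ _ => zero_le) (Finset.mem_univ j)).trans le_self_add
  · rw [enorm_mul, enorm_eq_nnnorm S]
    gcongr
    exact (enorm_integral_le_lintegral_enorm _).trans
      ((lintegral_mono_set Ioi_subset_Ici_self).trans le_add_self)

/-- The integrated form of `z = -(G[f₀] + G^T[f])`. -/
theorem integral_greenSum {m : ℕ} {t₀ T : ℝ} (hT : t₀ ≤ T) {γ : Fin m → ℂ}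
    (hγ : ∀ j, (γ j).re ≠ 0) {f₀ f : ℝ → ℂ} (hf₀ : LocallyIntegrableOn f₀ (Ici t₀))
    (h₀ : ∀ j, GreenConverges t₀ (γ j) f₀) (hf : LocallyIntegrableOn f (Ici T))
    (h : ∀ j, GreenConverges T (γ j) f) {t : ℝ} (ht : T ≤ t) :
    ∫ s in T..t, -(greenSum t₀ γ f₀ s + greenSum T γ f s) =
      -∑ j, (Gam γ j * γ j)⁻¹ * (greenOp t₀ (γ j) f₀ t + greenOp T (γ j) f t) +
        ∑ j, (Gam γ j * γ j)⁻¹ * (greenOp t₀ (γ j) f₀ T + greenOp T (γ j) f T) +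
        (∑ j, (Gam γ j * γ j)⁻¹) * ((∫ s in T..t, f₀ s) + ∫ s in T..t, f s) := by
  have hsub : Ici T ⊆ Ici t₀ := Ici_subset_Ici.2 hT
  have hγ0 : ∀ j, γ j ≠ 0 := fun j h0 => hγ j (by simp [h0])
  -- Dividing G_γ' = γ G_γ + f by Γ γ and summing expresses the integral of G through boundary
  -- values of the G_{γ_j} and the integral of the forcing.
  have h1 := IsPrimitiveOn.sum (s := Finset.univ) fun j _ =>
    (((isPrimitiveOn_greenOp (hγ j) hf₀ (h₀ j)).mono hT).add
      (isPrimitiveOn_greenOp (hγ j) hf (h j))).const_mul (Gam γ j * γ j)⁻¹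
  have h2 := h1.sub_eq le_rfl ht
  have hI₀ := intervalIntegrable_of_locallyIntegrableOn (hf₀.mono_set hsub) le_rfl ht
  have hI := intervalIntegrable_of_locallyIntegrableOn hf le_rfl ht
  have hc : IntervalIntegrable (fun s => greenSum t₀ γ f₀ s + greenSum T γ f s) volume T t := by
    refine ContinuousOn.intervalIntegrable ?_
    rw [uIcc_of_le ht]
    simp only [← greenJet_zero]
    exact (((continuousOn_greenJet hγ hf₀ h₀ 0).mono hsub).add
      (continuousOn_greenJet hγ hf h 0)).mono Icc_subset_Ici_self
  have h3 : ∀ s, ∑ j, (Gam γ j * γ j)⁻¹ * (γ j * greenOp t₀ (γ j) f₀ s + f₀ s +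
      (γ j * greenOp T (γ j) f s + f s)) = (greenSum t₀ γ f₀ s + greenSum T γ f s) +
        (∑ j, (Gam γ j * γ j)⁻¹) * (f₀ s + f s) := fun s => by
    rw [greenSum, greenSum, Finset.sum_mul, ← Finset.sum_add_distrib, ← Finset.sum_add_distrib]
    refine Finset.sum_congr rfl fun j _ => ?_
    rw [mul_inv]
    field_simp [hγ0 j]
    ring
  simp only [h3] at h2
  rw [intervalIntegral.integral_add hc ((hI₀.add hI).const_mul _),
    intervalIntegral.integral_const_mul, intervalIntegral.integral_add hI₀ hI] at h2
  rw [intervalIntegral.integral_neg]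
  linear_combination h2

/-- If the bound of the error term is finite, then the right hand side is integrable. -/
theorem integrableOn_of_lintegral_ne_top {T t : ℝ} {f l s : ℝ → ℂ}
    (hf : LocallyIntegrableOn f (Ici T)) (ht : T ≤ t) (hls : ∀ x ∈ Ici T, f x = l x + s x)
    (h : ∫⁻ x in Ici t, (‖l x‖ₑ + ‖s x‖ₑ) ≠ ∞) : IntegrableOn f (Ici T) := by
  rw [← Icc_union_Ici_eq_Ici ht]
  refine (hf.integrableOn_compact_subset Icc_subset_Ici_self isCompact_Icc).union
    ⟨(hf.mono_set (Ici_subset_Ici.2 ht)).aestronglyMeasurable, ?_⟩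
  refine lt_of_le_of_lt (setLIntegral_mono' measurableSet_Ici fun x hx => ?_)
    (lt_top_iff_ne_top.2 h)
  rw [hls x (ht.trans hx)]
  exact enorm_add_le _ _

/-- The asymptotic representation of the exponent. -/
theorem exists_error_term {m : ℕ} (d : Fin m → ℂ) (S : ℂ) {T : ℝ} {γ : Fin m → ℂ}
    {f l s : ℝ → ℂ} (hf : LocallyIntegrableOn f (Ici T))
    (hls : ∀ x ∈ Ici T, f x = l x + s x)
    (h0 : ∀ j, Tendsto (greenOp T (γ j) f) atTop (𝓝 0)) {v : ℝ → ℂ}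
    (hv : ∀ t ∈ Ici T, v t = Complex.exp (-∑ j, d j * greenOp T (γ j) f t -
      S * ((∫ x in Ioi T, f x) - ∫ x in T..t, f x))) :
    ∃ K : ℝ≥0, ∀ᶠ t in atTop, ‖v t - 1‖ₑ ≤ (K : ℝ≥0∞) *
      (∑ j, absGreenOp T ((γ j).re : ℂ) f t + ∫⁻ x in Ici t, (‖l x‖ₑ + ‖s x‖ₑ)) := by
  by_cases hfi : IntegrableOn f (Ici T)
  · obtain ⟨K, hK⟩ := exists_enorm_exp_sub_one_le d S hfi h0
    refine ⟨K, ?_⟩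
    filter_upwards [hK, eventually_ge_atTop T] with t ht htT
    have h1 : (∫ x in Ioi T, f x) - ∫ x in T..t, f x = ∫ x in Ioi t, f x := by
      rw [intervalIntegral.integral_of_le htT, ← Ioc_union_Ioi_eq_Ioi htT,
        setIntegral_union (Ioc_disjoint_Ioi le_rfl) measurableSet_Ioi
          (hfi.mono_set (Ioc_subset_Icc_self.trans Icc_subset_Ici_self))
          (hfi.mono_set ((Ioi_subset_Ioi htT).trans Ioi_subset_Ici_self))]
      ring
    rw [hv t htT, h1]
    refine ht.trans ?_
    gcongr (K : ℝ≥0∞) * (_ + ?_)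
    refine setLIntegral_mono' measurableSet_Ici fun x hx => ?_
    rw [hls x (htT.trans hx)]
    exact enorm_add_le _ _
  -- Without integrability the improper tail has no meaning, but then the tail of ‖l‖ + ‖s‖ is
  -- infinite and the bound holds trivially.
  · refine ⟨1, ?_⟩
    filter_upwards [eventually_ge_atTop T] with t ht
    have h1 : ∫⁻ x in Ici t, (‖l x‖ₑ + ‖s x‖ₑ) = ∞ := by
      by_contra h
      exact hfi (integrableOn_of_lintegral_ne_top hf ht hls h)
    simp [h1]

/-- Every γ_j is a root of Q, so each summand of G[f] is annihilated; the forcing enters Q(D)G[f]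
only through the true derivative of order n-1, which differs from `greenJet` by f. -/
theorem sum_taylor_mul_greenJet {n m : ℕ} {a : Fin n → ℂ} {lam : ℂ} {γ : Fin m → ℂ} {T t : ℝ}
    {f : ℝ → ℂ} (hlam : (charPoly a).IsRoot lam) (hmu : ∀ j, (charPoly a).IsRoot (lam + γ j))
    (hγ : ∀ j, γ j ≠ 0) :
    ∑ k ∈ Finset.Icc 1 n,
      (Polynomial.taylor lam (charPoly a)).coeff k * greenJet T γ f (k - 1) t = 0 := by
  simp only [greenJet, Finset.mul_sum]
  rw [Finset.sum_comm]
  refine Finset.sum_eq_zero fun j _ => ?_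
  have h := sum_taylor_mul_pow hlam (hmu j) (hγ j)
  rw [← mul_zero ((Gam γ j)⁻¹ * greenOp T (γ j) f t), ← h, Finset.mul_sum]
  refine Finset.sum_congr rfl fun k _ => ?_
  ring

end PoincarePerron

/-! ### Assembly of the solution and its asymptotics -/

open PoincarePerron

theorem mainTheorem8 (n : ℕ) (hn : 2 ≤ n) (t₀ : ℝ)
    (a : Fin n → ℂ) (r : Fin n → ℝ → ℂ)
    (hr : ∀ i, LocallyIntegrableOn (r i) (Ici t₀))
    -- the roots of the characteristic polynomial have pairwise distinct real parts
    (lam : ℂ) (mu : Fin (n - 1) → ℂ)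
    (hlam : (PoincarePerron.charPoly a).IsRoot lam)
    (hmu : ∀ j, (PoincarePerron.charPoly a).IsRoot (mu j))
    (hre : ∀ j, (mu j).re ≠ lam.re)
    (hinj : Function.Injective fun j => (mu j).re)
    (γ : Fin (n - 1) → ℂ) (hγ : ∀ j, γ j = mu j - lam)
    -- `G[P(r;lam)]` is defined, and it tends to `0` with its derivatives up to order `n - 2`
    (hconv : ∀ j, PoincarePerron.GreenConverges t₀ (γ j) (PoincarePerron.pertDeriv r lam 0))
    (hG : Tendsto (fun t => ∑ i ∈ Finset.range (n - 1),
      ‖PoincarePerron.jet t₀ (PoincarePerron.greenSum t₀ γ (PoincarePerron.pertDeriv r lam 0)) t i‖)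
      atTop (𝓝 0))
    -- integrability
    (p : ℝ) (hp1 : 1 < p) (hp2 : p ≤ 2)
    (hR : MemLp (PoincarePerron.remTheta a r lam γ t₀) (ENNReal.ofReal p)
      (volume.restrict (Ici t₀)))
    (q : ℕ → ℝ) (hq : ∀ k ∈ Finset.Icc 1 n, 1 < q k ∧ q k ≤ 2 ∧
      MemLp (PoincarePerron.pertDeriv r lam k) (ENNReal.ofReal (q k)) (volume.restrict (Ici t₀)))
    -- smallness
    (β : ℝ) (hβ0 : 0 < β) (hβ : ∀ j, β < |(γ j).re|)
    (hcl : PoincarePerron.SmallnessCondition r lam γ t₀ β) :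
    ∃ y : ℝ → ℂ, PoincarePerron.IsSolution a r t₀ y ∧
      (∀ i ∈ Finset.Icc 1 (n - 1),
        Tendsto (fun t => PoincarePerron.jet t₀ y t i / y t) atTop (𝓝 (lam ^ i))) ∧
      ∃ T : ℝ, t₀ ≤ T ∧ (∀ t ∈ Ici T, y t ≠ 0) ∧
      ∃ u : ℝ → ℂ,
        -- `u = z - θ` with `z = y'/y - lam`
        (∀ t ∈ Ici T, u t =
          PoincarePerron.jet t₀ y t 1 / y t - lam - PoincarePerron.theta r lam γ t₀ t) ∧
        -- the integral equation of `u`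
        (∀ t ∈ Ici T, u t =
          -(PoincarePerron.greenSum t₀ γ (PoincarePerron.remTheta a r lam γ t₀) t +
            PoincarePerron.greenSum T γ (fun s => PoincarePerron.linU r lam T u s +
              PoincarePerron.shiftU a r lam γ t₀ T u s) t)) ∧
        IntegrableOn (PoincarePerron.linU r lam T u) (Ici T) ∧
        ((∀ i < n - 1, MemLp (fun t => PoincarePerron.jet t₀ (PoincarePerron.theta r lam γ t₀) t i)
            (ENNReal.ofReal (p / (p - 1))) (volume.restrict (Ici t₀))) →
          IntegrableOn (PoincarePerron.shiftU a r lam γ t₀ T u) (Ici T)) ∧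
        ∃ ε : ℝ → ℂ,
          (∀ t ∈ Ici t₀, y t = (1 + ε t) * Complex.exp (lam * ((t : ℂ) - (t₀ : ℂ))) *
            Complex.exp (-∑ j : Fin (n - 1), (PoincarePerron.Gam γ j * γ j)⁻¹ *
              PoincarePerron.greenOp t₀ (γ j) (fun s => PoincarePerron.pertDeriv r lam 0 s +
                PoincarePerron.remTheta a r lam γ t₀ s) t) *
            Complex.exp ((-1) ^ n * (∏ k : Fin (n - 1), (mu k - lam)⁻¹) *
              ∫ s in t₀..t, (PoincarePerron.pertDeriv r lam 0 s +
                PoincarePerron.remTheta a r lam γ t₀ s))) ∧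
          ∃ K : ℝ≥0, ∀ᶠ t in atTop, ‖ε t‖ₑ ≤ (K : ℝ≥0∞) *
            (∑ j : Fin (n - 1), PoincarePerron.absGreenOp T ((γ j).re : ℂ)
                (fun s => PoincarePerron.linU r lam T u s +
                  PoincarePerron.shiftU a r lam γ t₀ T u s) t +
              ∫⁻ s in Ici t, (‖PoincarePerron.linU r lam T u s‖ₑ +
                ‖PoincarePerron.shiftU a r lam γ t₀ T u s‖ₑ)) := by
  have hγ0 : ∀ j, (γ j).re ≠ 0 := fun j => by
    rw [hγ, Complex.sub_re]; exact sub_ne_zero.2 (hre j)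
  have hγne : ∀ j, γ j ≠ 0 := fun j h0 => hγ0 j (by simp [h0])
  have hinjγ : Function.Injective γ := fun i j hij => hinj (by
    have := congrArg Complex.re hij
    simpa [hγ] using this)
  have hp0l := locallyIntegrableOn_pertDeriv hr lam 0
  have hΘ : ∀ k < n - 1, ∀ t ∈ Ici t₀, jet t₀ (theta r lam γ t₀) t k =
      -greenJet t₀ γ (pertDeriv r lam 0) k t := fun k hk t ht => by
    have h1 := jet_mul_greenJet hinjγ hγ0 hp0l hconv (-1) hk ht
    simp only [greenJet_zero, neg_one_mul] at h1
    exact h1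
  have hGj : ∀ k < n - 1, ∀ t ∈ Ici t₀, jet t₀ (greenSum t₀ γ (pertDeriv r lam 0)) t k =
      greenJet t₀ γ (pertDeriv r lam 0) k t := fun k hk t ht => by
    have h1 := jet_mul_greenJet hinjγ hγ0 hp0l hconv 1 hk ht
    simpa only [greenJet_zero, one_mul] using h1
  have hΘc : ∀ k < n - 1, ContinuousOn (fun t => jet t₀ (theta r lam γ t₀) t k) (Ici t₀) :=
    fun k hk => (continuousOn_greenJet hγ0 hp0l hconv k).neg.congr (hΘ k hk)
  have hΘ0 : Tendsto (fun t => ∑ k ∈ Finset.range (n - 1), ‖jet t₀ (theta r lam γ t₀) t k‖)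
      atTop (𝓝 0) := by
    refine hG.congr' ?_
    filter_upwards [eventually_ge_atTop t₀] with t ht
    refine Finset.sum_congr rfl fun k hk => ?_
    rw [hΘ k (Finset.mem_range.1 hk) t ht, hGj k (Finset.mem_range.1 hk) t ht, norm_neg]
  have hΘk : ∀ k < n - 1, Tendsto (fun t => jet t₀ (theta r lam γ t₀) t k) atTop (𝓝 0) :=
    fun k hk => squeeze_zero_norm (fun t => Finset.single_le_sum
      (f := fun k => ‖jet t₀ (theta r lam γ t₀) t k‖) (fun _ _ => norm_nonneg _)
      (Finset.mem_range.2 hk)) hΘ0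
  have hgl : LocallyIntegrableOn (remTheta a r lam γ t₀) (Ici t₀) :=
    (locallyIntegrableOn_linPart hr lam hΘc).add
      (locallyIntegrableOn_nonlinPart (by omega) a hr lam hΘc)
  obtain ⟨hgc, T, hT, u, f, hfl, hfeq, hfc, hf0, hju, hju0, hlinI, hshI⟩ :=
    exists_riccati_solution hn a hr lam hinjγ hΘc hΘ0 hp1 hp2 hgl hR hq hγ0
  have hf' : EqOn (fun s => linU r lam T u s + shiftU a r lam γ t₀ T u s) f (Ici T) :=
    fun s hs => (hfeq s hs).symm
  have hsub : Ici T ⊆ Ici t₀ := Ici_subset_Ici.2 hT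
  obtain ⟨f₀, hf₀⟩ : ∃ f₀, f₀ = fun s => pertDeriv r lam 0 s + remTheta a r lam γ t₀ s := ⟨_, rfl⟩
  have hf₀l : LocallyIntegrableOn f₀ (Ici t₀) := hf₀ ▸ hp0l.add hgl
  have hadd := fun j => GreenConverges.add hp0l hgl (hconv j) (hgc j)
  rw [← hf₀] at hadd
  have hf₀c : ∀ j, GreenConverges t₀ (γ j) f₀ := fun j => (hadd j).1
  have hJ : ∀ k, ∀ t ∈ Ici t₀, greenJet t₀ γ f₀ k t = greenJet t₀ γ (pertDeriv r lam 0) k t +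
      greenJet t₀ γ (remTheta a r lam γ t₀) k t := fun k t ht => by
    simp only [greenJet, (hadd _).2 t ht, mul_add, Finset.sum_add_distrib]
  -- the solution of the Riccati type equation
  let Z : ℝ → ℕ → ℂ := fun t i => -(greenJet t₀ γ f₀ i t + greenJet T γ f i t +
    if i = n - 1 then f₀ t + f t else 0)
  have hZs : ∀ k < n - 1, ∀ t ∈ Ici T,
      Z t k = jet T u t k + jet t₀ (theta r lam γ t₀) t k := fun k hk t ht => by
    simp only [Z]
    rw [if_neg (by omega), hju k hk t ht, hΘ k hk t (hsub ht), hJ k t (hsub ht)]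
    ring
  have hZ : ∀ i < n - 1, IsPrimitiveOn T (fun t => Z t i) (fun t => Z t (i + 1)) := fun i hi => by
    have h1 := (((isPrimitiveOn_greenJet hinjγ hγ0 hf₀l hf₀c hi).mono hT).add
      (isPrimitiveOn_greenJet hinjγ hγ0 hfl hfc hi)).const_mul (-1)
    refine h1.congr (fun t _ => ?_) fun t _ => ?_
    · simp only [Z]
      rw [if_neg (by omega)]
      ring
    · simp only [Z]
      split_ifs <;> ring
  have hroot : ∀ j, (charPoly a).IsRoot (lam + γ j) := fun j => by
    rw [hγ, add_sub_cancel]; exact hmu j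
  have heq : ∀ t ∈ Ici T, pertDeriv r lam 0 t +
      ∑ k ∈ Finset.Icc 1 n, (Polynomial.taylor lam (charPoly a)).coeff k * Z t (k - 1) +
        linPart r lam t (Z t) + nonlinPart a r lam t (Z t) = 0 := fun t ht => by
    -- The Green parts cancel since the γ_j are roots of Q; the forcing survives only at k = n,
    -- where the coefficient is 1.
    have h1 : ∑ k ∈ Finset.Icc 1 n, (Polynomial.taylor lam (charPoly a)).coeff k * Z t (k - 1) =
        -(f₀ t + f t) := by
      simp only [Z, mul_neg, mul_add, Finset.sum_neg_distrib, Finset.sum_add_distrib,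
        sum_taylor_mul_greenJet hlam hroot hγne, zero_add]
      rw [Finset.sum_eq_single_of_mem n (Finset.mem_Icc.2 (by omega)) fun k hk hkn => ?_,
        if_pos rfl, coeff_taylor_charPoly, one_mul]
      have := Finset.mem_Icc.1 hk
      rw [if_neg (by omega), mul_zero]
    have h2 : linPart r lam t (Z t) =
        linPart r lam t (jet T u t) + linPart r lam t (jet t₀ (theta r lam γ t₀) t) := by
      rw [← linPart_add]
      exact linPart_congr r lam t fun k hk => hZs k hk t ht
    have h3 : nonlinPart a r lam t (Z t) =
        nonlinPart a r lam t (jet T u t + jet t₀ (theta r lam γ t₀) t) :=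
      nonlinPart_congr (by omega) a r lam t fun k hk => hZs k hk t ht
    rw [h1, h2, h3, hfeq t ht, hf₀]
    simp only [remTheta, remPart, shiftedNonlin]
    ring
  -- the solution of the linear equation
  obtain ⟨S, hS⟩ : ∃ S, S = ∑ j, (Gam γ j * γ j)⁻¹ := ⟨_, rfl⟩
  have hS' : (-1) ^ n * ∏ k : Fin (n - 1), (mu k - lam)⁻¹ = S := by
    rw [hS, sum_inv_Gam_mul (by omega) hinjγ hγne, Nat.sub_add_cancel (by omega)]
    simp only [hγ]
  -- c₁ collects the boundary values at `T` from integrating z. The constant in front of y removes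
  -- them and restores ∫_{t₀}^T f₀, and its last term turns ∫_T^t f into minus a tail. If `f` is not
  -- integrable, that term is 0 by convention, which does no harm.
  let c₁ : ℂ := ∑ j, (Gam γ j * γ j)⁻¹ * (greenOp t₀ (γ j) f₀ T + greenOp T (γ j) f T)
  obtain ⟨y, hy, hyj⟩ := exists_solution_of_riccati hn hr hT hlam hZ heq
    (Complex.exp (lam * (T - t₀) - c₁ + S * (∫ s in t₀..T, f₀ s) - S * ∫ s in Ioi T, f s))
  have hy0 : ∀ t ∈ Ici T, y t = Complex.exp (lam * (T - t₀) - c₁ + S * (∫ s in t₀..T, f₀ s) -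
      S * ∫ s in Ioi T, f s) * Complex.exp (∫ s in T..t, (lam + Z s 0)) := fun t ht => by
    have h1 := hyj 0 (by omega) t ht
    rwa [expBell_zero, mul_one, jet, iteratedDerivWithin_zero] at h1
  have hyne : ∀ t ∈ Ici T, y t ≠ 0 := fun t ht => by
    rw [hy0 t ht]
    exact mul_ne_zero (Complex.exp_ne_zero _) (Complex.exp_ne_zero _)
  have hyq : ∀ i ≤ n - 1, ∀ t ∈ Ici T, jet t₀ y t i / y t = expBell lam (Z t) i :=
    fun i hi t ht => by
      rw [hyj i hi t ht, ← hy0 t ht, mul_div_cancel_left₀ _ (hyne t ht)]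
  have hZ0 : ∀ k < n - 1, Tendsto (fun t => Z t k) atTop (𝓝 0) := fun k hk => by
    have h1 := (hju0 k hk).add (hΘk k hk)
    rw [add_zero] at h1
    refine h1.congr' ?_
    filter_upwards [eventually_ge_atTop T] with t ht using (hZs k hk t ht).symm
  have hju1 : ∀ t ∈ Ici T, jet T u t 0 = u t := fun t _ => by simp [jet]
  have hΘ1 : ∀ t, jet t₀ (theta r lam γ t₀) t 0 = theta r lam γ t₀ t := fun t => by simp [jet]
  refine ⟨y, hy, fun i hi => ?_, T, hT, hyne, u, fun t ht => ?_, fun t ht => ?_, hlinI, hshI, ?_⟩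
  · have hi := Finset.mem_Icc.1 hi
    refine (tendsto_expBell i fun k hk => hZ0 k (by omega)).congr' ?_
    filter_upwards [eventually_ge_atTop T] with t ht using (hyq i hi.2 t ht).symm
  · rw [hyq 1 (by omega) t ht, expBell_one, hZs 0 (by omega) t ht, hju1 t ht, hΘ1]
    ring
  · rw [← hju1 t ht, hju 0 (by omega) t ht, greenJet_zero, ← greenJet_zero T,
      greenJet_congr hf']
  -- E is the claimed leading factor. It never vanishes, so ε = y/E - 1 makes the representation an
  -- identity on [t₀,∞), and only the bound on ε needs the formula for y beyond `T`.
  · let E : ℝ → ℂ := fun t => Complex.exp (lam * ((t : ℂ) - (t₀ : ℂ))) *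
      Complex.exp (-∑ j : Fin (n - 1), (Gam γ j * γ j)⁻¹ * greenOp t₀ (γ j) f₀ t) *
      Complex.exp (S * ∫ s in t₀..t, f₀ s)
    have hE : ∀ t, E t ≠ 0 := fun t =>
      mul_ne_zero (mul_ne_zero (Complex.exp_ne_zero _) (Complex.exp_ne_zero _))
        (Complex.exp_ne_zero _)
    refine ⟨fun t => y t / E t - 1, fun t _ => ?_, ?_⟩
    · rw [hS', ← hf₀, add_sub_cancel, mul_assoc (y t / E t), mul_assoc (y t / E t)]
      exact (div_mul_cancel₀ _ (hE t)).symm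
    · have hv : ∀ t ∈ Ici T, y t / E t = Complex.exp (-∑ j, (Gam γ j * γ j)⁻¹ *
          greenOp T (γ j) f t - S * ((∫ x in Ioi T, f x) - ∫ x in T..t, f x)) := fun t ht => by
        have h1 : ∫ s in T..t, (lam + Z s 0) = lam * (t - T) +
            ∫ s in T..t, -(greenSum t₀ γ f₀ s + greenSum T γ f s) := by
          have h2 : ∀ s, Z s 0 = -(greenSum t₀ γ f₀ s + greenSum T γ f s) := fun s => by
            simp only [Z, greenJet_zero]
            rw [if_neg (by omega), add_zero]
          simp only [← h2]
          rw [intervalIntegral.integral_add (by simp) (intervalIntegrable_of_locallyIntegrableOn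
            ((hZ 0 (by omega)).continuousOn.locallyIntegrableOn measurableSet_Ici) le_rfl ht),
            intervalIntegral.integral_const, Complex.real_smul]
          push_cast
          ring
        have h2 := intervalIntegral.integral_add_adjacent_intervals
          (intervalIntegrable_of_locallyIntegrableOn hf₀l le_rfl hT)
          (intervalIntegrable_of_locallyIntegrableOn hf₀l hT (hsub ht))
        rw [div_eq_iff (hE t), hy0 t ht, h1,
          integral_greenSum hT hγ0 hf₀l hf₀c hfl hfc ht, ← hS]
        simp only [E, ← Complex.exp_add]
        rw [← h2]
        congr 1
        simp only [mul_add, Finset.sum_add_distrib, c₁]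
        ring
      obtain ⟨K, hK⟩ := exists_error_term (fun j => (Gam γ j * γ j)⁻¹) S hfl hfeq hf0
        (v := fun t => y t / E t) hv
      refine ⟨K, ?_⟩
      filter_upwards [hK] with t ht
      simp only [absGreenOp_congr hf']
      exact ht
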